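/- A system $(X,\mathcal X,\mu,T_1,\dots,T_\ell)$ consists of a standard Borel probability space $(X,\mathcal X,\mu)$ and commuting invertible measure-preserving transformations $T_1,\dots,T_\ell\colon X\to X$, $\ell\ge 1$. It is ergodic if every set in $\mathcal X$ that is invariant under all of $T_1,\dots,T_\ell$ has measure $0$ or $1$. Equalities of sets, functions and $\sigma$-algebras are understood up to sets of measure zero. For commuting invertible measure-preserving transformations $R_1,\dots,R_s$ of $(X,\mathcal X,\mu)$, let $Z(R_1,\dots,R_s)$ be the closed linear span in $L^2(\mu)$ of all dual functions $$\lim_{H\to\infty}\frac1{H^s}\sum_{h\in\{1,\dots,H\}^s}\ \prod_{\epsilon\in\{0,1\}^s\setminus\{0\}}\mathcal C^{|\epsilon|}\, f_\epsilon\circ\bigl(R_1^{\epsilon_1h_1}\cdots R_s^{\epsilon_sh_s}\bigr)$$ (limits in $L^2(\mu)$), where $f_\epsilon\in L^\infty(\mu)$ for $\epsilon\in\{0,1\}^s\setminus\{0\}$, $\mathcal C$ is complex conjugation and $|\epsilon|=\epsilon_1+\dots+\epsilon_s$. Let $\mathcal Z(R_1,\dots,R_s)\subseteq\mathcal X$ be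 the $\sigma$-algebra generated by the sets $E\in\mathcal X$ with $\mathbf 1_E\in Z(R_1,\dots,R_s)$. Write $\mathcal Z_1(R):=\mathcal Z(R,R)$, and let $\mathcal I(R)$ be the $\sigma$-algebra of $R$-invariant sets in $\mathcal X$. A factor map from a system $(Y,\mathcal Y,\nu,S_1,\dots,S_\ell)$ to a system $(W,\mathcal W,\omega,Q_1,\dots,Q_\ell)$ is a measurable map $q\colon Y\to W$ with $q_*\nu=\omega$ and $q\circ S_i=Q_i\circ q$ $\nu$-almost everywhere for all $i$. For a sub-$\sigma$-algebra $\mathcal A\subseteq\mathcal X$, we say that $(Y,\mathcal Y,\nu,S_1,\dots,S_\ell)$ is an extension of $(X,\mathcal A,\mu,T_1,\dots,T_\ell)$ if there are a system $(W,\mathcal W,\omega,Q_1,\dots,Q_\ell)$, a factor map $p$ from $(X,\mathcal X,\mu,T_1,\dots,T_\ell)$ to it with $p^{-1}(\mathcal W)=\mathcal A$ (so that it is a realisation of $(X,\mathcal A,\mu,T_1,\dots,T_\ell)$ on a standard Borel space), and a factor map $q\colon Y\to W$. **Theorem (Existence of a structured extension).** Let $(X,\mathcal X,\mu,T_1,\dots,T_\ell)$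 be an ergodic system and let $\mathcal Z:=\mathcal Z(T_1,\dots,T_{\ell-1},T_\ell,T_\ell)$. Then $(X,\mathcal Z,\mu,T_1,\dots,T_\ell)$ admits an ergodic extension $(Y,\mathcal Y,\nu,S_1,\dots,S_\ell)$ satisfying $$\mathcal Y=\mathcal I(S_1)\vee\cdots\vee\mathcal I(S_{\ell-1})\vee\mathcal Z_1(S_\ell).$$ -/

import Mathlib

open MeasureTheory Filter Topology
open scoped ENNReal

noncomputable section

/-- `T 0, …, T (ℓ-1)` are commuting invertible (bimeasurable) `μ`-preserving transformations.
Together with a standard Borel probability space this is a system `(X, 𝒳, μ, T₁, …, T_ℓ)`. -/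
structure IsSystem {ℓ : ℕ} {X : Type*} [MeasurableSpace X] (μ : Measure X)
    (T : Fin ℓ → X ≃ᵐ X) : Prop where
  commute : ∀ i j x, T i (T j x) = T j (T i x)
  measurePreserving : ∀ i, MeasurePreserving (T i) μ μ

/-- Ergodicity of the joint action: a measurable set invariant under all the `T i` has measure
zero or one. -/
def IsJointlyErgodic {ℓ : ℕ} {X : Type*} [MeasurableSpace X] (μ : Measure X)
    (T : Fin ℓ → X ≃ᵐ X) : Prop :=
  ∀ E : Set X, MeasurableSet E → (∀ i, T i ⁻¹' E = E) → μ E = 0 ∨ μ E = 1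

/-- The point `R₁^{k₁} ⋯ R_s^{k_s} x`. -/
def cubePoint {s : ℕ} {X : Type*} [MeasurableSpace X] (R : Fin s → X ≃ᵐ X)
    (k : Fin s → ℕ) (x : X) : X :=
  (List.ofFn fun i => ((R i).toEquiv : Equiv.Perm X) ^ k i).prod x

/-- The truncated dual function
`𝔼_{h ∈ [H]^s} ∏_{ε ∈ {0,1}^s \ {0}} 𝒞^{|ε|} f_ε(R₁^{ε₁ h₁} ⋯ R_s^{ε_s h_s} x)`,
where `[H] = {1, …, H}` and `𝒞` is complex conjugation. -/
def dualAverage {s : ℕ} {X : Type*} [MeasurableSpace X] (R : Fin s → X ≃ᵐ X)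
    (f : (Fin s → Fin 2) → X → ℂ) (H : ℕ) (x : X) : ℂ :=
  ((H : ℂ) ^ s)⁻¹ *
    ∑ h ∈ Fintype.piFinset (fun _ : Fin s => Finset.Icc 1 H),
      ∏ ε ∈ Finset.univ.filter (fun ε : Fin s → Fin 2 => ε ≠ 0),
        (starRingEnd ℂ)^[∑ i, (ε i : ℕ)] (f ε (cubePoint R (fun i => (ε i : ℕ) * h i) x))

/-- `g ∈ L²(μ)` is a dual function along `R₁, …, R_s`: the `L²(μ)`-limit of the truncated dual
functions of some bounded functions `f_ε`, `ε ∈ {0,1}^s \ {0}`. (The value of `f` at `ε = 0` plays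
no role.) -/
def IsDualFunction {s : ℕ} {X : Type*} [MeasurableSpace X] (μ : Measure X)
    (R : Fin s → X ≃ᵐ X) (g : Lp ℂ 2 μ) : Prop :=
  ∃ f : (Fin s → Fin 2) → X → ℂ, (∀ ε, MemLp (f ε) ∞ μ) ∧
    Tendsto (fun H : ℕ => eLpNorm (fun x => dualAverage R f H x - g x) 2 μ) atTop (𝓝 0)

/-- The space `Z(R₁, …, R_s)`: the closed linear span in `L²(μ)` of the dual functions. -/
def boxSpace {s : ℕ} {X : Type*} [MeasurableSpace X] (μ : Measure X)
    (R : Fin s → X ≃ᵐ X) : Submodule ℂ (Lp ℂ 2 μ) :=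
  (Submodule.span ℂ {g | IsDualFunction μ R g}).topologicalClosure

/-- The box factor `𝒵(R₁, …, R_s)`: the σ-algebra generated by the measurable sets whose indicator
function belongs to `Z(R₁, …, R_s)`. It contains the measurable null sets. -/
@[reducible]
def boxFactor {s : ℕ} {X : Type*} [MeasurableSpace X] (μ : Measure X) [IsFiniteMeasure μ]
    (R : Fin s → X ≃ᵐ X) : MeasurableSpace X :=
  MeasurableSpace.generateFrom
    {E | ∃ hE : MeasurableSet E,
      indicatorConstLp 2 hE (measure_ne_top μ E) (1 : ℂ) ∈ boxSpace μ R}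

/-- The Host-Kra factor `𝒵₁(R) = 𝒵(R, R)` of degree one. -/
@[reducible]
def hostKraFactorOne {X : Type*} [MeasurableSpace X] (μ : Measure X) [IsFiniteMeasure μ]
    (R : X ≃ᵐ X) : MeasurableSpace X :=
  boxFactor μ (fun _ : Fin 2 => R)

/-- Equality of two σ-algebras up to sets of measure zero. -/
def EqModNull {X : Type*} [MeasurableSpace X] (μ : Measure X) (m₁ m₂ : MeasurableSpace X) : Prop :=
  (∀ E, MeasurableSet[m₁] E → ∃ F, MeasurableSet[m₂] F ∧ E =ᵐ[μ] F) ∧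
    ∀ F, MeasurableSet[m₂] F → ∃ E, MeasurableSet[m₁] E ∧ F =ᵐ[μ] E

/-- `π` is a factor map from `(Y, ν, S)` to `(X, μ, T)`. -/
structure IsFactorMap {ℓ : ℕ} {Y X : Type*} [MeasurableSpace Y] [MeasurableSpace X]
    (ν : Measure Y) (S : Fin ℓ → Y ≃ᵐ Y) (μ : Measure X) (T : Fin ℓ → X ≃ᵐ X)
    (π : Y → X) : Prop where
  measurePreserving : MeasurePreserving π ν μ
  equivariant : ∀ i, ∀ᵐ y ∂ν, π (S i y) = T i (π y)

/-- The system `(Y, ν, S)` is an extension of `(X, 𝒵, μ, T)`, for a sub-σ-algebra `𝒵` of `X`: the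
factor of `(X, μ, T)` given by `𝒵` is realised by a system `(W, ω, R)` on a standard Borel space,
through a factor map `p : X → W` with `p⁻¹(Borel W) = 𝒵` modulo null sets, and there is a factor
map `q : Y → W`. -/
def IsExtensionOfFactor {ℓ : ℕ} {Y X : Type*} (𝒵 : MeasurableSpace X) [MeasurableSpace Y]
    [MeasurableSpace X] (ν : Measure Y) (S : Fin ℓ → Y ≃ᵐ Y) (μ : Measure X)
    (T : Fin ℓ → X ≃ᵐ X) : Prop :=
  ∃ (W : Type) (_ : MeasurableSpace W) (_ : StandardBorelSpace W)
    (ω : Measure W) (_ : IsProbabilityMeasure ω) (R : Fin ℓ → W ≃ᵐ W) (p : X → W) (q : Y → W),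
    IsSystem ω R ∧ IsFactorMap μ T ω R p ∧
    EqModNull μ (MeasurableSpace.comap p inferInstance) 𝒵 ∧ IsFactorMap ν S ω R q

end

/-! Write a for the last index and L for the list of the others. First 𝒵 is made measurable for a
structured σ-algebra on some extension; then the extension is made ergodic and generated by its
structure.

Box extension. Pass to the relatively independent self-product of μ over the T_i-invariant sets and
replace f by f ⊗ conj f: this removes T_i from the box seminorm (`BoxLE.of_relProd`). Lift T_i as
T_i × id and every other T_j diagonally; then the surplus factor conj f(x₂) is invariant under the
lift of T_i. Repeating this for all i in L (`exists_isBoxExtension`) gives π : Y → X such that the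
seminorm of f along T_a, T_a and the T_i is controlled by that of (f ∘ π) · F along S_a, S_a alone,
with F measurable for the join of the invariant σ-algebras of the S_i. The maps id × T_i are carried
along; they act on the fibres of π, and a function invariant under them comes from X, because the
measures of the disintegration over the T_i-invariant sets are ergodic.

Order two. A bounded function orthogonal to every g with g ∘ S = θ g, where θ is S-invariant and
unimodular, has vanishing seminorm along S, S (`boxLE_pair_of_orthogonal`). Since S need not be
ergodic, this is a fibrewise Wiener lemma: if the mean square correlations on an ergodic fibre are
large, some twisted average is large there by Parseval; a measurable choice of limiting frequencies
and the mean ergodic theorem then produce a correlated eigenfunction.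

Descent. Let B be the join of the S_i-invariant sets, i in L, with the σ-algebra of the generalised
eigenfunctions of S_a. The fibre maps preserve B, so E[f ∘ π | B] = v ∘ π for some v on X. By the
above f - v has vanishing seminorm, and van der Corput makes it orthogonal to all dual functions. As
conditional expectation is self-adjoint, it follows that dual functions, and with them 𝒵, are
B-measurable on Y (`IsBoxExtension.aestronglyMeasurable_boxSpace`).

Ergodicity. Y may be larger than B and need not be ergodic. Countably many invariant functions and
eigenfunctions account for the countably many sets that generate 𝒵 modulo null sets; coding Y by
their values along ℤ^ℓ-orbits gives a shift system all of whose coordinates are structured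
(`exists_structured_extension`). Almost every ergodic component still maps onto the realisation of
𝒵, because that realisation is ergodic, and inherits the countably many almost everywhere identities
that make the coordinates structured. Finally eigenfunctions are measurable for 𝒵₁(S_a), being dual
functions built from their own conjugates (`IsEig.measurable_hostKra`). -/

noncomputable section

open ProbabilityTheory
open scoped ComplexConjugate

/-! ### Strictly invariant sets, and their relation to almost everywhere invariance. -/

section JointInvariants

variable {ι Y : Type*} [mY : MeasurableSpace Y]

/-- The σ-algebra of measurable sets that are strictly invariant under every `S i`. -/
@[reducible]
def jointInv (S : ι → Y ≃ᵐ Y) : MeasurableSpace Y where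
  MeasurableSet' E := MeasurableSet[mY] E ∧ ∀ i, S i ⁻¹' E = E
  measurableSet_empty := by simp
  measurableSet_compl E h := ⟨h.1.compl, fun i => by rw [Set.preimage_compl, h.2 i]⟩
  measurableSet_iUnion f h := ⟨MeasurableSet.iUnion fun n => (h n).1, fun i => by
    rw [Set.preimage_iUnion]; exact Set.iUnion_congr fun n => (h n).2 i⟩

theorem jointInv_le (S : ι → Y ≃ᵐ Y) : jointInv S ≤ mY := fun _ h => h.1

theorem jointInv_unit (S : Y ≃ᵐ Y) :
    jointInv (fun _ : Unit => S) = MeasurableSpace.invariants S := by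
  ext E
  exact ⟨fun h => ⟨h.1, h.2 ()⟩, fun h => ⟨h.1, fun _ => h.2⟩⟩

theorem jointInv_apply_eq {β : Type*} [MeasurableSpace β] [MeasurableSingletonClass β]
    {S : ι → Y ≃ᵐ Y} {u : Y → β} (hu : Measurable[jointInv S] u) (i : ι) (y : Y) :
    u (S i y) = u y := by
  have h : MeasurableSet[jointInv S] (u ⁻¹' {u y}) := hu (measurableSet_singleton _)
  have : y ∈ S i ⁻¹' (u ⁻¹' {u y}) := by rw [h.2 i]; rfl
  exact this

theorem measurable_jointInv {β : Type*} [MeasurableSpace β]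
    {S : ι → Y ≃ᵐ Y} {u : Y → β} (hu : Measurable u) (h : ∀ i y, u (S i y) = u y) :
    Measurable[jointInv S] u := fun s hs =>
  ⟨hu hs, fun i => by ext y; simp [h i y]⟩

/-- The action of a word in the letters `S i` and their inverses. -/
def wordMap (S : ι → Y ≃ᵐ Y) : List (ι × Bool) → Y → Y
  | [], y => y
  | (i, b) :: w, y => wordMap S w (if b then S i y else (S i).symm y)

theorem wordMap_quasi {S : ι → Y ≃ᵐ Y} {ν : Measure Y} (hS : ∀ i, MeasurePreserving (S i) ν ν)
    (w : List (ι × Bool)) : MeasurePreserving (wordMap S w) ν ν := by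
  induction w with
  | nil => exact MeasurePreserving.id ν
  | cons a w ih =>
    obtain ⟨i, b⟩ := a
    cases b
    · simpa [wordMap, Function.comp_def] using ih.comp ((hS i).symm)
    · simpa [wordMap, Function.comp_def] using ih.comp (hS i)

/-- An almost everywhere invariant function agrees almost everywhere with a strictly invariant
one. -/
theorem exists_jointInv_ae_eq [Countable ι] {S : ι → Y ≃ᵐ Y} {ν : Measure Y}
    (hS : ∀ i, MeasurePreserving (S i) ν ν) {u : Y → ℂ} (hu : Measurable u)
    (h : ∀ i, ∀ᵐ y ∂ν, u (S i y) = u y) :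
    ∃ u' : Y → ℂ, Measurable[jointInv S] u' ∧ u =ᵐ[ν] u' := by
  classical
  -- On N the function u is constant along the whole orbit. The words contain inverses, so N is
  -- invariant in both directions, and there are countably many words, so N is conull; outside N the
  -- function can be set to 0.
  set N : Set Y := {y | ∀ w, u (wordMap S w y) = u y} with hN
  have hNmeas : MeasurableSet N := by
    rw [hN, Set.ofPred_forall]
    exact MeasurableSet.iInter fun w =>
      measurableSet_eq_fun (hu.comp (wordMap_quasi hS w).measurable) hu
  have hword : ∀ w, ∀ᵐ y ∂ν, u (wordMap S w y) = u y := by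
    intro w
    induction w with
    | nil => exact Eventually.of_forall fun y => rfl
    | cons a w ih =>
      obtain ⟨i, b⟩ := a
      cases b
      · have h1 := (hS i).symm.quasiMeasurePreserving.ae ih
        have h2 := (hS i).symm.quasiMeasurePreserving.ae (h i)
        filter_upwards [h1, h2] with y h1 h2
        simp only [wordMap, Bool.false_eq_true, if_false]
        rw [h1, ← h2]; simp
      · have h1 := (hS i).quasiMeasurePreserving.ae ih
        filter_upwards [h1, h i] with y h1 h2
        simp only [wordMap, if_true]
        rw [h1, h2]
  have hNae : ∀ᵐ y ∂ν, y ∈ N := by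
    rw [hN]; exact ae_all_iff.2 hword
  have hNinv : ∀ i y, S i y ∈ N ↔ y ∈ N := by
    intro i y
    constructor
    · intro hy w
      have h1 := hy ((i, false) :: w)
      have h2 := hy [(i, false)]
      simp only [wordMap, Bool.false_eq_true, if_false, MeasurableEquiv.symm_apply_apply] at h1 h2
      rw [h1, h2]
    · intro hy w
      have h1 := hy ((i, true) :: w)
      have h2 := hy [(i, true)]
      simp only [wordMap, if_true] at h1 h2
      rw [h1, h2]
  refine ⟨N.indicator u, measurable_jointInv (hu.indicator hNmeas) fun i y => ?_, ?_⟩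
  · by_cases hy : y ∈ N
    · rw [Set.indicator_of_mem hy, Set.indicator_of_mem ((hNinv i y).2 hy)]
      simpa [wordMap] using hy [(i, true)]
    · rw [Set.indicator_of_notMem hy, Set.indicator_of_notMem (fun h => hy ((hNinv i y).1 h))]
  · filter_upwards [hNae] with y hy
    rw [Set.indicator_of_mem hy]

/-- Conditional expectation commutes with a measure-preserving equivalence that preserves the
σ-algebra. -/
theorem condExp_comp_equiv {ν : Measure Y} [IsFiniteMeasure ν] {U : Y ≃ᵐ Y}
    (hU : MeasurePreserving U ν ν) {m : MeasurableSpace Y} (hm : m ≤ mY) (h1 : m.comap U = m) {f : Y → ℂ}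
    (hf : Integrable f ν) :
    ν[f ∘ U|m] =ᵐ[ν] ν[f|m] ∘ U := by
  have hemb := @MeasurableEquiv.measurableEmbedding Y Y mY mY U
  have hUm : Measurable[m, m] U := by
    rw [measurable_iff_comap_le, h1]
  have hint : ∀ {v : Y → ℂ}, Integrable v ν → Integrable (v ∘ U) ν := fun hv =>
    (@MeasurePreserving.integrable_comp_emb Y Y ℂ mY ν mY _ _ U ν hU hemb _).2 hv
  symm
  refine ae_eq_condExp_of_forall_setIntegral_eq hm (hint hf) ?_ ?_ ?_
  · intro s hs _
    exact (hint integrable_condExp).integrableOn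
  · intro s hs _
    rw [← h1] at hs
    obtain ⟨t, ht, rfl⟩ := hs
    have e1 := hU.setIntegral_preimage_emb hemb f t
    have e2 := hU.setIntegral_preimage_emb hemb (ν[f|m]) t
    simp only [Function.comp_def]
    rw [e1, e2, setIntegral_condExp hm hf ht]
  · exact (stronglyMeasurable_condExp.comp_measurable hUm).aestronglyMeasurable

theorem jointInv_comap (S : ι → Y ≃ᵐ Y) {U : Y ≃ᵐ Y} (hU : ∀ i y, U (S i y) = S i (U y)) :
    (jointInv S).comap U = jointInv S := by
  refine le_antisymm ?_ fun E hE => ⟨U.symm ⁻¹' E, ⟨U.symm.measurable hE.1, fun i => ?_⟩, by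
    rw [← Set.preimage_comp]; simp⟩
  · rintro _ ⟨E, hE, rfl⟩
    refine ⟨U.measurable hE.1, fun i => ?_⟩
    ext y
    have : S i (U y) ∈ E ↔ U y ∈ E := by
      conv_rhs => rw [← hE.2 i]
      rfl
    simp [hU, this]
  · ext y
    have h1 : U.symm (S i y) = S i (U.symm y) := by
      apply U.injective
      rw [hU]; simp
    have : S i (U.symm y) ∈ E ↔ U.symm y ∈ E := by
      conv_rhs => rw [← hE.2 i]
      rfl
    simp [h1, this]

/-- An invariant set is its own preimage, so integrals over it do not change when f is composed with
`S i`. -/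
theorem condExp_jointInv_comp {S : ι → Y ≃ᵐ Y} {ν : Measure Y} [IsFiniteMeasure ν] {i : ι} (hS : MeasurePreserving (S i) ν ν)
    {f : Y → ℂ} (hf : Integrable f ν) :
    ν[f ∘ S i|jointInv S] =ᵐ[ν] ν[f|jointInv S] := by
  have h := jointInv_le S
  set g := ν[f|jointInv S] with hg
  have hgm : Measurable[jointInv S] g := stronglyMeasurable_condExp.measurable
  symm
  refine ae_eq_condExp_of_forall_setIntegral_eq h (hS.integrable_comp_of_integrable hf)
    (fun s _ _ => integrable_condExp.integrableOn) ?_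
    stronglyMeasurable_condExp.aestronglyMeasurable
  intro s hs _
  have e1 := hS.setIntegral_preimage_emb (S i).measurableEmbedding f s
  rw [hs.2 i] at e1
  simp only [Function.comp_def]
  rw [e1, setIntegral_condExp h hf hs]

end JointInvariants

/-! ### The mean ergodic theorem for weighted averaging operators. -/

section MeanErgodic

variable {ι Y : Type*} [MeasurableSpace Y]

/-- Weighted averaging operator. -/
def wavg [Fintype ι] (w : ι → Y → ℂ) (S : ι → Y ≃ᵐ Y) (u : Y → ℂ) : Y → ℂ :=
  fun y => ∑ i, w i y * u (S i y)

/-- Cesàro averages of the weighted averaging operator. -/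
def bavg [Fintype ι] (w : ι → Y → ℂ) (S : ι → Y ≃ᵐ Y) (n : ℕ) (u : Y → ℂ) : Y → ℂ :=
  fun y => (n : ℂ)⁻¹ * ∑ k ∈ Finset.range n, ((wavg w S)^[k] u) y

variable [Fintype ι] {w : ι → Y → ℂ} {S : ι → Y ≃ᵐ Y} {ν : Measure Y}

theorem wavg_congr (hS : ∀ i, MeasurePreserving (S i) ν ν) {u v : Y → ℂ} (h : u =ᵐ[ν] v) :
    wavg w S u =ᵐ[ν] wavg w S v := by
  have : ∀ i, ∀ᵐ y ∂ν, u (S i y) = v (S i y) := fun i => (hS i).quasiMeasurePreserving.ae h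
  filter_upwards [ae_all_iff.2 this] with y hy
  simp [wavg, hy]

theorem eLpNorm_mul_comp_le (hS : ∀ i, MeasurePreserving (S i) ν ν)
    (hwb : ∀ i y, ‖w i y‖ ≤ (Fintype.card ι : ℝ)⁻¹) {u : Y → ℂ} (hu : MemLp u 2 ν) (i : ι) :
    eLpNorm (fun y => w i y * u (S i y)) 2 ν ≤
      ENNReal.ofReal ((Fintype.card ι : ℝ)⁻¹) * eLpNorm u 2 ν := by
  have h2 := eLpNorm_le_mul_eLpNorm_of_ae_le_mul (μ := ν) (f := fun y => w i y * u (S i y))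
    (g := u ∘ S i) (c := (Fintype.card ι : ℝ)⁻¹) (Eventually.of_forall fun y => by
      simp only [norm_mul, Function.comp]
      exact mul_le_mul_of_nonneg_right (hwb i y) (norm_nonneg _)) 2
  rwa [eLpNorm_comp_measurePreserving hu.1 (hS i)] at h2

theorem memLp_mul_comp (hS : ∀ i, MeasurePreserving (S i) ν ν) (hw : ∀ i, Measurable (w i))
    (hwb : ∀ i y, ‖w i y‖ ≤ (Fintype.card ι : ℝ)⁻¹) {u : Y → ℂ} (hu : MemLp u 2 ν) (i : ι) :
    MemLp (fun y => w i y * u (S i y)) 2 ν := by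
  refine ⟨(hw i).aestronglyMeasurable.mul (hu.1.comp_measurePreserving (hS i)), ?_⟩
  exact (eLpNorm_mul_comp_le hS hwb hu i).trans_lt (ENNReal.mul_lt_top (by simp) hu.2)

theorem memLp_wavg (hS : ∀ i, MeasurePreserving (S i) ν ν) (hw : ∀ i, Measurable (w i))
    (hwb : ∀ i y, ‖w i y‖ ≤ (Fintype.card ι : ℝ)⁻¹) {u : Y → ℂ} (hu : MemLp u 2 ν) :
    MemLp (wavg w S u) 2 ν :=
  memLp_finsetSum _ fun i _ => memLp_mul_comp hS hw hwb hu i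

/-- Contractivity is all that the mean ergodic theorem needs; here it is the triangle inequality
with weights at most 1/|ι|. Two cases are used: constant weights, whose fixed vectors are the
jointly invariant functions, and ι = `Unit` with weight conj θ, |θ| = 1, whose fixed vectors satisfy
g ∘ S = θ g. -/
theorem eLpNorm_wavg_le (hS : ∀ i, MeasurePreserving (S i) ν ν) (hw : ∀ i, Measurable (w i))
    (hwb : ∀ i y, ‖w i y‖ ≤ (Fintype.card ι : ℝ)⁻¹) {u : Y → ℂ} (hu : MemLp u 2 ν) :
    eLpNorm (wavg w S u) 2 ν ≤ eLpNorm u 2 ν := by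
  have h1 : wavg w S u = ∑ i, fun y => w i y * u (S i y) := by
    ext y; simp [wavg]
  rw [h1]
  refine (eLpNorm_sum_le (fun i _ => (memLp_mul_comp hS hw hwb hu i).1) (by norm_num)).trans ?_
  refine (Finset.sum_le_sum fun i _ => eLpNorm_mul_comp_le hS hwb hu i).trans ?_
  rcases isEmpty_or_nonempty ι with h | h
  · simp
  · have hc : (Fintype.card ι : ℝ) ≠ 0 := by simp
    rw [Finset.sum_const, Finset.card_univ, nsmul_eq_mul, ← mul_assoc]
    have : (Fintype.card ι : ℝ≥0∞) * ENNReal.ofReal ((Fintype.card ι : ℝ)⁻¹) = 1 := by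
      rw [← ENNReal.ofReal_natCast, ← ENNReal.ofReal_mul (by positivity), mul_inv_cancel₀ hc,
        ENNReal.ofReal_one]
    rw [this, one_mul]

/-- The averaging operator on `L²`. -/
def wavgL (hS : ∀ i, MeasurePreserving (S i) ν ν) (hw : ∀ i, Measurable (w i))
    (hwb : ∀ i y, ‖w i y‖ ≤ (Fintype.card ι : ℝ)⁻¹) : Lp ℂ 2 ν →L[ℂ] Lp ℂ 2 ν :=
  LinearMap.mkContinuous
    { toFun := fun u => (memLp_wavg hS hw hwb (Lp.memLp u)).toLp _
      map_add' := fun u v => by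
        rw [← MemLp.toLp_add]
        refine MemLp.toLp_congr _ _ ?_
        have := wavg_congr (w := w) hS (Lp.coeFn_add u v)
        refine this.trans (Eventually.of_forall fun y => ?_)
        simp [wavg, mul_add, Finset.sum_add_distrib]
      map_smul' := fun c u => by
        rw [← MemLp.toLp_const_smul]
        refine MemLp.toLp_congr _ _ ?_
        have := wavg_congr (w := w) hS (Lp.coeFn_smul c u)
        refine this.trans (Eventually.of_forall fun y => ?_)
        simp [wavg, Finset.mul_sum, mul_left_comm] } 1 (fun u => by
      simp only [LinearMap.coe_mk, AddHom.coe_mk, one_mul]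
      rw [Lp.norm_toLp, Lp.norm_def]
      exact ENNReal.toReal_mono (Lp.eLpNorm_ne_top u) (eLpNorm_wavg_le hS hw hwb (Lp.memLp u)))

theorem wavgL_toLp (hS : ∀ i, MeasurePreserving (S i) ν ν) (hw : ∀ i, Measurable (w i))
    (hwb : ∀ i y, ‖w i y‖ ≤ (Fintype.card ι : ℝ)⁻¹) {u : Y → ℂ} (hu : MemLp u 2 ν) :
    wavgL hS hw hwb (hu.toLp u) = (memLp_wavg hS hw hwb hu).toLp _ :=
  MemLp.toLp_congr (memLp_wavg hS hw hwb (Lp.memLp _)) _ (wavg_congr hS hu.coeFn_toLp)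

theorem memLp_wavg_iterate (hS : ∀ i, MeasurePreserving (S i) ν ν) (hw : ∀ i, Measurable (w i))
    (hwb : ∀ i y, ‖w i y‖ ≤ (Fintype.card ι : ℝ)⁻¹) {u : Y → ℂ} (hu : MemLp u 2 ν) (k : ℕ) :
    MemLp ((wavg w S)^[k] u) 2 ν := by
  induction k with
  | zero => exact hu
  | succ k ih => rw [Function.iterate_succ_apply']; exact memLp_wavg hS hw hwb ih

theorem memLp_bavg (hS : ∀ i, MeasurePreserving (S i) ν ν) (hw : ∀ i, Measurable (w i))
    (hwb : ∀ i y, ‖w i y‖ ≤ (Fintype.card ι : ℝ)⁻¹) {u : Y → ℂ} (hu : MemLp u 2 ν) (n : ℕ) :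
    MemLp (bavg w S n u) 2 ν :=
  (memLp_finsetSum _ fun k _ => memLp_wavg_iterate hS hw hwb hu k).const_mul _

theorem wavgL_iterate_toLp (hS : ∀ i, MeasurePreserving (S i) ν ν) (hw : ∀ i, Measurable (w i))
    (hwb : ∀ i y, ‖w i y‖ ≤ (Fintype.card ι : ℝ)⁻¹) {u : Y → ℂ} (hu : MemLp u 2 ν) (k : ℕ) :
    (wavgL hS hw hwb)^[k] (hu.toLp u) = (memLp_wavg_iterate hS hw hwb hu k).toLp _ := by
  induction k with
  | zero => rfl
  | succ k ih =>
    rw [Function.iterate_succ_apply', ih, wavgL_toLp]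
    exact MemLp.toLp_congr _ _ (by rw [Function.iterate_succ_apply'])

theorem birkhoffAverage_wavgL (hS : ∀ i, MeasurePreserving (S i) ν ν) (hw : ∀ i, Measurable (w i))
    (hwb : ∀ i y, ‖w i y‖ ≤ (Fintype.card ι : ℝ)⁻¹) {u : Y → ℂ} (hu : MemLp u 2 ν) (n : ℕ) :
    birkhoffAverage ℂ (wavgL hS hw hwb) id n (hu.toLp u) =
      (memLp_bavg hS hw hwb hu n).toLp _ := by
  refine Lp.ext ?_
  refine EventuallyEq.trans ?_ (MemLp.coeFn_toLp _).symm
  simp only [birkhoffAverage, birkhoffSum, id]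
  refine (Lp.coeFn_smul _ _).trans ?_
  have h1 : ∀ᵐ y ∂ν, ((∑ k ∈ Finset.range n, (wavgL hS hw hwb)^[k] (hu.toLp u) : Lp ℂ 2 ν) : Y → ℂ) y
      = ∑ k ∈ Finset.range n, (((wavgL hS hw hwb)^[k] (hu.toLp u) : Lp ℂ 2 ν) : Y → ℂ) y := by
    have := Lp.coeFn_finsetSum (μ := ν) (p := 2) (Finset.range n)
      (fun k => (wavgL hS hw hwb)^[k] (hu.toLp u))
    filter_upwards [this] with y hy
    rw [hy]; simp
  have h2 : ∀ k, ∀ᵐ y ∂ν, (((wavgL hS hw hwb)^[k] (hu.toLp u) : Lp ℂ 2 ν) : Y → ℂ) y =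
      ((wavg w S)^[k] u) y := by
    intro k
    rw [wavgL_iterate_toLp]
    exact MemLp.coeFn_toLp _
  filter_upwards [h1, ae_all_iff.2 h2] with y hy1 hy2
  rw [Pi.smul_apply, smul_eq_mul, hy1]
  simp only [bavg, hy2]

/-- Von Neumann's mean ergodic theorem for the weighted averaging operator, in terms of
functions. -/
theorem mean_ergodic_wavg (hS : ∀ i, MeasurePreserving (S i) ν ν) (hw : ∀ i, Measurable (w i))
    (hwb : ∀ i y, ‖w i y‖ ≤ (Fintype.card ι : ℝ)⁻¹) {f : Y → ℂ} (hf : MemLp f 2 ν) :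
    ∃ g : Y → ℂ, Measurable g ∧ MemLp g 2 ν ∧ wavg w S g =ᵐ[ν] g ∧
      Tendsto (fun n => eLpNorm (fun y => bavg w S n f y - g y) 2 ν) atTop (𝓝 0) ∧
      ∀ h : Y → ℂ, MemLp h 2 ν → wavg w S h =ᵐ[ν] h →
        ∫ y, f y * conj (h y) ∂ν = ∫ y, g y * conj (h y) ∂ν := by
  set M := wavgL hS hw hwb with hM
  have hM1 : ‖M‖ ≤ 1 := LinearMap.mkContinuous_norm_le _ zero_le_one _
  set K := (M : Lp ℂ 2 ν →ₗ[ℂ] Lp ℂ 2 ν).eqLocus ((1 : Lp ℂ 2 ν →L[ℂ] Lp ℂ 2 ν) : Lp ℂ 2 ν →ₗ[ℂ] Lp ℂ 2 ν) with hK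
  have hlim := M.tendsto_birkhoffAverage_orthogonalProjection hM1 (hf.toLp f)
  set P := (K.orthogonalProjectionOnto (hf.toLp f) : Lp ℂ 2 ν) with hP
  have hPK : M P = P := (K.orthogonalProjectionOnto (hf.toLp f)).2
  have hg : MemLp P 2 ν := Lp.memLp P
  refine ⟨P, (Lp.stronglyMeasurable P).measurable, hg, ?_, ?_, ?_⟩
  · have h1 : M P = (memLp_wavg hS hw hwb hg).toLp _ := rfl
    have h2 := (MemLp.coeFn_toLp (memLp_wavg hS hw hwb hg)).symm
    rw [← h1, hPK] at h2
    exact h2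
  · have := (Lp.tendsto_Lp_iff_tendsto_eLpNorm' _ _).1 hlim
    refine this.congr fun n => ?_
    refine eLpNorm_congr_ae ?_
    rw [birkhoffAverage_wavgL hS hw hwb hf n]
    filter_upwards [MemLp.coeFn_toLp (memLp_bavg hS hw hwb hf n)] with y hy
    simp only [Pi.sub_apply, hy]
  · intro h hh hfix
    have hhK : hh.toLp h ∈ K := by
      change M (hh.toLp h) = hh.toLp h
      rw [hM, wavgL_toLp]
      exact MemLp.toLp_congr _ _ hfix
    have h0 := K.starProjection_inner_eq_zero (hf.toLp f) _ hhK
    have h1 : inner ℂ (hh.toLp h) (hf.toLp f) = inner ℂ (hh.toLp h) P := by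
      rw [← sub_eq_zero, ← inner_sub_right]
      rw [← inner_conj_symm]
      change conj (inner ℂ (hf.toLp f - P) (hh.toLp h)) = 0
      have : K.starProjection (hf.toLp f) = P := rfl
      rw [← this, h0, map_zero]
    rw [L2.inner_def, L2.inner_def] at h1
    have e1 : ∫ y, f y * conj (h y) ∂ν = ∫ y, inner ℂ ((hh.toLp h) y) ((hf.toLp f) y) ∂ν := by
      refine integral_congr_ae ?_
      filter_upwards [hh.coeFn_toLp, hf.coeFn_toLp] with y h1 h2
      simp [h1, h2]
    have e2 : ∫ y, P y * conj (h y) ∂ν = ∫ y, inner ℂ ((hh.toLp h) y) (P y) ∂ν := by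
      refine integral_congr_ae ?_
      filter_upwards [hh.coeFn_toLp] with y h1
      simp [h1]
    rw [e1, e2, h1]

end MeanErgodic

/-! ### Uniform averages over a finite family, and joint invariance. -/

section JointAverage

variable {ι Y : Type*} [mY : MeasurableSpace Y] [Fintype ι] {S : ι → Y ≃ᵐ Y} {ν : Measure Y}

/-- Constant weights `1 / |ι|`. -/
def unifWeight (ι Y : Type*) [Fintype ι] : ι → Y → ℂ := fun _ _ => ((Fintype.card ι : ℝ)⁻¹ : ℝ)

theorem measurable_unifWeight (i : ι) : Measurable (unifWeight ι Y i) := measurable_const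

theorem norm_unifWeight_le (i : ι) (y : Y) : ‖unifWeight ι Y i y‖ ≤ (Fintype.card ι : ℝ)⁻¹ := by
  rw [unifWeight, Complex.norm_real, Real.norm_of_nonneg (by positivity)]

theorem sum_unifWeight [Nonempty ι] (y : Y) : ∑ i, unifWeight ι Y i y = 1 := by
  have : (Fintype.card ι : ℂ) ≠ 0 := by simp
  simp [unifWeight]

theorem wavg_eq_self_of_invariant [Nonempty ι] {u : Y → ℂ} (h : ∀ i y, u (S i y) = u y) :
    wavg (unifWeight ι Y) S u = u := by
  ext y
  simp only [wavg, h]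
  rw [← Finset.sum_mul, sum_unifWeight, one_mul]

/-- Fixed vectors of the uniform average are invariant under each transformation. -/
theorem invariant_of_wavg_eq_self [Nonempty ι] (hS : ∀ i, MeasurePreserving (S i) ν ν) {u : Y → ℂ}
    (hu : MemLp u 2 ν) (h : wavg (unifWeight ι Y) S u =ᵐ[ν] u) (i : ι) :
    ∀ᵐ y ∂ν, u (S i y) = u y := by
  have hui : ∀ i, MemLp (u ∘ S i) 2 ν := fun i => hu.comp_measurePreserving (hS i)
  set U := hu.toLp u with hU
  set V : ι → Lp ℂ 2 ν := fun i => (hui i).toLp _ with hV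
  have hn : ∀ i, ‖V i‖ = ‖U‖ := fun i => by
    simp only [hV, hU]
    rw [Lp.norm_toLp, Lp.norm_toLp, eLpNorm_comp_measurePreserving hu.1 (hS i)]
  have hc : (Fintype.card ι : ℂ) ≠ 0 := by simp
  have hsum : ∑ i, V i = (Fintype.card ι : ℂ) • U := by
    refine Lp.ext ?_
    have h1 := Lp.coeFn_finsetSum (μ := ν) (p := 2) Finset.univ V
    have h2 := Lp.coeFn_smul (Fintype.card ι : ℂ) U
    have h3 : ∀ i, ∀ᵐ y ∂ν, V i y = u (S i y) := fun i => (hui i).coeFn_toLp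
    filter_upwards [h1, h2, ae_all_iff.2 h3, hu.coeFn_toLp, h] with y h1 h2 h3 h4 h5
    rw [h1, h2]
    simp only [Finset.sum_apply, h3, Pi.smul_apply, smul_eq_mul, hU, h4]
    rw [← h5]
    simp only [wavg, unifWeight]
    rw [← Finset.mul_sum, ← mul_assoc]
    push_cast
    rw [mul_inv_cancel₀ hc, one_mul]
  -- Strict convexity: the `V i` have the norm of `U` and their mean is `U`, so expanding the
  -- squares leaves nothing.
  have hz : ∑ i, ‖V i - U‖ ^ 2 = 0 := by
    have e : ∀ i, ‖V i - U‖ ^ 2 = 2 * ‖U‖ ^ 2 - 2 * RCLike.re (inner ℂ (V i) U) := fun i => by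
      rw [@norm_sub_sq ℂ, hn i]; ring
    simp only [e]
    rw [Finset.sum_sub_distrib, ← Finset.mul_sum, ← Finset.mul_sum, ← map_sum, ← sum_inner, hsum,
      inner_smul_left, inner_self_eq_norm_sq_to_K]
    simp
    norm_cast
    simp
  have hzi := (Finset.sum_eq_zero_iff_of_nonneg (fun i _ => by positivity)).1 hz i (Finset.mem_univ i)
  have heq : V i = U := by
    rw [← sub_eq_zero]; simpa using hzi
  have h3 : V i =ᵐ[ν] u ∘ S i := (hui i).coeFn_toLp
  filter_upwards [h3, hu.coeFn_toLp] with y h3 h4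
  rw [← h4, ← hU, ← heq, h3]; rfl

/-- Mean ergodic theorem for a finite family of transformations: averages converge to the
conditional expectation on the jointly invariant σ-algebra. -/
theorem tendsto_bavg_condExp [Nonempty ι] [IsFiniteMeasure ν]
    (hS : ∀ i, MeasurePreserving (S i) ν ν) {f : Y → ℂ} (hf : MemLp f 2 ν) :
    Tendsto (fun n => eLpNorm (fun y => bavg (unifWeight ι Y) S n f y - (ν[f|jointInv S]) y) 2 ν)
      atTop (𝓝 0) := by
  obtain ⟨g, hgm, hg, hfix, hlim, horth⟩ :=
    mean_ergodic_wavg hS measurable_unifWeight norm_unifWeight_le hf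
  obtain ⟨g', hg', hgg'⟩ := exists_jointInv_ae_eq hS hgm (invariant_of_wavg_eq_self hS hg hfix)
  have hfi : Integrable f ν := hf.integrable (by norm_num)
  have hgi : Integrable g ν := hg.integrable (by norm_num)
  have key : g =ᵐ[ν] ν[f|jointInv S] := by
    refine ae_eq_condExp_of_forall_setIntegral_eq (jointInv_le S) hfi
      (fun s _ _ => hgi.integrableOn) ?_ ?_
    · intro s hs _
      have h1 := horth (s.indicator fun _ => (1 : ℂ))
        ((memLp_const 1).indicator (jointInv_le S s hs))
        (Eventually.of_forall fun y => congrFun (wavg_eq_self_of_invariant fun i y => by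
          have : S i y ∈ s ↔ y ∈ s := by
            conv_rhs => rw [← hs.2 i]
            rfl
          by_cases hy : y ∈ s <;> simp [Set.indicator, this, hy]) y)
      rw [← integral_indicator (jointInv_le S s hs), ← integral_indicator (jointInv_le S s hs)]
      convert h1.symm using 2
      · ext y; by_cases hy : y ∈ s <;> simp [hy]
      · ext y; by_cases hy : y ∈ s <;> simp [hy]
    · exact ⟨g', hg'.stronglyMeasurable, hgg'⟩
  refine hlim.congr fun n => eLpNorm_congr_ae ?_
  filter_upwards [key] with y hy
  rw [hy]

theorem norm_wavg_le [Nonempty ι] {f : Y → ℂ} {B : ℝ} (hf : ∀ y, ‖f y‖ ≤ B) (y : Y) :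
    ‖wavg (unifWeight ι Y) S f y‖ ≤ B := by
  refine (norm_sum_le _ _).trans ?_
  have hc : (Fintype.card ι : ℝ) ≠ 0 := by simp
  calc ∑ i, ‖unifWeight ι Y i y * f (S i y)‖ ≤ ∑ i : ι, (Fintype.card ι : ℝ)⁻¹ * B :=
        Finset.sum_le_sum fun i _ => by
          rw [norm_mul]
          exact mul_le_mul (norm_unifWeight_le i y) (hf _) (norm_nonneg _) (by positivity)
    _ = B := by
        rw [Finset.sum_const, Finset.card_univ, nsmul_eq_mul, ← mul_assoc, mul_inv_cancel₀ hc,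
          one_mul]

theorem norm_bavg_le [Nonempty ι] {f : Y → ℂ} {B : ℝ} (hB : 0 ≤ B) (hf : ∀ y, ‖f y‖ ≤ B) (n : ℕ)
    (y : Y) :
    ‖bavg (unifWeight ι Y) S n f y‖ ≤ B := by
  have hit : ∀ k y, ‖((wavg (unifWeight ι Y) S)^[k] f) y‖ ≤ B := by
    intro k
    induction k with
    | zero => exact hf
    | succ k ih => intro y; rw [Function.iterate_succ_apply']; exact norm_wavg_le ih y
  rw [bavg, norm_mul, norm_inv, Complex.norm_natCast]
  rcases Nat.eq_zero_or_pos n with h0 | hpos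
  · simpa [h0] using hB
  · rw [inv_mul_le_iff₀ (by positivity)]
    refine (norm_sum_le _ _).trans ((Finset.sum_le_sum fun k _ => hit k y).trans ?_)
    simp

theorem measurable_wavg_unif {f : Y → ℂ} (hf : Measurable f) :
    Measurable (wavg (unifWeight ι Y) S f) :=
  Finset.measurable_fun_sum _ fun i _ =>
    (measurable_unifWeight i).mul (hf.comp (S i).measurable)

theorem measurable_wavg_iterate {f : Y → ℂ} (hf : Measurable f) (k : ℕ) :
    Measurable ((wavg (unifWeight ι Y) S)^[k] f) := by
  induction k with
  | zero => exact hf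
  | succ k ih => rw [Function.iterate_succ_apply']; exact measurable_wavg_unif ih

theorem measurable_bavg {f : Y → ℂ} (hf : Measurable f) (n : ℕ) :
    Measurable (bavg (unifWeight ι Y) S n f) :=
  (Finset.measurable_fun_sum _ fun k _ => measurable_wavg_iterate hf k).const_mul _

/-- Averaging does not change integrals over jointly invariant sets. -/
theorem setIntegral_bavg [Nonempty ι] [IsFiniteMeasure ν] (hS : ∀ i, MeasurePreserving (S i) ν ν)
    {f : Y → ℂ} (hfm : Measurable f) {B : ℝ} (hf : ∀ y, ‖f y‖ ≤ B)
    {E : Set Y} (hE : MeasurableSet[jointInv S] E) {n : ℕ} (hn : 0 < n) :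
    ∫ y in E, bavg (unifWeight ι Y) S n f y ∂ν = ∫ y in E, f y ∂ν := by
  have hint : ∀ {u : Y → ℂ}, Measurable u → (∀ y, ‖u y‖ ≤ B) → IntegrableOn u E ν :=
    fun hu hb => (Integrable.of_bound hu.aestronglyMeasurable B
      (Eventually.of_forall hb)).integrableOn
  have hb : ∀ k y, ‖((wavg (unifWeight ι Y) S)^[k] f) y‖ ≤ B := by
    intro k
    induction k with
    | zero => exact hf
    | succ k ih => intro y; rw [Function.iterate_succ_apply']; exact norm_wavg_le ih y
  have h1 : ∀ {u : Y → ℂ}, Measurable u → (∀ y, ‖u y‖ ≤ B) →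
      ∫ y in E, wavg (unifWeight ι Y) S u y ∂ν = ∫ y in E, u y ∂ν := by
    intro u hu hub
    have hi : ∀ i, ∫ y in E, unifWeight ι Y i y * u (S i y) ∂ν =
        ((Fintype.card ι : ℝ)⁻¹ : ℝ) * ∫ y in E, u y ∂ν := fun i => by
      simp only [unifWeight]
      rw [integral_const_mul]
      congr 1
      have := (hS i).setIntegral_preimage_emb (S i).measurableEmbedding u E
      rwa [hE.2 i] at this
    simp only [wavg]
    rw [integral_finsetSum]
    · simp only [hi]
      have hc : (Fintype.card ι : ℂ) ≠ 0 := by simp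
      rw [Finset.sum_const, Finset.card_univ, nsmul_eq_mul, ← mul_assoc]
      push_cast
      rw [mul_inv_cancel₀ hc, one_mul]
    · intro i _
      exact (hint (hu.comp (S i).measurable) (fun y => hub _)).const_mul _
  have h2 : ∀ k, ∫ y in E, ((wavg (unifWeight ι Y) S)^[k] f) y ∂ν = ∫ y in E, f y ∂ν := by
    intro k
    induction k with
    | zero => rfl
    | succ k ih =>
      rw [Function.iterate_succ_apply', h1 (measurable_wavg_iterate hfm k) (hb k), ih]
  simp only [bavg]
  rw [integral_const_mul, integral_finsetSum]
  · simp only [h2]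
    have hc : (n : ℂ) ≠ 0 := by exact_mod_cast hn.ne'
    rw [Finset.sum_const, Finset.card_range, nsmul_eq_mul, ← mul_assoc, inv_mul_cancel₀ hc,
      one_mul]
  · intro k _
    exact hint (measurable_wavg_iterate hfm k) (hb k)

end JointAverage

/-! ### Ergodic decomposition through conditional measures on the invariant sets. -/

section ErgodicDecomposition

variable {ι Y : Type*} [mY : MeasurableSpace Y] [StandardBorelSpace Y] {S : ι → Y ≃ᵐ Y}
  {ν : Measure Y} [IsProbabilityMeasure ν]

/-- Averaging the conditional measures over ν gives ν back, so a null set is null for almost all of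
them. -/
theorem ae_ae_condExpKernel (S : ι → Y ≃ᵐ Y) {P : Y → Prop}
    (h : ∀ᵐ y ∂ν, P y) : ∀ᵐ y ∂ν, ∀ᵐ z ∂(condExpKernel ν (jointInv S) y), P z := by
  have hm := jointInv_le S
  have h1 := condExpKernel_comp_trim (μ := ν) hm
  rw [← h1] at h
  exact ae_of_ae_trim hm (Measure.ae_ae_of_ae_comp h)

/-- A countable π-system generating the σ-algebra of a standard Borel space. -/
theorem exists_countable_piSystem (Y : Type*) [mY : MeasurableSpace Y] [StandardBorelSpace Y] :
    ∃ C : Set (Set Y), C.Countable ∧ IsPiSystem C ∧ (∀ s ∈ C, MeasurableSet s) ∧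
      mY = MeasurableSpace.generateFrom C := by
  refine ⟨generateSetAlgebra (MeasurableSpace.countableGeneratingSet Y),
    countable_generateSetAlgebra MeasurableSpace.countable_countableGeneratingSet,
    isSetAlgebra_generateSetAlgebra.isSetRing.isSetSemiring.isPiSystem, fun s hs => ?_, ?_⟩
  · have := MeasurableSpace.measurableSet_generateFrom hs
    rwa [generateFrom_generateSetAlgebra_eq,
      MeasurableSpace.generateFrom_countableGeneratingSet] at this
  · rw [generateFrom_generateSetAlgebra_eq, MeasurableSpace.generateFrom_countableGeneratingSet]

theorem condExpKernel_real_ae_eq (hS : ∀ i, MeasurePreserving (S i) ν ν) (i : ι) {C : Set Y}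
    (hC : MeasurableSet C) :
    ∀ᵐ y ∂ν, condExpKernel ν (jointInv S) y (S i ⁻¹' C) = condExpKernel ν (jointInv S) y C := by
  have h := jointInv_le S
  have h1 := condExp_ae_eq_integral_condExpKernel h
    ((integrable_const (1 : ℂ)).indicator hC : Integrable (C.indicator fun _ => (1 : ℂ)) ν)
  have h2 := condExp_ae_eq_integral_condExpKernel h
    ((integrable_const (1 : ℂ)).indicator ((S i).measurable hC) :
      Integrable ((S i ⁻¹' C).indicator fun _ => (1 : ℂ)) ν)
  have h3 := condExp_jointInv_comp (hS i)
    ((integrable_const (1 : ℂ)).indicator hC : Integrable (C.indicator fun _ => (1 : ℂ)) ν)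
  have e : (C.indicator fun _ => (1 : ℂ)) ∘ S i = (S i ⁻¹' C).indicator fun _ => (1 : ℂ) := by
    rfl
  rw [e] at h3
  filter_upwards [h1, h2, h3] with y h1 h2 h3
  rw [h1, h2, integral_indicator_const _ hC, integral_indicator_const _ ((S i).measurable hC)] at h3
  simp only [Complex.real_smul, mul_one, Complex.ofReal_inj] at h3
  exact (measureReal_eq_measureReal_iff).1 h3

/-- For one set invariance holds outside a null set of y; a countable generating π-system makes the
exceptional set independent of the set. -/
theorem ae_measurePreserving_condExpKernel [Countable ι] (hS : ∀ i, MeasurePreserving (S i) ν ν) :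
    ∀ᵐ y ∂ν, ∀ i, MeasurePreserving (S i) (condExpKernel ν (jointInv S) y)
      (condExpKernel ν (jointInv S) y) := by
  obtain ⟨C, hCc, hCpi, hCm, hCgen⟩ := exists_countable_piSystem Y
  have h1 : ∀ i, ∀ᵐ y ∂ν, ∀ s ∈ C, condExpKernel ν (jointInv S) y (S i ⁻¹' s) =
      condExpKernel ν (jointInv S) y s := fun i =>
    (ae_ball_iff hCc).2 fun s hs => condExpKernel_real_ae_eq hS i (hCm s hs)
  filter_upwards [ae_all_iff.2 h1] with y hy i
  refine ⟨(S i).measurable, ?_⟩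
  have : IsProbabilityMeasure ((condExpKernel ν (jointInv S) y).map (S i)) :=
    Measure.isProbabilityMeasure_map (S i).measurable.aemeasurable
  refine ext_of_generate_finite C hCgen hCpi (fun s hs => ?_) (by simp)
  rw [Measure.map_apply (S i).measurable (hCm s hs), hy i s hs]

/-- Jointly invariant functions are almost surely constant for the conditional measures. -/
theorem ae_condExpKernel_const (S : ι → Y ≃ᵐ Y) {g : Y → ℝ} (hg : Measurable[jointInv S] g) :
    ∀ᵐ y ∂ν, ∀ᵐ z ∂(condExpKernel ν (jointInv S) y), g z = g y := by
  have hm := jointInv_le S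
  -- The sublevel sets of g are invariant, so their conditional measure is 0 or 1; rational
  -- thresholds keep the null sets countable in number.
  have h1 : ∀ q : ℚ, ∀ᵐ y ∂ν, (∀ᵐ z ∂(condExpKernel ν (jointInv S) y), (g z < q ↔ g y < q)) := by
    intro q
    have hE : MeasurableSet[jointInv S] {z | g z < q} := hg measurableSet_Iio
    have hE' : MeasurableSet {z | g z < q} := hm _ hE
    have h2 := condExp_ae_eq_integral_condExpKernel hm
      ((integrable_const (1 : ℝ)).indicator hE' :
        Integrable ({z | g z < q}.indicator fun _ => (1 : ℝ)) ν)
    rw [condExp_of_stronglyMeasurable hm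
      ((@measurable_const _ _ _ (jointInv S) (1 : ℝ)).indicator hE).stronglyMeasurable
      ((integrable_const (1 : ℝ)).indicator hE')] at h2
    filter_upwards [h2] with y hy
    rw [integral_indicator_const _ hE', smul_eq_mul, mul_one] at hy
    by_cases hyq : g y < q
    · rw [Set.indicator_of_mem (show y ∈ {z | g z < q} from hyq)] at hy
      have : (condExpKernel ν (jointInv S) y) {z | g z < q} = 1 := by
        rw [measureReal_def] at hy
        exact (ENNReal.toReal_eq_one_iff _).1 hy.symm
      have h4 := (prob_compl_eq_zero_iff hE').2 this
      filter_upwards [measure_eq_zero_iff_ae_notMem.1 h4] with z hz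
      simp at hz
      simp [hz, hyq]
    · rw [Set.indicator_of_notMem (show y ∉ {z | g z < q} from hyq)] at hy
      have h4 : (condExpKernel ν (jointInv S) y) {z | g z < q} = 0 := by
        rw [← measureReal_eq_zero_iff]; exact hy.symm
      filter_upwards [measure_eq_zero_iff_ae_notMem.1 h4] with z hz
      have hz' : ¬ g z < q := hz
      simp [hz', hyq]
  filter_upwards [ae_all_iff.2 h1] with y hy
  filter_upwards [ae_all_iff.2 hy] with z hz
  refine le_antisymm (le_of_forall_rat_lt_imp_le fun q hq => ?_)
    (le_of_forall_rat_lt_imp_le fun q hq => ?_)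
  · exact not_lt.1 fun h => absurd ((hz q).2 h) (not_lt.2 hq.le)
  · exact not_lt.1 fun h => absurd ((hz q).1 h) (not_lt.2 hq.le)

/-- Almost every conditional measure on the jointly invariant σ-algebra is ergodic. -/
theorem ae_ergodic_condExpKernel [Fintype ι] [Nonempty ι]
    (hS : ∀ i, MeasurePreserving (S i) ν ν) :
    ∀ᵐ y ∂ν, ∀ E, MeasurableSet[jointInv S] E → condExpKernel ν (jointInv S) y E = 0 ∨
      condExpKernel ν (jointInv S) y E = 1 := by
  have hJ := jointInv_le S
  obtain ⟨C, hCc, hCpi, hCm, hCgen⟩ := exists_countable_piSystem Y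
  set κ := condExpKernel ν (jointInv S) with hκ
  set ind : Set Y → Y → ℂ := fun s => s.indicator fun _ => (1 : ℂ) with hind
  have hindm : ∀ s ∈ C, Measurable (ind s) := fun s hs => measurable_const.indicator (hCm s hs)
  have hindb : ∀ s y, ‖ind s y‖ ≤ 1 := fun s y => by
    simp only [hind, Set.indicator]; split_ifs <;> simp
  -- The averages of the indicator of s converge to its conditional expectation; on the conditional
  -- measure of y this limit is the constant κ y s. Convergence almost everywhere costs a
  -- subsequence.
  have hsub : ∀ s ∈ C, ∃ ns : ℕ → ℕ, StrictMono ns ∧ ∀ᵐ y ∂ν, ∀ᵐ z ∂(κ y),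
      Tendsto (fun k => bavg (unifWeight ι Y) S (ns k) (ind s) z) atTop (𝓝 ((κ y).real s)) := by
    intro s hs
    have hmem : MemLp (ind s) 2 ν :=
      MemLp.of_bound (hindm s hs).aestronglyMeasurable 1 (Eventually.of_forall (hindb s))
    have h1 := tendstoInMeasure_of_tendsto_eLpNorm (by norm_num)
      (fun n => (measurable_bavg (S := S) (hindm s hs) n).aestronglyMeasurable)
      (stronglyMeasurable_condExp.mono hJ).aestronglyMeasurable
      (tendsto_bavg_condExp hS hmem)
    obtain ⟨ns, hns, hlim⟩ := h1.exists_seq_tendsto_ae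
    refine ⟨ns, hns, ?_⟩
    have h2 := condExp_ae_eq_integral_condExpKernel hJ (hmem.integrable (by norm_num))
    have h3 := ae_condExpKernel_const (ν := ν) S (g := fun y => (κ y).real s)
      ((measurable_condExpKernel (hCm s hs)).ennreal_toReal)
    filter_upwards [ae_ae_condExpKernel S hlim, ae_ae_condExpKernel S h2, h3] with y h4 h5 h6
    filter_upwards [h4, h5, h6] with z h4 h5 h6
    rw [h5, ← hκ, hind, integral_indicator_const _ (hCm s hs), h6] at h4
    simpa using h4
  choose! ns hns hlim using hsub
  filter_upwards [(ae_ball_iff hCc).2 hlim, ae_measurePreserving_condExpKernel hS] with y hy hmp E hE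
  rw [← hκ] at hmp
  -- Averaging does not change the integral over E and tends to a constant, so E is independent of
  -- every s in the π-system. It is then independent of itself, which forces measure 0 or 1.
  have hprod : ∀ s ∈ C, κ y (E ∩ s) = κ y E * κ y s := by
    intro s hs
    have h1 : Tendsto (fun k => ∫ z in E, bavg (unifWeight ι Y) S (ns s k) (ind s) z ∂(κ y)) atTop
        (𝓝 (∫ z in E, ((κ y).real s : ℂ) ∂(κ y))) := by
      refine tendsto_integral_of_dominated_convergence (fun _ => 1)
        (fun k => (measurable_bavg (hindm s hs) _).aestronglyMeasurable) (integrable_const _)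
        (fun k => Eventually.of_forall fun z => norm_bavg_le zero_le_one (hindb s) _ z)
        (ae_restrict_of_ae (hy s hs))
    have h2 : ∀ᶠ k in atTop, ∫ z in E, bavg (unifWeight ι Y) S (ns s k) (ind s) z ∂(κ y) =
        ((κ y).real (E ∩ s) : ℂ) := by
      filter_upwards [eventually_gt_atTop 0] with k hk
      rw [setIntegral_bavg hmp (hindm s hs) (hindb s) hE (hk.trans_le ((hns s hs).id_le k))]
      simp only [hind]
      rw [setIntegral_indicator (hCm s hs)]
      simp
    have h3 := tendsto_nhds_unique (h1.congr' h2) tendsto_const_nhds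
    simp only [integral_const, measureReal_restrict_apply_univ, Complex.real_smul] at h3
    have h4 : (κ y).real (E ∩ s) = (κ y).real E * (κ y).real s := by exact_mod_cast h3.symm
    simp only [measureReal_def] at h4
    rw [← ENNReal.toReal_mul] at h4
    exact (ENNReal.toReal_eq_toReal_iff' (measure_ne_top _ _)
      (ENNReal.mul_ne_top (measure_ne_top _ _) (measure_ne_top _ _))).1 h4
  have hmeas : (κ y).restrict E = (κ y E) • κ y := by
    have : IsFiniteMeasure ((κ y E) • κ y) :=
      ⟨by simp⟩
    refine ext_of_generate_finite C hCgen hCpi (fun s hs => ?_) (by simp)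
    rw [Measure.restrict_apply (hCm s hs), Set.inter_comm, hprod s hs]; rfl
  have h1 : κ y E = κ y E * κ y E := by
    conv_lhs => rw [← Set.inter_self E, ← Measure.restrict_apply (hJ E hE), hmeas]
    rfl
  by_cases h0 : κ y E = 0
  · exact Or.inl h0
  · right
    have h2 := (ENNReal.mul_eq_left h0 (measure_ne_top _ _)).1 h1.symm
    exact h2

/-- The averages of f ∘ q converge to the conditional expectation of f ∘ q upstairs, and to the
constant ∫ f dω because the factor is ergodic. For f the indicator of C this identifies the
conditional measure of q⁻¹ C with ω C. -/
theorem condExpKernel_map_eq_of_ergodic [Fintype ι] [Nonempty ι]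
    (hS : ∀ i, MeasurePreserving (S i) ν ν) {W : Type*} [MeasurableSpace W] [StandardBorelSpace W]
    {ω : Measure W} [IsProbabilityMeasure ω] {R : ι → W ≃ᵐ W}
    (hR : ∀ i, MeasurePreserving (R i) ω ω)
    (herg : ∀ E, MeasurableSet[jointInv R] E → ω E = 0 ∨ ω E = 1) {q : Y → W}
    (hq : MeasurePreserving q ν ω) (hqe : ∀ i, ∀ᵐ y ∂ν, q (S i y) = R i (q y)) :
    ∀ᵐ y ∂ν, MeasurePreserving q (condExpKernel ν (jointInv S) y) ω := by
  have hJ := jointInv_le S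
  have hconst : ∀ {f : W → ℂ}, Integrable f ω →
      (fun _ => ∫ w, f w ∂ω) =ᵐ[ω] ω[f|jointInv R] := by
    intro f hf
    refine ae_eq_condExp_of_forall_setIntegral_eq (jointInv_le R) hf
      (fun s _ _ => integrableOn_const (measure_ne_top _ _)) ?_ aestronglyMeasurable_const
    intro s hs _
    rcases herg s hs with h | h
    · rw [Measure.restrict_eq_zero.2 h]; simp
    · have : ω.restrict s = ω := by
        rw [Measure.restrict_eq_self_of_ae_mem]
        exact (prob_compl_eq_zero_iff (jointInv_le R s hs)).2 h
      rw [this]; simp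
  have hwav : ∀ f : W → ℂ, ∀ k, ∀ᵐ y ∂ν, ((wavg (unifWeight ι W) R)^[k] f) (q y) =
      ((wavg (unifWeight ι Y) S)^[k] (f ∘ q)) y := by
    intro f k
    induction k with
    | zero => exact Eventually.of_forall fun y => rfl
    | succ k ih =>
      have h1 : ∀ i, ∀ᵐ y ∂ν, ((wavg (unifWeight ι W) R)^[k] f) (q (S i y)) =
          ((wavg (unifWeight ι Y) S)^[k] (f ∘ q)) (S i y) :=
        fun i => (hS i).quasiMeasurePreserving.ae ih
      filter_upwards [ae_all_iff.2 h1, ae_all_iff.2 hqe] with y h1 h2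
      rw [Function.iterate_succ_apply', Function.iterate_succ_apply']
      simp only [wavg]
      refine Finset.sum_congr rfl fun i _ => ?_
      rw [← h1, h2]; rfl
  have hbav : ∀ f : W → ℂ, ∀ n, ∀ᵐ y ∂ν, bavg (unifWeight ι W) R n f (q y) =
      bavg (unifWeight ι Y) S n (f ∘ q) y := by
    intro f n
    filter_upwards [ae_all_iff.2 (hwav f)] with y hy
    simp [bavg, hy]
  have hce : ∀ C : Set W, MeasurableSet C → ∀ᵐ y ∂ν,
      condExpKernel ν (jointInv S) y (q ⁻¹' C) = ω C := by
    intro C hC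
    set f : W → ℂ := C.indicator fun _ => (1 : ℂ) with hf
    have hfm : Measurable f := measurable_const.indicator hC
    have hfb : ∀ w, ‖f w‖ ≤ 1 := fun w => by
      simp only [hf, Set.indicator]; split_ifs <;> simp
    have hmem : MemLp f 2 ω :=
      MemLp.of_bound hfm.aestronglyMeasurable 1 (Eventually.of_forall hfb)
    have hfq : Integrable (f ∘ q) ν :=
      hq.integrable_comp_of_integrable (hmem.integrable (by norm_num))
    have hmemq : MemLp (f ∘ q) 2 ν := hmem.comp_measurePreserving hq
    have key : (fun _ => ∫ w, f w ∂ω) =ᵐ[ν] ν[f ∘ q|jointInv S] := by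
      have l1 := tendsto_bavg_condExp hR hmem
      have l2 := tendsto_bavg_condExp hS hmemq
      have l1' : Tendsto (fun n => eLpNorm (fun y => bavg (unifWeight ι Y) S n (f ∘ q) y -
          ∫ w, f w ∂ω) 2 ν) atTop (𝓝 0) := by
        refine l1.congr fun n => ?_
        have e1 : eLpNorm (fun w => bavg (unifWeight ι W) R n f w - (ω[f|jointInv R]) w) 2 ω =
            eLpNorm (fun w => bavg (unifWeight ι W) R n f w - ∫ w, f w ∂ω) 2 ω := by
          refine eLpNorm_congr_ae ?_
          filter_upwards [hconst (hmem.integrable (by norm_num))] with w hw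
          rw [← hw]
        have e2 := eLpNorm_comp_measurePreserving (p := 2) (μ := ν) (ν := ω)
          (g := fun w => bavg (unifWeight ι W) R n f w - ∫ w, f w ∂ω)
          ((measurable_bavg hfm n).sub measurable_const).aestronglyMeasurable hq
        rw [e1, ← e2]
        refine eLpNorm_congr_ae ?_
        filter_upwards [hbav f n] with y hy
        simp [hy]
      have m1 := tendstoInMeasure_of_tendsto_eLpNorm (p := 2) (by norm_num)
        (fun n => (measurable_bavg (S := S) (hfm.comp hq.measurable) n).aestronglyMeasurable)
        aestronglyMeasurable_const l1'
      have m2 := tendstoInMeasure_of_tendsto_eLpNorm (p := 2) (by norm_num)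
        (fun n => (measurable_bavg (S := S) (hfm.comp hq.measurable) n).aestronglyMeasurable)
        (stronglyMeasurable_condExp.mono hJ).aestronglyMeasurable l2
      exact tendstoInMeasure_ae_unique m1 m2
    have h2 := condExp_ae_eq_integral_condExpKernel hJ hfq
    filter_upwards [key, h2] with y h1 h2
    rw [h2] at h1
    have e : f ∘ q = (q ⁻¹' C).indicator fun _ => (1 : ℂ) := by
      rfl
    rw [e, hf, integral_indicator_const _ hC, integral_indicator_const _ (hq.measurable hC)] at h1
    simp only [Complex.real_smul, mul_one, Complex.ofReal_inj] at h1
    simp only [measureReal_def] at h1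
    exact ((ENNReal.toReal_eq_toReal_iff' (measure_ne_top _ _) (measure_ne_top _ _)).1 h1).symm
  obtain ⟨C, hCc, hCpi, hCm, hCgen⟩ := exists_countable_piSystem W
  filter_upwards [(ae_ball_iff hCc).2 fun s hs => hce s (hCm s hs)] with y hy
  refine ⟨hq.measurable, ?_⟩
  have : IsProbabilityMeasure ((condExpKernel ν (jointInv S) y).map q) :=
    Measure.isProbabilityMeasure_map hq.measurable.aemeasurable
  refine ext_of_generate_finite C hCgen hCpi (fun s hs => ?_) (by simp)
  rw [Measure.map_apply hq.measurable (hCm s hs), hy s hs]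

end ErgodicDecomposition

/-! ### Correlations of a single transformation. -/

section SingleTransformation

variable {Y : Type*} [mY : MeasurableSpace Y] {ν : Measure Y}

/-- The σ-algebra of sets invariant under a single transformation. -/
abbrev singleInv (S : Y ≃ᵐ Y) : MeasurableSpace Y := jointInv fun _ : Unit => S

theorem wavg_unit_iterate (S : Y ≃ᵐ Y) (f : Y → ℂ) (k : ℕ) (y : Y) :
    ((wavg (unifWeight Unit Y) fun _ => S)^[k] f) y = f (S^[k] y) := by
  induction k generalizing y with
  | zero => rfl
  | succ k ih =>
    rw [Function.iterate_succ_apply', Function.iterate_succ_apply]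
    simp [wavg, unifWeight, ih]

theorem bavg_unit (S : Y ≃ᵐ Y) (f : Y → ℂ) (n : ℕ) (y : Y) :
    bavg (unifWeight Unit Y) (fun _ => S) n f y =
      (n : ℂ)⁻¹ * ∑ k ∈ Finset.range n, f (S^[k] y) := by
  simp only [bavg, wavg_unit_iterate]

theorem tendsto_integral_norm_sq [IsFiniteMeasure ν] {u : ℕ → Y → ℂ} {v : Y → ℂ}
    (hu : ∀ n, MemLp (u n) 2 ν)
    (hv : MemLp v 2 ν) (h : Tendsto (fun n => eLpNorm (fun y => u n y - v y) 2 ν) atTop (𝓝 0)) :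
    Tendsto (fun n => ∫ y, ‖u n y‖ ^ 2 ∂ν) atTop (𝓝 (∫ y, ‖v y‖ ^ 2 ∂ν)) := by
  have h1 : Tendsto (fun n => (hu n).toLp (u n)) atTop (𝓝 (hv.toLp v)) := by
    rw [Lp.tendsto_Lp_iff_tendsto_eLpNorm']
    refine h.congr fun n => eLpNorm_congr_ae ?_
    filter_upwards [(hu n).coeFn_toLp, hv.coeFn_toLp] with y h1 h2
    simp [h1, h2]
  have h2 : ∀ {w : Y → ℂ} (hw : MemLp w 2 ν), ‖hw.toLp w‖ ^ 2 = ∫ y, ‖w y‖ ^ 2 ∂ν := by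
    intro w hw
    rw [← @inner_self_eq_norm_sq ℂ, L2.inner_def, ← integral_re (L2.integrable_inner _ _)]
    refine integral_congr_ae ?_
    filter_upwards [hw.coeFn_toLp] with y hy
    rw [hy, inner_self_eq_norm_sq]
  simpa only [h2] using h1.norm.pow 2

/-- Convergence of the averaged correlations to the squared norm of the projection onto the
invariant functions. -/
theorem tendsto_avg_correlation [IsFiniteMeasure ν] {S : Y ≃ᵐ Y} (hS : MeasurePreserving S ν ν)
    {f : Y → ℂ} (hfm : Measurable f) {B : ℝ} (hf : ∀ y, ‖f y‖ ≤ B) :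
    Tendsto (fun K : ℕ => ((K : ℝ) ^ 2)⁻¹ * ∑ k ∈ Finset.range K, ∑ k' ∈ Finset.range K,
      (∫ y, f (S^[k] y) * conj (f (S^[k'] y)) ∂ν).re) atTop
      (𝓝 (∫ y, ‖(ν[f|singleInv S]) y‖ ^ 2 ∂ν)) := by
  have hmem : MemLp f 2 ν :=
    MemLp.of_bound hfm.aestronglyMeasurable B (Eventually.of_forall hf)
  have hS' : ∀ _ : Unit, MeasurePreserving S ν ν := fun _ => hS
  refine (tendsto_integral_norm_sq
    (memLp_bavg hS' measurable_unifWeight norm_unifWeight_le hmem) (hmem.condExp (by norm_num))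
    (tendsto_bavg_condExp hS' hmem)).congr fun K => ?_
  have hSk : ∀ k, Measurable (S^[k]) := fun k => S.measurable.iterate k
  have hint : ∀ k k', Integrable (fun y => f (S^[k] y) * conj (f (S^[k'] y))) ν := fun k k' => by
    refine Integrable.of_bound ((hfm.comp (hSk k)).mul
      (Complex.continuous_conj.measurable.comp (hfm.comp (hSk k')))).aestronglyMeasurable (B * B)
      (Eventually.of_forall fun y => ?_)
    rw [norm_mul, RCLike.norm_conj]
    exact mul_le_mul (hf _) (hf _) (norm_nonneg _) ((norm_nonneg _).trans (hf y))
  have e : ∀ y, ‖bavg (unifWeight Unit Y) (fun _ => S) K f y‖ ^ 2 =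
      ((K : ℝ) ^ 2)⁻¹ * ∑ k ∈ Finset.range K, ∑ k' ∈ Finset.range K,
        (f (S^[k] y) * conj (f (S^[k'] y))).re := by
    intro y
    rw [bavg_unit, norm_mul, mul_pow, norm_inv, Complex.norm_natCast, inv_pow]
    congr 1
    rw [← Complex.normSq_eq_norm_sq, ← Complex.ofReal_re (Complex.normSq _), Complex.normSq_eq_conj_mul_self,
      mul_comm, map_sum, Finset.sum_mul_sum, Complex.re_sum]
    exact Finset.sum_congr rfl fun k _ => Complex.re_sum _ _
  simp only [e]
  rw [integral_const_mul]
  congr 1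
  rw [integral_finsetSum]
  · refine Finset.sum_congr rfl fun k _ => ?_
    rw [integral_finsetSum]
    · exact Finset.sum_congr rfl fun k' _ => integral_re (hint k k')
    · exact fun k' _ => (hint k k').re
  · exact fun k _ => integrable_finsetSum _ fun k' _ => (hint k k').re

end SingleTransformation

theorem integrable_indicator_one {X : Type*} [MeasurableSpace X] {μ : Measure X}
    [IsFiniteMeasure μ] {B : Set X} (hB : MeasurableSet B) :
    Integrable (B.indicator fun _ => (1 : ℂ)) μ :=
  (integrable_const (1 : ℂ)).indicator hB

/-! ### Relatively independent self-joinings over the invariant sets of one transformation. -/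

section RelativeProduct

variable {X : Type*} [mX : MeasurableSpace X] [StandardBorelSpace X] {μ : Measure X}
  [IsProbabilityMeasure μ]

/-- Conditional measures with respect to the invariant σ-algebra of `T`. -/
def relKernel (μ : Measure X) [IsFiniteMeasure μ] (T : X ≃ᵐ X) : Kernel X X :=
  (condExpKernel μ (singleInv T)).comap id (measurable_id'' (jointInv_le fun _ : Unit => T))

theorem relKernel_apply (T : X ≃ᵐ X) (x : X) :
    relKernel μ T x = condExpKernel μ (singleInv T) x := by
  rw [relKernel, Kernel.comap_apply]; rfl

instance (T : X ≃ᵐ X) : IsMarkovKernel (relKernel μ T) := by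
  unfold relKernel; infer_instance

/-- The relatively independent self-joining of `μ` over the `T`-invariant σ-algebra. -/
def relProd (μ : Measure X) [IsFiniteMeasure μ] (T : X ≃ᵐ X) : Measure (X × X) :=
  μ ⊗ₘ relKernel μ T

instance (T : X ≃ᵐ X) : IsProbabilityMeasure (relProd μ T) := by
  unfold relProd; infer_instance

theorem measurePreserving_fst_relProd (T : X ≃ᵐ X) :
    MeasurePreserving Prod.fst (relProd μ T) μ :=
  ⟨measurable_fst, Measure.fst_compProd μ _⟩

theorem integral_relProd (T : X ≃ᵐ X) {f g : X → ℂ} (hf : Measurable f) (hg : Measurable g)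
    {B C : ℝ} (hfb : ∀ x, ‖f x‖ ≤ B) (hgb : ∀ x, ‖g x‖ ≤ C) :
    ∫ p, f p.1 * g p.2 ∂(relProd μ T) = ∫ x, f x * (μ[g|singleInv T]) x ∂μ := by
  rw [relProd, Measure.integral_compProd]
  · have h := condExp_ae_eq_integral_condExpKernel (μ := μ) (jointInv_le fun _ : Unit => T)
      (Integrable.of_bound hg.aestronglyMeasurable C (Eventually.of_forall hgb))
    refine integral_congr_ae ?_
    filter_upwards [h] with x hx
    rw [integral_const_mul, hx, relKernel_apply]
  · refine Integrable.of_bound ((hf.comp measurable_fst).mul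
      (hg.comp measurable_snd)).aestronglyMeasurable (B * C) (Eventually.of_forall fun p => ?_)
    rw [norm_mul]
    exact mul_le_mul (hfb _) (hgb _) (norm_nonneg _) ((norm_nonneg _).trans (hfb p.1))

theorem relProd_real_prod (T : X ≃ᵐ X) {A B : Set X} (hA : MeasurableSet A)
    (hB : MeasurableSet B) :
    ((relProd μ T).real (A ×ˢ B) : ℂ) =
      ∫ x in A, (μ[B.indicator (fun _ => (1 : ℂ))|singleInv T]) x ∂μ := by
  have h := integral_relProd (μ := μ) T (f := A.indicator fun _ => (1 : ℂ))
    (g := B.indicator fun _ => (1 : ℂ)) (measurable_const.indicator hA)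
    (measurable_const.indicator hB) (B := 1) (C := 1)
    (fun x => by simp only [Set.indicator]; split_ifs <;> simp)
    (fun x => by simp only [Set.indicator]; split_ifs <;> simp)
  have e1 : (fun p : X × X => A.indicator (fun _ => (1 : ℂ)) p.1 *
      B.indicator (fun _ => (1 : ℂ)) p.2) = (A ×ˢ B).indicator fun _ => (1 : ℂ) := by
    ext p
    by_cases h1 : p.1 ∈ A <;> by_cases h2 : p.2 ∈ B <;> simp [Set.indicator, h1, h2]
  rw [e1, integral_indicator_const _ (hA.prod hB)] at h
  rw [← integral_indicator hA]
  simp only [Complex.real_smul, mul_one] at h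
  rw [h]
  refine integral_congr_ae (Eventually.of_forall fun x => ?_)
  by_cases h1 : x ∈ A <;> simp [h1]

/-- Rectangles suffice, and the mass of A × B is the integral over A of the conditional expectation
of the indicator of B. The hypothesis says that composing with R' before conditioning equals
composing with R afterwards. It covers R × R for R commuting with T, and also id × T and T × id, as
conditioning on T-invariant sets does not see T. -/
theorem measurePreserving_prodCongr {T R R' : X ≃ᵐ X} (hR : MeasurePreserving R μ μ)
    (h : ∀ B : Set X, MeasurableSet B →
      μ[(B.indicator fun _ => (1 : ℂ)) ∘ R'|singleInv T] =ᵐ[μ]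
        μ[B.indicator fun _ => (1 : ℂ)|singleInv T] ∘ R) :
    MeasurePreserving (R.prodCongr R') (relProd μ T) (relProd μ T) := by
  refine ⟨(R.prodCongr R').measurable, ?_⟩
  have : IsProbabilityMeasure ((relProd μ T).map (R.prodCongr R')) :=
    Measure.isProbabilityMeasure_map (R.prodCongr R').measurable.aemeasurable
  refine Measure.ext_prod fun {A B} hA hB => ?_
  rw [Measure.map_apply (R.prodCongr R').measurable (hA.prod hB)]
  have e : (R.prodCongr R') ⁻¹' (A ×ˢ B) = (R ⁻¹' A) ×ˢ (R' ⁻¹' B) := rfl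
  rw [e, ← measureReal_eq_measureReal_iff]
  have e1 := relProd_real_prod (μ := μ) T (R.measurable hA) (R'.measurable hB)
  have e2 := relProd_real_prod (μ := μ) T hA hB
  have e3 := hR.setIntegral_preimage_emb R.measurableEmbedding
    (μ[B.indicator fun _ => (1 : ℂ)|singleInv T]) A
  have e4 : ∫ x in R ⁻¹' A, (μ[(R' ⁻¹' B).indicator fun _ => (1 : ℂ)|singleInv T]) x ∂μ =
      ∫ x in R ⁻¹' A, (μ[B.indicator fun _ => (1 : ℂ)|singleInv T]) (R x) ∂μ := by
    refine integral_congr_ae (ae_restrict_of_ae ?_)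
    exact h B hB
  rw [e4, e3, ← e2] at e1
  exact_mod_cast e1

theorem measurePreserving_prodCongr_diag {T R : X ≃ᵐ X} (hR : MeasurePreserving R μ μ)
    (hcomm : ∀ x, R (T x) = T (R x)) :
    MeasurePreserving (R.prodCongr R) (relProd μ T) (relProd μ T) :=
  measurePreserving_prodCongr hR fun _ hB =>
    condExp_comp_equiv hR (jointInv_le _) (jointInv_comap _ fun _ => hcomm)
      (integrable_indicator_one hB)

theorem measurePreserving_prodCongr_right {T : X ≃ᵐ X} (hT : MeasurePreserving T μ μ) :
    MeasurePreserving ((MeasurableEquiv.refl X).prodCongr T) (relProd μ T) (relProd μ T) :=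
  measurePreserving_prodCongr (MeasurePreserving.id μ) fun _ hB =>
    condExp_jointInv_comp (S := fun _ : Unit => T) (i := ()) hT (integrable_indicator_one hB)

theorem measurePreserving_prodCongr_left {T : X ≃ᵐ X} (hT : MeasurePreserving T μ μ) :
    MeasurePreserving (T.prodCongr (MeasurableEquiv.refl X)) (relProd μ T) (relProd μ T) :=
  measurePreserving_prodCongr hT fun B _ => Eventually.of_forall fun x => by
    have h : Measurable[singleInv T] (μ[B.indicator fun _ => (1 : ℂ)|singleInv T]) :=
      stronglyMeasurable_condExp.measurable
    exact (jointInv_apply_eq (S := fun _ : Unit => T) h () x).symm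

/-- A function on the relative product that is invariant under `id × T` depends only on the first
coordinate. -/
theorem exists_fst_of_invariant {T : X ≃ᵐ X} (hT : MeasurePreserving T μ μ) {w : X × X → ℂ}
    (hw : Measurable w)
    (h : ∀ᵐ p ∂(relProd μ T), w ((MeasurableEquiv.refl X).prodCongr T p) = w p) :
    ∃ v : X → ℂ, Measurable v ∧ ∀ᵐ p ∂(relProd μ T), w p = v p.1 := by
  refine ⟨fun x => ∫ z, w (x, z) ∂(relKernel μ T x),
    (hw.stronglyMeasurable.integral_kernel_prod_right' (κ := relKernel μ T)).measurable, ?_⟩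
  have hm : MeasurableSet {p : X × X | w ((MeasurableEquiv.refl X).prodCongr T p) = w p} :=
    measurableSet_eq_fun (hw.comp (MeasurableEquiv.measurable _)) hw
  have hv : Measurable fun x => ∫ z, w (x, z) ∂(relKernel μ T x) :=
    (hw.stronglyMeasurable.integral_kernel_prod_right' (κ := relKernel μ T)).measurable
  rw [relProd, Measure.ae_compProd_iff hm] at h
  have hm' := measurableSet_eq_fun hw (hv.comp measurable_fst)
  refine (Measure.ae_compProd_iff hm').2 ?_
  have herg := ae_ergodic_condExpKernel (ν := μ) (S := fun _ : Unit => T) (fun _ => hT)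
  have hmp := ae_measurePreserving_condExpKernel (ν := μ) (S := fun _ : Unit => T) (fun _ => hT)
  filter_upwards [h, herg, hmp] with x hx he hp
  simp only [Function.comp_apply]
  rw [relKernel_apply] at hx ⊢
  -- The fibre measures are T-ergodic, so w(x, ·), being invariant under T, is almost surely
  -- constant.
  have hergT : Ergodic T (condExpKernel μ (singleInv T) x) := by
    refine ⟨hp (), ⟨fun s hs hinv => ?_⟩⟩
    rcases he s ⟨hs, fun _ => hinv⟩ with h0 | h1
    · exact eventuallyConst_set'.2 (Or.inl (ae_eq_empty.2 h0))
    · exact eventuallyConst_set'.2 (Or.inr (ae_eq_univ.2 ((prob_compl_eq_zero_iff hs).2 h1)))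
  obtain ⟨c, hc⟩ := hergT.ae_eq_const_of_ae_eq_comp₀ (g := fun z => w (x, z))
    (hw.comp measurable_prodMk_left).nullMeasurable hx
  have hint : ∫ z, w (x, z) ∂(condExpKernel μ (singleInv T) x) = c := by
    rw [integral_congr_ae hc]; simp
  filter_upwards [hc] with z hz
  rw [hint, hz]; rfl

/-- The self-correlation of `f ⊗ conj f` in the relative product. -/
theorem integral_tensor_conj (T : X ≃ᵐ X) {f : X → ℂ} (hf : Measurable f) {B : ℝ}
    (hfb : ∀ x, ‖f x‖ ≤ B) :
    (∫ p, f p.1 * conj (f p.2) ∂(relProd μ T)).re = ∫ x, ‖(μ[f|singleInv T]) x‖ ^ 2 ∂μ := by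
  have hle := jointInv_le fun _ : Unit => T
  have hcm : Measurable fun x => conj (f x) := Complex.continuous_conj.measurable.comp hf
  have hint : Integrable f μ := Integrable.of_bound hf.aestronglyMeasurable B (Eventually.of_forall hfb)
  rw [integral_relProd T (g := fun x => conj (f x)) hf hcm hfb (C := B)
    (fun x => by rw [RCLike.norm_conj]; exact hfb x)]
  have h1 : μ[fun x => conj (f x)|singleInv T] =ᵐ[μ] fun x => conj ((μ[f|singleInv T]) x) := by
    have := ContinuousLinearMap.comp_condExp_comm (m := singleInv T) hint
      (Complex.conjCLE : ℂ →L[ℝ] ℂ)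
    exact this.symm
  set g := μ[f|singleInv T] with hg
  have hgs : StronglyMeasurable[singleInv T] g := stronglyMeasurable_condExp
  have hgb : ∀ᵐ x ∂μ, ‖g x‖ ≤ B := ae_bdd_norm_condExp_of_ae_bdd_norm (Eventually.of_forall hfb)
  have hcg : StronglyMeasurable[singleInv T] fun x => conj (g x) :=
    Complex.continuous_conj.comp_stronglyMeasurable hgs
  have hi : Integrable (fun x => conj (g x) * f x) μ := by
    refine Integrable.of_bound ((hcg.mono hle).aestronglyMeasurable.mul hf.aestronglyMeasurable)
      (B * B) ?_
    filter_upwards [hgb] with x hx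
    rw [norm_mul, RCLike.norm_conj]
    exact mul_le_mul hx (hfb _) (norm_nonneg _) ((norm_nonneg _).trans hx)
  have h2 := condExp_bilin_of_stronglyMeasurable_left (m := singleInv T) (μ := μ)
    (ContinuousLinearMap.mul ℝ ℂ) hcg (by simpa using hi) hint
  have h3 : ∫ x, f x * (μ[fun x => conj (f x)|singleInv T]) x ∂μ =
      ∫ x, (μ[fun x => conj (g x) * f x|singleInv T]) x ∂μ := by
    rw [integral_condExp hle]
    refine integral_congr_ae ?_
    filter_upwards [h1] with x hx
    rw [hx, mul_comm]
  rw [h3]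
  refine (integral_re (𝕜 := ℂ) integrable_condExp).symm.trans ?_
  refine integral_congr_ae ?_
  filter_upwards [h2] with x hx
  simp only [ContinuousLinearMap.mul_apply'] at hx
  rw [hx, ← hg]
  simp only [RCLike.re_to_complex]
  rw [← Complex.normSq_eq_conj_mul_self, Complex.ofReal_re, Complex.normSq_eq_norm_sq]

end RelativeProduct

/-! ### Points of cubes generated by commuting transformations. -/

section Cube

variable {X : Type*} [MeasurableSpace X] {μ : Measure X}

theorem cubePoint_succ {s : ℕ} (R : Fin (s + 1) → X ≃ᵐ X) (k : Fin (s + 1) → ℕ) (x : X) :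
    cubePoint R k x = cubePoint (Fin.init R) (Fin.init k) ((R (Fin.last s))^[k (Fin.last s)] x) := by
  unfold cubePoint
  rw [List.ofFn_succ', List.prod_concat, Equiv.Perm.mul_apply]
  have : (((R (Fin.last s)).toEquiv : Equiv.Perm X) ^ k (Fin.last s)) x =
      (R (Fin.last s))^[k (Fin.last s)] x := by
    rw [← Equiv.Perm.iterate_eq_pow]; rfl
  rw [this]; rfl

theorem cubePoint_nil (R : Fin 0 → X ≃ᵐ X) (k : Fin 0 → ℕ) (x : X) : cubePoint R k x = x := by
  simp [cubePoint]

theorem iterate_comm {R Q : X ≃ᵐ X} (h : ∀ x, R (Q x) = Q (R x)) (m n : ℕ) (x : X) :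
    R^[m] (Q^[n] x) = Q^[n] (R^[m] x) :=
  (Function.Commute.iterate_iterate (f := R) (g := Q) h m n) x

theorem cubePoint_comm {s : ℕ} {R : Fin s → X ≃ᵐ X} {Q : X ≃ᵐ X} (h : ∀ i x, R i (Q x) = Q (R i x))
    (k : Fin s → ℕ) (n : ℕ) (x : X) :
    cubePoint R k (Q^[n] x) = Q^[n] (cubePoint R k x) := by
  induction s generalizing x with
  | zero => simp [cubePoint_nil]
  | succ s ih =>
    rw [cubePoint_succ, cubePoint_succ, iterate_comm (h _), ih]
    exact fun i x => h _ x

theorem measurePreserving_cubePoint {s : ℕ} {R : Fin s → X ≃ᵐ X}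
    (h : ∀ i, MeasurePreserving (R i) μ μ) (k : Fin s → ℕ) :
    MeasurePreserving (cubePoint R k) μ μ := by
  induction s with
  | zero => 
    have : cubePoint R k = id := funext fun x => cubePoint_nil R k x
    rw [this]; exact MeasurePreserving.id μ
  | succ s ih =>
    have : cubePoint R k = cubePoint (Fin.init R) (Fin.init k) ∘
        (R (Fin.last s))^[k (Fin.last s)] := funext fun x => cubePoint_succ R k x
    rw [this]
    exact (ih (fun i => h _) _).comp ((h _).iterate _)

theorem cubePoint_zero {s : ℕ} (R : Fin s → X ≃ᵐ X) (x : X) : cubePoint R (fun _ => 0) x = x := by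
  induction s with
  | zero => exact cubePoint_nil R _ x
  | succ s ih => rw [cubePoint_succ]; exact ih _

end Cube

/-! ### Box seminorms as upper bounds witnessed at finite scales, without limits. -/

section Box

variable {X : Type*} [MeasurableSpace X] {μ : Measure X}

/-- The correlation `f ∘ R^k · conj (f ∘ R^k')`. -/
def corr (R : X ≃ᵐ X) (f : X → ℂ) (k k' : ℕ) : X → ℂ :=
  fun x => f (R^[k] x) * conj (f (R^[k'] x))

/-- `BoxLE μ L f c` says that the (power of the) box seminorm of `f` along the list `L`, computed by
iterated averaging with the head of `L` outermost, is at most `c`. -/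
def BoxLE (μ : Measure X) : List (X ≃ᵐ X) → (X → ℂ) → ℝ → Prop
  | [], f, c => (∫ x, f x ∂μ).re ≤ c
  | R :: L, f, c => 0 ≤ c ∧ ∀ η > 0, ∃ K > 0, ∃ a : ℕ → ℕ → ℝ,
      (∀ k < K, ∀ k' < K, BoxLE μ L (corr R f k k') (a k k')) ∧
      ((K : ℝ) ^ 2)⁻¹ * ∑ k ∈ Finset.range K, ∑ k' ∈ Finset.range K, a k k' ≤ c + η

theorem measurable_corr {R : X ≃ᵐ X} {f : X → ℂ} (hf : Measurable f) (k k' : ℕ) :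
    Measurable (corr R f k k') :=
  (hf.comp (R.measurable.iterate k)).mul
    (Complex.continuous_conj.measurable.comp (hf.comp (R.measurable.iterate k')))

theorem norm_corr_le {R : X ≃ᵐ X} {f : X → ℂ} {B : ℝ} (hf : ∀ x, ‖f x‖ ≤ B) (k k' : ℕ) (x : X) :
    ‖corr R f k k' x‖ ≤ B * B := by
  rw [corr, norm_mul, RCLike.norm_conj]
  exact mul_le_mul (hf _) (hf _) (norm_nonneg _) ((norm_nonneg _).trans (hf x))

/-- Each correlation pairs f with its conjugate, so the unimodular factor cancels. For the empty
list this would fail. -/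
theorem BoxLE.const_mul {R : X ≃ᵐ X} {L : List (X ≃ᵐ X)} {f : X → ℂ} {c : ℝ}
    (h : BoxLE μ (R :: L) f c) {z : ℂ} (hz : z * conj z = 1) :
    BoxLE μ (R :: L) (fun x => z * f x) c := by
  have : ∀ k k', corr R (fun x => z * f x) k k' = corr R f k k' := by
    intro k k'; ext x
    simp only [corr, map_mul]
    linear_combination (f (R^[k] x) * conj (f (R^[k'] x))) * hz
  simpa only [BoxLE, this] using h

/-- The tensor `f ⊗ conj f`. -/
def tensorConj (f : X → ℂ) : X × X → ℂ := fun p => f p.1 * conj (f p.2)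

/-- Doubling commutes with taking correlations along a diagonal lift; this carries the induction of
`BoxLE.of_relProd`. -/
theorem corr_tensorConj (Q : X ≃ᵐ X) (f : X → ℂ) (k k' : ℕ) :
    corr (Q.prodCongr Q) (tensorConj f) k k' = tensorConj (corr Q f k k') := by
  have h : ∀ (n : ℕ) (p : X × X), (Q.prodCongr Q)^[n] p = (Q^[n] p.1, Q^[n] p.2) := by
    intro n p
    induction n generalizing p with
    | zero => rfl
    | succ n ih => rw [Function.iterate_succ_apply, ih]; rfl
  ext p
  simp only [corr, tensorConj, h, map_mul, Complex.conj_conj]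
  ring

/-- Passing to the relative product over `T` removes the innermost transformation. -/
theorem BoxLE.of_relProd [StandardBorelSpace X] [IsProbabilityMeasure μ] {T : X ≃ᵐ X}
    (hT : MeasurePreserving T μ μ) (M : List (X ≃ᵐ X)) {f : X → ℂ} (hf : Measurable f) {B : ℝ}
    (hfb : ∀ x, ‖f x‖ ≤ B) {c : ℝ}
    (h : BoxLE (relProd μ T) (M.map fun Q => Q.prodCongr Q) (tensorConj f) c) :
    BoxLE μ (M ++ [T]) f c := by
  induction M generalizing f B c with
  | nil =>
    -- The integral of f ⊗ conj f is ‖E[f | T-invariant sets]‖², which by the mean ergodic theorem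
    -- is the limit of the averaged T-correlations of f. A large K thus witnesses the bound for [T].
    have h0 := integral_tensor_conj (μ := μ) T hf hfb
    have h1 : ∫ x, ‖(μ[f|singleInv T]) x‖ ^ 2 ∂μ ≤ c := h0 ▸ h
    refine ⟨(integral_nonneg fun x => by positivity).trans h1, fun η hη => ?_⟩
    have h2 := tendsto_avg_correlation hT hf hfb
    obtain ⟨K, hK, hK'⟩ := ((h2.eventually_lt_const (lt_add_of_pos_right _ hη)).and
      (eventually_gt_atTop 0)).exists
    refine ⟨K, hK', fun k k' => (∫ y, f (T^[k] y) * conj (f (T^[k'] y)) ∂μ).re,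
      fun k _ k' _ => le_refl _, ?_⟩
    linarith
  | cons Q M ih =>
    refine ⟨h.1, fun η hη => ?_⟩
    obtain ⟨K, hK, a, ha, hle⟩ := h.2 η hη
    refine ⟨K, hK, a, fun k hk k' hk' => ?_, hle⟩
    have := ha k hk k' hk'
    rw [corr_tensorConj] at this
    exact ih (measurable_corr hf k k') (norm_corr_le hfb k k') this

end Box

/-! ### The Cauchy–Schwarz inequality behind van der Corput's lemma. -/

section VanDerCorput

variable {X : Type*} [MeasurableSpace X] {μ : Measure X}

theorem sq_integral_le [IsProbabilityMeasure μ] {u : X → ℝ} (hu : Integrable u μ)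
    (hu2 : Integrable (fun x => u x ^ 2) μ) : (∫ x, u x ∂μ) ^ 2 ≤ ∫ x, u x ^ 2 ∂μ := by
  set c := ∫ x, u x ∂μ with hc
  have h : 0 ≤ ∫ x, (u x - c) ^ 2 ∂μ := integral_nonneg fun x => sq_nonneg _
  have e : ∫ x, (u x - c) ^ 2 ∂μ = ∫ x, u x ^ 2 ∂μ - c ^ 2 := by
    have : ∀ x, (u x - c) ^ 2 = u x ^ 2 - (2 * c) * u x + c ^ 2 := fun x => by ring
    simp only [this]
    have i1 : Integrable (fun x => u x ^ 2 - (2 * c) * u x) μ := hu2.sub (hu.const_mul _)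
    rw [integral_add i1 (integrable_const _), integral_sub hu2 (hu.const_mul _),
      integral_const_mul, ← hc]
    simp; ring
  linarith

/-- Cauchy–Schwarz step in the van der Corput argument. -/
theorem norm_avg_sq_le [IsProbabilityMeasure μ] {α : Type*} (I : Finset α) (hI : I.Nonempty) {K : ℕ}
    {P : α → X → ℂ} {G : ℕ → α → X → ℂ} (hP : ∀ h, Measurable (P h))
    (hPb : ∀ h x, ‖P h x‖ ≤ 1) (hG : ∀ k h, Measurable (G k h)) (hGb : ∀ k h x, ‖G k h x‖ ≤ 1) :
    ‖(K : ℂ)⁻¹ * ∑ k ∈ Finset.range K, (I.card : ℂ)⁻¹ * ∑ h ∈ I, ∫ x, G k h x * P h x ∂μ‖ ^ 2 ≤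
      ((K : ℝ) ^ 2)⁻¹ * ∑ k ∈ Finset.range K, ∑ k' ∈ Finset.range K,
        ((I.card : ℂ)⁻¹ * ∑ h ∈ I, ∫ x, G k h x * conj (G k' h x) ∂μ).re := by
  have hIc : (0 : ℝ) < I.card := by exact_mod_cast hI.card_pos
  -- P does not depend on k, so the average over k can be taken inside. Cauchy–Schwarz for each h
  -- then drops P, convexity of the square brings the exponent inside the average over h, and |D|²
  -- expands into correlations.
  set D : α → X → ℂ := fun h x => (K : ℂ)⁻¹ * ∑ k ∈ Finset.range K, G k h x with hD
  have hDm : ∀ h, Measurable (D h) := fun h =>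
    (Finset.measurable_fun_sum _ fun k _ => hG k h).const_mul _
  have hDb : ∀ h x, ‖D h x‖ ≤ 1 := by
    intro h x
    rw [hD, norm_mul, norm_inv, Complex.norm_natCast]
    rcases Nat.eq_zero_or_pos K with h0 | h0
    · simp [h0]
    · rw [inv_mul_le_iff₀ (by positivity), mul_one]
      exact (norm_sum_le _ _).trans ((Finset.sum_le_sum fun k _ => hGb k h x).trans (by simp))
  have hint : ∀ {u : X → ℂ}, Measurable u → (∀ x, ‖u x‖ ≤ 1) → Integrable u μ := fun hu hb =>
    Integrable.of_bound hu.aestronglyMeasurable 1 (Eventually.of_forall hb)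
  have hmul1 : ∀ {a b : ℂ}, ‖a‖ ≤ 1 → ‖b‖ ≤ 1 → ‖a * b‖ ≤ 1 := fun {a b} ha hb => by
    rw [norm_mul]; exact mul_le_one₀ ha (norm_nonneg _) hb
  have e1 : (K : ℂ)⁻¹ * ∑ k ∈ Finset.range K, (I.card : ℂ)⁻¹ * ∑ h ∈ I, ∫ x, G k h x * P h x ∂μ =
      (I.card : ℂ)⁻¹ * ∑ h ∈ I, ∫ x, D h x * P h x ∂μ := by
    have : ∀ h, ∫ x, D h x * P h x ∂μ =
        (K : ℂ)⁻¹ * ∑ k ∈ Finset.range K, ∫ x, G k h x * P h x ∂μ := by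
      intro h
      rw [← integral_finsetSum, ← integral_const_mul]
      · simp only [hD, Finset.mul_sum, Finset.sum_mul, mul_assoc]
      · exact fun k _ => hint ((hG k h).mul (hP h)) fun x => hmul1 (hGb k h x) (hPb h x)
    simp only [this]
    rw [← Finset.mul_sum, ← Finset.mul_sum, Finset.sum_comm]
    ring
  have hn : ∀ h, ‖∫ x, D h x * P h x ∂μ‖ ^ 2 ≤ ∫ x, ‖D h x‖ ^ 2 ∂μ := by
    intro h
    have i1 : Integrable (fun x => ‖D h x‖) μ := (hint (hDm h) (hDb h)).norm
    have i2 : Integrable (fun x => ‖D h x‖ ^ 2) μ :=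
      Integrable.of_bound ((hDm h).norm.pow_const 2).aestronglyMeasurable 1
        (Eventually.of_forall fun x => by
          rw [norm_pow, norm_norm]; exact pow_le_one₀ (norm_nonneg _) (hDb h x))
    refine le_trans ?_ (sq_integral_le i1 i2)
    refine pow_le_pow_left₀ (norm_nonneg _) ((norm_integral_le_integral_norm _).trans ?_) 2
    refine integral_mono ((hint ((hDm h).mul (hP h)) fun x => hmul1 (hDb h x) (hPb h x)).norm) i1
      fun x => ?_
    simp only [norm_mul]
    exact mul_le_of_le_one_right (norm_nonneg _) (hPb h x)
  have hexp : ∀ h, ∫ x, ‖D h x‖ ^ 2 ∂μ = ((K : ℝ) ^ 2)⁻¹ * ∑ k ∈ Finset.range K,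
      ∑ k' ∈ Finset.range K, (∫ x, G k h x * conj (G k' h x) ∂μ).re := by
    intro h
    have hi : ∀ k k', Integrable (fun x => G k h x * conj (G k' h x)) μ := fun k k' =>
      hint ((hG k h).mul (Complex.continuous_conj.measurable.comp (hG k' h)))
        fun x => hmul1 (hGb k h x) (by rw [RCLike.norm_conj]; exact hGb k' h x)
    have e : ∀ x, ‖D h x‖ ^ 2 = ((K : ℝ) ^ 2)⁻¹ * ∑ k ∈ Finset.range K, ∑ k' ∈ Finset.range K,
        (G k h x * conj (G k' h x)).re := by
      intro x
      rw [hD, norm_mul, mul_pow, norm_inv, Complex.norm_natCast, inv_pow]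
      congr 1
      rw [← Complex.normSq_eq_norm_sq, ← Complex.ofReal_re (Complex.normSq _),
        Complex.normSq_eq_conj_mul_self, mul_comm, map_sum, Finset.sum_mul_sum, Complex.re_sum]
      exact Finset.sum_congr rfl fun k _ => Complex.re_sum _ _
    simp only [e]
    rw [integral_const_mul]
    congr 1
    rw [integral_finsetSum]
    · refine Finset.sum_congr rfl fun k _ => ?_
      rw [integral_finsetSum]
      · exact Finset.sum_congr rfl fun k' _ => integral_re (hi k k')
      · exact fun k' _ => (hi k k').re
    · exact fun k _ => integrable_finsetSum _ fun k' _ => (hi k k').re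
  have hre : ∀ z : ℂ, ((I.card : ℂ)⁻¹ * z).re = (I.card : ℝ)⁻¹ * z.re := fun z => by
    rw [← Complex.ofReal_natCast, ← Complex.ofReal_inv, Complex.re_ofReal_mul]
  rw [e1]
  calc ‖(I.card : ℂ)⁻¹ * ∑ h ∈ I, ∫ x, D h x * P h x ∂μ‖ ^ 2
      ≤ ((I.card : ℝ)⁻¹ * ∑ h ∈ I, ‖∫ x, D h x * P h x ∂μ‖) ^ 2 := by
        refine pow_le_pow_left₀ (norm_nonneg _) ?_ 2
        rw [norm_mul, norm_inv, Complex.norm_natCast]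
        gcongr
        exact norm_sum_le _ _
    _ ≤ (I.card : ℝ)⁻¹ * ∑ h ∈ I, ‖∫ x, D h x * P h x ∂μ‖ ^ 2 := by
        have := Real.pow_arith_mean_le_arith_mean_pow I (fun _ => (I.card : ℝ)⁻¹)
          (fun h => ‖∫ x, D h x * P h x ∂μ‖) (fun _ _ => by positivity)
          (by rw [Finset.sum_const, nsmul_eq_mul, mul_inv_cancel₀ hIc.ne'])
          (fun _ _ => norm_nonneg _) 2
        rwa [← Finset.mul_sum, ← Finset.mul_sum] at this
    _ ≤ (I.card : ℝ)⁻¹ * ∑ h ∈ I, ∫ x, ‖D h x‖ ^ 2 ∂μ := by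
        gcongr with h _
        exact hn h
    _ = _ := by
        simp only [hexp, hre, Complex.re_sum]
        rw [← Finset.mul_sum, Finset.sum_comm, mul_left_comm]
        congr 1
        rw [Finset.mul_sum]
        refine Finset.sum_congr rfl fun k _ => ?_
        rw [Finset.sum_comm, Finset.mul_sum]

end VanDerCorput

/-! ### Multilinear cube averages are controlled by box seminorms. -/

section MultilinearAverage

variable {X : Type*} [MeasurableSpace X] {μ : Measure X}

/-- The exponents `ε · h`. -/
def cubeExp {s : ℕ} (ε : Fin s → Fin 2) (h : Fin s → ℕ) : Fin s → ℕ := fun i => (ε i : ℕ) * h i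

/-- The averages `𝔼_h ∫ ∏_ε F_ε(R^{ε·h} x)`. -/
def cubeAvg (μ : Measure X) {s : ℕ} (R : Fin s → X ≃ᵐ X) (F : (Fin s → Fin 2) → X → ℂ)
    (H : ℕ) : ℂ :=
  ((Fintype.piFinset fun _ : Fin s => Finset.Icc 1 H).card : ℂ)⁻¹ *
    ∑ h ∈ Fintype.piFinset (fun _ : Fin s => Finset.Icc 1 H),
      ∫ x, ∏ ε, F ε (cubePoint R (cubeExp ε h) x) ∂μ

theorem prod_cube_succ {s : ℕ} (g : (Fin (s + 1) → Fin 2) → ℂ) :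
    ∏ ε, g ε = ∏ ε : Fin s → Fin 2, g (Fin.snoc (α := fun _ => Fin 2) ε 0) *
      g (Fin.snoc (α := fun _ => Fin 2) ε 1) := by
  rw [← (Fin.snocEquiv fun _ : Fin (s + 1) => Fin 2).prod_comp, Fintype.prod_prod_type_right]
  refine Finset.prod_congr rfl fun ε _ => ?_
  rw [Fin.prod_univ_two]; rfl

theorem sum_piFinset_succ {s : ℕ} (I : Finset ℕ) (g : (Fin (s + 1) → ℕ) → ℂ) :
    ∑ h ∈ Fintype.piFinset (fun _ : Fin (s + 1) => I), g h =
      ∑ m ∈ I, ∑ h ∈ Fintype.piFinset (fun _ : Fin s => I),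
        g (Fin.snoc (α := fun _ => ℕ) h m) := by
  rw [← Finset.sum_product']
  symm
  refine Finset.sum_bij' (fun p _ => Fin.snoc (α := fun _ => ℕ) p.2 p.1)
    (fun h _ => (h (Fin.last s), Fin.init h)) ?_ ?_ ?_ ?_ ?_
  · intro p hp
    rw [Finset.mem_product, Fintype.mem_piFinset] at hp
    rw [Fintype.mem_piFinset]
    intro i
    refine Fin.lastCases ?_ (fun i => ?_) i
    · simpa using hp.1
    · simpa using hp.2 i
  · intro h hh
    rw [Fintype.mem_piFinset] at hh
    rw [Finset.mem_product, Fintype.mem_piFinset]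
    exact ⟨hh _, fun i => hh _⟩
  · intro p _; simp
  · intro h _; simp
  · intro p _; rfl

theorem cubePoint_snoc {s : ℕ} {R : Fin (s + 1) → X ≃ᵐ X}
    (hcomm : ∀ i j x, R i (R j x) = R j (R i x))
    (ε : Fin s → Fin 2) (e : Fin 2) (h : Fin s → ℕ) (m : ℕ) (x : X) :
    cubePoint R (cubeExp (Fin.snoc (α := fun _ => Fin 2) ε e) (Fin.snoc (α := fun _ => ℕ) h m)) x =
      (R (Fin.last s))^[(e : ℕ) * m] (cubePoint (Fin.init R) (cubeExp ε h) x) := by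
  rw [cubePoint_succ, cubePoint_comm (R := Fin.init R) (Q := R (Fin.last s)) fun i x => hcomm _ _ x]
  congr 1
  · simp [cubeExp]
  · congr 1
    ext i
    simp [cubeExp, Fin.init]

/-- Vertices are paired along the last direction: F at ε_last = 0 is multiplied by a shift by `m` of
F at ε_last = 1. -/
theorem cubeAvg_succ {s : ℕ} {R : Fin (s + 1) → X ≃ᵐ X}
    (hcomm : ∀ i j x, R i (R j x) = R j (R i x)) (F : (Fin (s + 1) → Fin 2) → X → ℂ) (H : ℕ) :
    cubeAvg μ R F H = (H : ℂ)⁻¹ * ∑ m ∈ Finset.Icc 1 H, cubeAvg μ (Fin.init R)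
      (fun ε x => F (Fin.snoc (α := fun _ => Fin 2) ε 0) x *
        F (Fin.snoc (α := fun _ => Fin 2) ε 1) ((R (Fin.last s))^[m] x)) H := by
  unfold cubeAvg
  rw [sum_piFinset_succ, ← Finset.mul_sum, ← mul_assoc]
  congr 1
  · simp [Fintype.card_piFinset, pow_succ, mul_comm]
  · refine Finset.sum_congr rfl fun m _ => Finset.sum_congr rfl fun h _ => ?_
    refine integral_congr_ae (Eventually.of_forall fun x => ?_)
    simp only
    rw [prod_cube_succ]
    refine Finset.prod_congr rfl fun ε _ => ?_
    rw [cubePoint_snoc hcomm, cubePoint_snoc hcomm]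
    simp

theorem norm_cubeAvg_le [IsProbabilityMeasure μ] {s : ℕ} (R : Fin s → X ≃ᵐ X)
    {F : (Fin s → Fin 2) → X → ℂ} (hF : ∀ ε x, ‖F ε x‖ ≤ 1) (H : ℕ) : ‖cubeAvg μ R F H‖ ≤ 1 := by
  rw [cubeAvg, norm_mul, norm_inv, Complex.norm_natCast]
  set I := Fintype.piFinset (fun _ : Fin s => Finset.Icc 1 H)
  rcases Nat.eq_zero_or_pos I.card with h0 | h0
  · simp [h0]
  · rw [inv_mul_le_iff₀ (by positivity), mul_one]
    refine (norm_sum_le _ _).trans ((Finset.sum_le_sum (g := fun _ => 1) fun h _ => ?_).trans (by simp))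
    refine (norm_integral_le_of_norm_le_const (C := 1) (Eventually.of_forall fun x => ?_)).trans
      (by simp)
    rw [norm_prod]
    exact Finset.prod_le_one (fun _ _ => norm_nonneg _) fun ε _ => hF _ _

/-- Q commutes with the cube maps, so the power of Q can be moved to the base point, where
invariance of μ absorbs it. -/
theorem cubeAvg_comp {s : ℕ} {R : Fin s → X ≃ᵐ X} {Q : X ≃ᵐ X} (hQ : MeasurePreserving Q μ μ)
    (hcomm : ∀ i x, R i (Q x) = Q (R i x)) (F : (Fin s → Fin 2) → X → ℂ) (n H : ℕ) :
    cubeAvg μ R (fun ε x => F ε (Q^[n] x)) H = cubeAvg μ R F H := by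
  unfold cubeAvg
  congr 1
  refine Finset.sum_congr rfl fun h _ => ?_
  have hn : MeasurePreserving (Q^[n]) μ μ := hQ.iterate n
  have hemb : MeasurableEmbedding (Q^[n]) := by
    induction n with
    | zero => exact MeasurableEmbedding.id
    | succ n ih =>
      rw [Function.iterate_succ]
      exact (ih (hQ.iterate n)).comp Q.measurableEmbedding
  rw [← hn.integral_comp hemb fun x => ∏ ε, F ε (cubePoint R (cubeExp ε h) x)]
  simp only [cubePoint_comm hcomm]

/-- `a` asymptotically bounds the averages over cubes with `F 0 = f`, uniformly over the other
functions. -/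
def UnifLE (μ : Measure X) {s : ℕ} (R : Fin s → X ≃ᵐ X) (f : X → ℂ) (a : ℝ) : Prop :=
  ∀ η > 0, ∀ᶠ H : ℕ in atTop, ∀ F : (Fin s → Fin 2) → X → ℂ, F 0 = f → (∀ ε, Measurable (F ε)) →
    (∀ ε x, ‖F ε x‖ ≤ 1) → (cubeAvg μ R F H).re ≤ a + η

theorem norm_sum_shift_le {b : ℕ → ℂ} (hb : ∀ m, ‖b m‖ ≤ 1) (H j : ℕ) :
    ‖∑ m ∈ Finset.Icc 1 H, b m - ∑ m ∈ Finset.Icc 1 H, b (m + j)‖ ≤ 2 * j := by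
  induction j with
  | zero => simp
  | succ j ih =>
    have h1 : ∑ m ∈ Finset.Icc 1 H, b (m + (j + 1)) =
        ∑ m ∈ Finset.Icc 1 H, b (m + j) + b (H + 1 + j) - b (1 + j) := by
      clear ih
      induction H with
      | zero => simp
      | succ H ih =>
        rw [Finset.sum_Icc_succ_top (by omega), Finset.sum_Icc_succ_top (by omega), ih]
        have e : H + 1 + (j + 1) = H + 1 + 1 + j := by ring
        rw [e]; ring
    rw [h1]
    have : ∑ m ∈ Finset.Icc 1 H, b m - (∑ m ∈ Finset.Icc 1 H, b (m + j) + b (H + 1 + j) - b (1 + j)) =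
      (∑ m ∈ Finset.Icc 1 H, b m - ∑ m ∈ Finset.Icc 1 H, b (m + j)) + (b (1 + j) - b (H + 1 + j)) := by
      ring
    rw [this]
    refine (norm_add_le _ _).trans ?_
    have := norm_sub_le (b (1 + j)) (b (H + 1 + j))
    have := hb (1 + j)
    have := hb (H + 1 + j)
    push_cast
    linarith

/-- The van der Corput step, eliminating the last transformation. -/
theorem UnifLE.succ [IsProbabilityMeasure μ] {s : ℕ} {R : Fin (s + 1) → X ≃ᵐ X}
    (hcomm : ∀ i j x, R i (R j x) = R j (R i x)) (hR : ∀ i, MeasurePreserving (R i) μ μ)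
    {f : X → ℂ} {K : ℕ} (hK : 0 < K) {a : ℕ → ℕ → ℝ}
    (h : ∀ k < K, ∀ k' < K, UnifLE μ (Fin.init R) (corr (R (Fin.last s)) f k k') (a k k')) :
    UnifLE μ R f (√(((K : ℝ) ^ 2)⁻¹ * ∑ k ∈ Finset.range K, ∑ k' ∈ Finset.range K, a k k')) := by
  set A := ((K : ℝ) ^ 2)⁻¹ * ∑ k ∈ Finset.range K, ∑ k' ∈ Finset.range K, a k k' with hA
  intro η hη
  have hK0 : (0 : ℝ) < K := by exact_mod_cast hK
  -- The error (η / 2)² is chosen for the square root taken below, which turns it into η / 2; the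
  -- other half of η pays for replacing m by m + (K - k).
  have h1 : ∀ᶠ H : ℕ in atTop, ∀ k ∈ Finset.range K, ∀ k' ∈ Finset.range K,
      ∀ F : (Fin s → Fin 2) → X → ℂ, F 0 = corr (R (Fin.last s)) f k k' →
        (∀ ε, Measurable (F ε)) → (∀ ε x, ‖F ε x‖ ≤ 1) →
          (cubeAvg μ (Fin.init R) F H).re ≤ a k k' + (η / 2) ^ 2 := by
    rw [Filter.eventually_all_finset]
    intro k hk
    rw [Filter.eventually_all_finset]
    intro k' hk'
    exact h k (Finset.mem_range.1 hk) k' (Finset.mem_range.1 hk') _ (by positivity)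
  have h2 : ∀ᶠ H : ℕ in atTop, (2 * K : ℝ) / H ≤ η / 2 := by
    have : Tendsto (fun H : ℕ => (2 * K : ℝ) / H) atTop (𝓝 0) :=
      tendsto_const_div_atTop_nhds_zero_nat _
    exact this.eventually_le_const (by positivity)
  filter_upwards [h1, h2, eventually_gt_atTop 0] with H h1 h2 hH F hF0 hFm hFb
  have hH0 : (0 : ℝ) < H := by exact_mod_cast hH
  set Q := R (Fin.last s) with hQ
  set F0 : (Fin s → Fin 2) → X → ℂ := fun ε => F (Fin.snoc (α := fun _ => Fin 2) ε 0) with hF0'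
  set F1 : (Fin s → Fin 2) → X → ℂ := fun ε => F (Fin.snoc (α := fun _ => Fin 2) ε 1) with hF1'
  have hF00 : F0 0 = f := by
    rw [← hF0]
    simp only [hF0']
    congr 1
    ext i
    refine Fin.lastCases ?_ (fun i => ?_) i <;> simp
  set b : ℕ → ℂ := fun m => cubeAvg μ (Fin.init R) (fun ε x => F0 ε x * F1 ε (Q^[m] x)) H with hb
  have hb1 : ∀ m, ‖b m‖ ≤ 1 := fun m => norm_cubeAvg_le _ (fun ε x => by
    rw [norm_mul]; exact mul_le_one₀ (hFb _ _) (norm_nonneg _) (hFb _ _)) H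
  have hLam : cubeAvg μ R F H = (H : ℂ)⁻¹ * ∑ m ∈ Finset.Icc 1 H, b m := cubeAvg_succ hcomm F H
  have hQm : ∀ n, Measurable (Q^[n]) := fun n => Q.measurable.iterate n
  -- The average with shift m + (K - k) is translated by Q^k. The functions `F1` then all sit at
  -- Q^(m + K), whatever k is, so `norm_avg_sq_le` eliminates them and leaves correlations of the
  -- `F0`.
  have hm : ∀ m, ‖(K : ℂ)⁻¹ * ∑ k ∈ Finset.range K, b (m + (K - k))‖ ≤ √A + η / 2 := by
    intro m
    set I := Fintype.piFinset (fun _ : Fin s => Finset.Icc 1 H) with hI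
    have hIne : I.Nonempty := ⟨fun _ => 1, by rw [hI, Fintype.mem_piFinset]; intro i; simp; omega⟩
    have hcp : ∀ (ε : Fin s → Fin 2) h, Measurable (cubePoint (Fin.init R) (cubeExp ε h)) :=
      fun ε h => (measurePreserving_cubePoint (μ := μ) (fun i => hR _) _).measurable
    have key := norm_avg_sq_le (μ := μ) I hIne (K := K)
      (P := fun h x => ∏ ε, F1 ε (Q^[m + K] (cubePoint (Fin.init R) (cubeExp ε h) x)))
      (G := fun k h x => ∏ ε, F0 ε (Q^[k] (cubePoint (Fin.init R) (cubeExp ε h) x)))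
      (fun h => Finset.measurable_fun_prod _ fun ε _ => (hFm _).comp ((hQm _).comp (hcp ε h)))
      (fun h x => by
        rw [norm_prod]
        exact Finset.prod_le_one (fun _ _ => norm_nonneg _) fun ε _ => hFb _ _)
      (fun k h => Finset.measurable_fun_prod _ fun ε _ => (hFm _).comp ((hQm _).comp (hcp ε h)))
      (fun k h x => by
        rw [norm_prod]
        exact Finset.prod_le_one (fun _ _ => norm_nonneg _) fun ε _ => hFb _ _)
    have eL : ∀ k < K, b (m + (K - k)) = (I.card : ℂ)⁻¹ * ∑ h ∈ I, ∫ x,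
        (∏ ε, F0 ε (Q^[k] (cubePoint (Fin.init R) (cubeExp ε h) x))) *
          ∏ ε, F1 ε (Q^[m + K] (cubePoint (Fin.init R) (cubeExp ε h) x)) ∂μ := by
      intro k hk
      rw [hb]
      simp only
      rw [← cubeAvg_comp (R := Fin.init R) (Q := Q) (hR (Fin.last s)) (fun i x => hcomm _ _ x) _ k H]
      unfold cubeAvg
      congr 1
      refine Finset.sum_congr rfl fun h _ => integral_congr_ae (Eventually.of_forall fun x => ?_)
      simp only
      rw [← Finset.prod_mul_distrib]
      refine Finset.prod_congr rfl fun ε _ => ?_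
      rw [← Function.iterate_add_apply]
      congr 3
      omega
    rw [Finset.sum_congr rfl fun k hk => (eL k (Finset.mem_range.1 hk)).symm] at key
    have eR : ∀ k ∈ Finset.range K, ∀ k' ∈ Finset.range K,
        ((I.card : ℂ)⁻¹ * ∑ h ∈ I, ∫ x,
          (∏ ε, F0 ε (Q^[k] (cubePoint (Fin.init R) (cubeExp ε h) x))) *
          conj (∏ ε, F0 ε (Q^[k'] (cubePoint (Fin.init R) (cubeExp ε h) x))) ∂μ).re ≤
        a k k' + (η / 2) ^ 2 := by
      intro k hk k' hk'
      refine le_trans (le_of_eq ?_) (h1 k hk k' hk' (fun ε => corr Q (F0 ε) k k') (by rw [hF00])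
        (fun ε => measurable_corr (hFm _) _ _)
        (fun ε x => (norm_corr_le (fun x => hFb _ x) k k' x).trans (by norm_num)))
      unfold cubeAvg
      congr 2
      refine Finset.sum_congr rfl fun h _ => integral_congr_ae (Eventually.of_forall fun x => ?_)
      simp only [corr]
      rw [map_prod, ← Finset.prod_mul_distrib]
    have hle : ‖(K : ℂ)⁻¹ * ∑ k ∈ Finset.range K, b (m + (K - k))‖ ^ 2 ≤ A + (η / 2) ^ 2 := by
      refine key.trans ?_
      calc _ ≤ ((K : ℝ) ^ 2)⁻¹ * ∑ k ∈ Finset.range K, ∑ k' ∈ Finset.range K,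
            (a k k' + (η / 2) ^ 2) := by
            gcongr with k hk k' hk'
            exact eR k hk k' hk'
        _ = A + (η / 2) ^ 2 := by
            simp only [Finset.sum_add_distrib, mul_add, ← hA]
            congr 1
            simp
            field_simp
    -- A may be negative, with √A = 0 by convention; max A 0 treats both signs by √(x + y²) ≤ √x +
    -- y.
    calc _ ≤ √(A + (η / 2) ^ 2) := Real.le_sqrt_of_sq_le hle
      _ ≤ √(max A 0 + (η / 2) ^ 2) := Real.sqrt_le_sqrt (by gcongr; exact le_max_left _ _)
      _ ≤ √(max A 0) + η / 2 := by
        have h0 : 0 ≤ max A 0 := le_max_right _ _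
        refine Real.sqrt_le_iff.2 ⟨by positivity, ?_⟩
        have := Real.sqrt_nonneg (max A 0)
        nlinarith [Real.sq_sqrt h0]
      _ = √A + η / 2 := by
        congr 1
        rcases le_total A 0 with h0 | h0
        · rw [max_eq_right h0, Real.sqrt_zero, Real.sqrt_eq_zero_of_nonpos h0]
        · rw [max_eq_left h0]
  have hshift : ‖(H : ℂ)⁻¹ * ∑ m ∈ Finset.Icc 1 H, b m -
      (H : ℂ)⁻¹ * ∑ m ∈ Finset.Icc 1 H, (K : ℂ)⁻¹ * ∑ k ∈ Finset.range K, b (m + (K - k))‖ ≤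
      2 * K / H := by
    have hKc : (K : ℂ) ≠ 0 := by exact_mod_cast hK.ne'
    have e : ∑ m ∈ Finset.Icc 1 H, b m - ∑ m ∈ Finset.Icc 1 H, (K : ℂ)⁻¹ *
        ∑ k ∈ Finset.range K, b (m + (K - k)) = (K : ℂ)⁻¹ * ∑ k ∈ Finset.range K,
          (∑ m ∈ Finset.Icc 1 H, b m - ∑ m ∈ Finset.Icc 1 H, b (m + (K - k))) := by
      rw [Finset.sum_sub_distrib, Finset.sum_const, Finset.card_range, nsmul_eq_mul, mul_sub,
        ← mul_assoc, inv_mul_cancel₀ hKc, one_mul, ← Finset.mul_sum, Finset.sum_comm]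
    rw [← mul_sub, e, norm_mul, norm_mul, norm_inv, norm_inv, Complex.norm_natCast,
      Complex.norm_natCast, div_eq_inv_mul]
    refine mul_le_mul_of_nonneg_left ?_ (by positivity)
    rw [inv_mul_le_iff₀ hK0]
    refine (norm_sum_le _ _).trans ?_
    calc _ ≤ ∑ k ∈ Finset.range K, (2 * K : ℝ) := Finset.sum_le_sum fun k _ => by
          refine (norm_sum_shift_le hb1 H (K - k)).trans ?_
          gcongr
          exact Nat.sub_le K k
      _ = K * (2 * K) := by simp
  have hbig : ‖(H : ℂ)⁻¹ * ∑ m ∈ Finset.Icc 1 H, (K : ℂ)⁻¹ * ∑ k ∈ Finset.range K,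
      b (m + (K - k))‖ ≤ √A + η / 2 := by
    rw [norm_mul, norm_inv, Complex.norm_natCast, inv_mul_le_iff₀ hH0]
    refine (norm_sum_le _ _).trans ((Finset.sum_le_sum fun m _ => hm m).trans ?_)
    simp [mul_add]
  rw [hLam]
  refine (Complex.re_le_norm _).trans ?_
  have := norm_le_insert' ((H : ℂ)⁻¹ * ∑ m ∈ Finset.Icc 1 H, b m)
    ((H : ℂ)⁻¹ * ∑ m ∈ Finset.Icc 1 H, (K : ℂ)⁻¹ * ∑ k ∈ Finset.range K, b (m + (K - k)))
  linarith

/-- Each van der Corput step costs a square root, hence the exponent 2^s. The bounds for the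
correlations are combined by the power mean inequality. -/
theorem exists_unifLE_of_boxLE [IsProbabilityMeasure μ] {s : ℕ} {R : Fin s → X ≃ᵐ X}
    (hcomm : ∀ i j x, R i (R j x) = R j (R i x)) (hR : ∀ i, MeasurePreserving (R i) μ μ)
    {f : X → ℂ} {c : ℝ} (h : BoxLE μ (List.ofFn R).reverse f c) :
    ∀ η > 0, ∃ a : ℝ, a ^ (2 ^ s) ≤ c + η ∧ UnifLE μ R f a := by
  induction s generalizing f c with
  | zero =>
    intro η hη
    have h' : (∫ x, f x ∂μ).re ≤ c := by simpa [BoxLE] using h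
    refine ⟨c, by simp [hη.le], fun η' hη' => Eventually.of_forall fun H F hF _ _ => ?_⟩
    have : cubeAvg μ R F H = ∫ x, f x ∂μ := by
      simp only [cubeAvg, Fintype.piFinset_of_isEmpty, cubePoint_nil, Finset.univ_unique,
        Finset.card_singleton, Nat.cast_one, inv_one, one_mul, Finset.sum_singleton,
        Finset.prod_singleton]
      have hd : ∀ e : Fin 0 → Fin 2, F e = f := fun e => by rw [← hF, Subsingleton.elim e 0]
      simp only [hd]
    rw [this]; linarith
  | succ s ih =>
    intro η hη
    rw [List.ofFn_succ', List.concat_eq_append, List.reverse_append] at h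
    have h' : BoxLE μ (R (Fin.last s) :: (List.ofFn (Fin.init R)).reverse) f c := h
    obtain ⟨hc, h2⟩ := h'
    obtain ⟨K, hK, a', ha', hle⟩ := h2 (η / 2) (by positivity)
    have hex : ∀ k k', ∃ a : ℝ, k < K → k' < K → a ^ (2 ^ s) ≤ a' k k' + η / 2 ∧
        UnifLE μ (Fin.init R) (corr (R (Fin.last s)) f k k') a := by
      intro k k'
      by_cases hk : k < K
      · by_cases hk' : k' < K
        · obtain ⟨a, ha⟩ := ih (fun i j x => hcomm _ _ x) (fun i => hR _) (ha' k hk k' hk') (η / 2)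
            (by positivity)
          exact ⟨a, fun _ _ => ha⟩
        · exact ⟨0, fun _ h => absurd h hk'⟩
      · exact ⟨0, fun h => absurd h hk⟩
    choose a ha using hex
    refine ⟨_, ?_, UnifLE.succ hcomm hR hK fun k hk k' hk' => (ha k k' hk hk').2⟩
    set A := ((K : ℝ) ^ 2)⁻¹ * ∑ k ∈ Finset.range K, ∑ k' ∈ Finset.range K, a k k' with hA
    have hK0 : (0 : ℝ) < K := by exact_mod_cast hK
    rw [pow_succ' 2 s, pow_mul]
    -- If A ≤ 0 the new bound √A is 0, and what remains is 0 ≤ c + η; this is where the clause 0 ≤ c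
    -- of `BoxLE` enters.
    rcases le_total A 0 with h0 | h0
    · rw [Real.sqrt_eq_zero_of_nonpos h0]
      simp
      positivity
    · rw [Real.sq_sqrt h0]
      have hw : ∑ p ∈ Finset.range K ×ˢ Finset.range K, ((K : ℝ) ^ 2)⁻¹ = 1 := by
        rw [Finset.sum_const, Finset.card_product, Finset.card_range, nsmul_eq_mul]
        push_cast
        field_simp
      have hpm : A ^ (2 ^ s) ≤ ((K : ℝ) ^ 2)⁻¹ * ∑ k ∈ Finset.range K, ∑ k' ∈ Finset.range K,
          a k k' ^ (2 ^ s) := by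
        -- The a k k' may be negative, so the power mean inequality needs an even exponent. For s =
        -- 0 the exponent is 1 and both sides agree.
        rcases Nat.eq_zero_or_pos s with hs | hs
        · subst hs; simp [hA]
        · have := Real.pow_arith_mean_le_arith_mean_pow_of_even (Finset.range K ×ˢ Finset.range K)
            (fun _ => ((K : ℝ) ^ 2)⁻¹) (fun p => a p.1 p.2) (fun _ _ => by positivity) hw
            (n := 2 ^ s) (by rw [Nat.even_pow]; exact ⟨even_two, hs.ne'⟩)
          rw [← Finset.mul_sum, ← Finset.mul_sum, Finset.sum_product, Finset.sum_product] at this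
          exact this
      refine hpm.trans ?_
      calc _ ≤ ((K : ℝ) ^ 2)⁻¹ * ∑ k ∈ Finset.range K, ∑ k' ∈ Finset.range K,
            (a' k k' + η / 2) := by
            gcongr with k hk k' hk'
            exact (ha k k' (Finset.mem_range.1 hk) (Finset.mem_range.1 hk')).1
        _ = ((K : ℝ) ^ 2)⁻¹ * ∑ k ∈ Finset.range K, ∑ k' ∈ Finset.range K, a' k k' + η / 2 := by
            simp only [Finset.sum_add_distrib, mul_add]
            congr 1
            simp
            field_simp
        _ ≤ c + η := by linarith

theorem unifLE_zero_of_boxLE [IsProbabilityMeasure μ] {s : ℕ} {R : Fin s → X ≃ᵐ X}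
    (hcomm : ∀ i j x, R i (R j x) = R j (R i x)) (hR : ∀ i, MeasurePreserving (R i) μ μ)
    {f : X → ℂ} (h : BoxLE μ (List.ofFn R).reverse f 0) : UnifLE μ R f 0 := by
  intro η hη
  obtain ⟨a, ha, hU⟩ := exists_unifLE_of_boxLE hcomm hR h ((η / 2) ^ (2 ^ s)) (by positivity)
  have : a ≤ η / 2 := by
    by_contra! hlt
    have := pow_lt_pow_left₀ hlt (by positivity) (n := 2 ^ s) (by positivity)
    linarith
  filter_upwards [hU (η / 2) (by positivity)] with H hH F h1 h2 h3
  have := hH F h1 h2 h3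
  linarith

end MultilinearAverage

/-! ### Orthogonality of functions with vanishing seminorm to dual functions. -/

section DualFunctions

variable {X : Type*} [MeasurableSpace X] {μ : Measure X}

theorem conj_iterate_norm (k : ℕ) (z : ℂ) : ‖(starRingEnd ℂ)^[k] z‖ = ‖z‖ := by
  induction k generalizing z with
  | zero => rfl
  | succ k ih => rw [Function.iterate_succ_apply, ih, RCLike.norm_conj]

theorem conj_iterate_real_mul (k : ℕ) (c : ℝ) (z : ℂ) :
    (starRingEnd ℂ)^[k] (c * z) = c * (starRingEnd ℂ)^[k] z := by
  induction k generalizing z with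
  | zero => rfl
  | succ k ih => rw [Function.iterate_succ_apply, Function.iterate_succ_apply, map_mul,
      Complex.conj_ofReal, ih]

theorem measurable_conj_iterate (k : ℕ) : Measurable ((starRingEnd ℂ)^[k]) :=
  Complex.continuous_conj.measurable.iterate k

/-- An essentially bounded function agrees almost everywhere with a multiple of a measurable function
bounded by one. -/
theorem exists_bounded_repr {f : X → ℂ} (hf : MemLp f ∞ μ) :
    ∃ C : ℝ, 0 < C ∧ ∀ C' ≥ C, ∃ t : X → ℂ, Measurable t ∧ (∀ x, ‖t x‖ ≤ 1) ∧
      ∀ᵐ x ∂μ, f x = C' * t x := by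
  have hfin : eLpNormEssSup f μ < ∞ := by simpa using hf.2
  set C := (eLpNormEssSup f μ).toReal with hC
  have hb : ∀ᵐ x ∂μ, ‖f x‖ ≤ C := by
    filter_upwards [enorm_ae_le_eLpNormEssSup f μ] with x hx
    rw [hC, ← toReal_enorm]
    exact ENNReal.toReal_mono hfin.ne hx
  refine ⟨C + 1, by positivity, fun C' hC' => ?_⟩
  have hC0 : 0 ≤ C := ENNReal.toReal_nonneg
  have hC'0 : 0 < C' := by linarith
  have hC'c : (C' : ℂ) ≠ 0 := by exact_mod_cast hC'0.ne'
  have hg := hf.1.stronglyMeasurable_mk.measurable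
  set g := hf.1.mk f with hgdef
  refine ⟨{x | ‖g x‖ ≤ C'}.indicator fun x => (C' : ℂ)⁻¹ * g x,
    (hg.const_mul _).indicator (measurableSet_le hg.norm measurable_const), fun x => ?_, ?_⟩
  · by_cases hx : ‖g x‖ ≤ C'
    · rw [Set.indicator_of_mem (show x ∈ {x | ‖g x‖ ≤ C'} from hx), norm_mul, norm_inv,
        Complex.norm_real, Real.norm_of_nonneg hC'0.le, inv_mul_le_iff₀ hC'0, mul_one]
      exact hx
    · rw [Set.indicator_of_notMem (show x ∉ {x | ‖g x‖ ≤ C'} from hx)]; simp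
  · filter_upwards [hb, hf.1.ae_eq_mk] with x hx hx2
    have hgx : ‖g x‖ ≤ C' := by rw [hgdef, ← hx2]; linarith
    rw [Set.indicator_of_mem (show x ∈ {x | ‖g x‖ ≤ C'} from hgx), ← mul_assoc,
      mul_inv_cancel₀ hC'c, one_mul, hx2]

theorem eLpNorm_integral_tendsto [IsProbabilityMeasure μ] {f : X → ℂ} (hf : Measurable f)
    (hfb : ∀ x, ‖f x‖ ≤ 1) {D : ℕ → X → ℂ} {g : X → ℂ} (hD : ∀ H, Integrable (D H) μ)
    (hg : Integrable g μ)
    (h : Tendsto (fun H => eLpNorm (fun x => D H x - g x) 2 μ) atTop (𝓝 0)) :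
    Tendsto (fun H => ∫ x, f x * D H x ∂μ) atTop (𝓝 (∫ x, f x * g x ∂μ)) := by
  have hfi : ∀ {u : X → ℂ}, Integrable u μ → Integrable (fun x => f x * u x) μ := fun hu =>
    hu.bdd_mul (c := 1) hf.aestronglyMeasurable (Eventually.of_forall hfb)
  refine tendsto_integral_of_L1 _ (hfi hg).1 (Eventually.of_forall fun H => hfi (hD H)) ?_
  refine tendsto_of_tendsto_of_tendsto_of_le_of_le tendsto_const_nhds h (fun _ => zero_le)
    fun H => ?_
  calc ∫⁻ x, ‖f x * D H x - f x * g x‖ₑ ∂μ ≤ ∫⁻ x, ‖D H x - g x‖ₑ ∂μ := by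
        refine lintegral_mono fun x => ?_
        rw [← mul_sub, enorm_mul]
        refine mul_le_of_le_one_left (zero_le) ?_
        rw [← ofReal_norm]
        exact ENNReal.ofReal_le_one.2 (hfb x)
    _ = eLpNorm (fun x => D H x - g x) 1 μ := eLpNorm_one_eq_lintegral_enorm.symm
    _ ≤ eLpNorm (fun x => D H x - g x) 2 μ :=
        eLpNorm_le_eLpNorm_of_exponent_le (by norm_num) ((hD H).sub hg).1

/-- Functions with vanishing box seminorm are orthogonal to dual functions. -/
theorem integral_mul_dual_eq_zero [IsProbabilityMeasure μ] {s : ℕ} (hs : 0 < s) {R : Fin s → X ≃ᵐ X}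
    (hcomm : ∀ i j x, R i (R j x) = R j (R i x)) (hR : ∀ i, MeasurePreserving (R i) μ μ)
    {f : X → ℂ} (hf : Measurable f) (hfb : ∀ x, ‖f x‖ ≤ 1)
    (hbox : BoxLE μ (List.ofFn R).reverse f 0) {g : Lp ℂ 2 μ} (hg : IsDualFunction μ R g) :
    ∫ x, f x * g x ∂μ = 0 := by
  classical
  obtain ⟨φ, hφ, hlim⟩ := hg
  -- All f_ε are divided by one common bound C, so that the dual averages become C^n times averages
  -- of functions bounded by 1, as `UnifLE` requires; n is the number of nonzero vertices.
  choose C0 hC0 hφ' using fun ε => exists_bounded_repr (hφ ε)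
  set C : ℝ := ∑ ε, C0 ε with hC
  have hCge : ∀ ε, C ≥ C0 ε := fun ε =>
    Finset.single_le_sum (f := C0) (fun ε _ => (hC0 ε).le) (Finset.mem_univ ε)
  choose t htm htb ht using fun ε => hφ' ε C (hCge ε)
  set E := Finset.univ.filter (fun ε : Fin s → Fin 2 => ε ≠ 0) with hE
  set n := E.card with hn
  set w : (Fin s → Fin 2) → X → ℂ := fun ε x => (starRingEnd ℂ)^[∑ i, (ε i : ℕ)] (t ε x) with hw
  have hwm : ∀ ε, Measurable (w ε) := fun ε => (measurable_conj_iterate _).comp (htm ε)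
  have hwb : ∀ ε x, ‖w ε x‖ ≤ 1 := fun ε x => by rw [hw, conj_iterate_norm]; exact htb ε x
  have hcp : ∀ (ε : Fin s → Fin 2) h, MeasurePreserving (cubePoint R (cubeExp ε h)) μ μ :=
    fun ε h => measurePreserving_cubePoint hR _
  set I : ℕ → Finset (Fin s → ℕ) := fun H => Fintype.piFinset fun _ : Fin s => Finset.Icc 1 H
    with hI
  set D : ℕ → X → ℂ := fun H x => (C : ℂ) ^ n * (((I H).card : ℂ)⁻¹ * ∑ h ∈ I H,
    ∏ ε ∈ E, w ε (cubePoint R (cubeExp ε h) x)) with hD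
  have hprodb : ∀ h x, ‖∏ ε ∈ E, w ε (cubePoint R (cubeExp ε h) x)‖ ≤ 1 := fun h x => by
    rw [norm_prod]
    exact Finset.prod_le_one (fun _ _ => norm_nonneg _) fun ε _ => hwb _ _
  have hprodm : ∀ h, Measurable fun x => ∏ ε ∈ E, w ε (cubePoint R (cubeExp ε h) x) := fun h =>
    Finset.measurable_fun_prod _ fun ε _ => (hwm ε).comp (hcp ε h).measurable
  have hprodi : ∀ h, Integrable (fun x => ∏ ε ∈ E, w ε (cubePoint R (cubeExp ε h) x)) μ := fun h =>
    Integrable.of_bound (hprodm h).aestronglyMeasurable 1 (Eventually.of_forall (hprodb h))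
  have hDi : ∀ H, Integrable (D H) μ := fun H =>
    ((integrable_finsetSum _ fun h _ => hprodi h).const_mul _).const_mul _
  have hDae : ∀ H, ∀ᵐ x ∂μ, dualAverage R φ H x = D H x := by
    intro H
    have h1 : ∀ ε h, ∀ᵐ x ∂μ, φ ε (cubePoint R (cubeExp ε h) x) =
        C * t ε (cubePoint R (cubeExp ε h) x) := fun ε h =>
      (hcp ε h).quasiMeasurePreserving.ae (ht ε)
    have h2 : ∀ᵐ x ∂μ, ∀ ε, ∀ h ∈ I H, φ ε (cubePoint R (cubeExp ε h) x) =
        C * t ε (cubePoint R (cubeExp ε h) x) :=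
      ae_all_iff.2 fun ε => (Filter.eventually_all_finset (I H)).2 fun h _ => h1 ε h
    filter_upwards [h2] with x hx
    simp only [dualAverage, hD]
    have hcard : ((I H).card : ℂ) = (H : ℂ) ^ s := by simp [hI, Fintype.card_piFinset]
    rw [hcard, mul_left_comm]
    congr 1
    rw [Finset.mul_sum]
    refine Finset.sum_congr rfl fun h hh => ?_
    rw [hn, ← Finset.prod_const, ← Finset.prod_mul_distrib]
    refine Finset.prod_congr rfl fun ε _ => ?_
    rw [← conj_iterate_real_mul, ← hx ε h hh]
    rfl
  have hlim' : Tendsto (fun H => eLpNorm (fun x => D H x - g x) 2 μ) atTop (𝓝 0) := by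
    refine hlim.congr fun H => eLpNorm_congr_ae ?_
    filter_upwards [hDae H] with x hx
    rw [hx]
  have hgi : Integrable g μ := (Lp.memLp g).integrable (by norm_num)
  have hconv := eLpNorm_integral_tendsto hf hfb hDi hgi hlim'
  -- `UnifLE` bounds real parts from above only. Multiplying f by 1, -1, i and -i, which does not
  -- change the seminorm since s > 0, bounds the integral in all four directions.
  have key : ∀ z : ℂ, ‖z‖ = 1 → (z * ∫ x, f x * g x ∂μ).re ≤ 0 := by
    intro z hz
    have hz' : z * conj z = 1 := by
      rw [Complex.mul_conj, Complex.normSq_eq_norm_sq, hz]; simp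
    have hbox' : BoxLE μ (List.ofFn R).reverse (fun x => z * f x) 0 := by
      obtain ⟨s, rfl⟩ : ∃ m, s = m + 1 := ⟨s - 1, by omega⟩
      rw [List.ofFn_succ', List.concat_eq_append, List.reverse_append] at hbox ⊢
      exact BoxLE.const_mul hbox hz'
    have hU := unifLE_zero_of_boxLE hcomm hR hbox'
    have hCn : 0 ≤ C ^ n := pow_nonneg (Finset.sum_nonneg fun ε _ => (hC0 ε).le) _
    have hconv2 : Tendsto (fun H => (z * ∫ x, f x * D H x ∂μ).re) atTop
        (𝓝 (z * ∫ x, f x * g x ∂μ).re) :=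
      (Complex.continuous_re.tendsto _).comp (hconv.const_mul z)
    have hbound : ∀ η > 0, (z * ∫ x, f x * g x ∂μ).re ≤ C ^ n * (0 + η) := by
      intro η hη
      refine le_of_tendsto hconv2 ?_
      filter_upwards [hU η hη] with H hH
      set F : (Fin s → Fin 2) → X → ℂ := fun ε => if ε = 0 then fun x => z * f x else w ε with hF
      have h1 := hH F (by simp [hF])
        (fun ε => by simp only [hF]; split_ifs; exacts [hf.const_mul z, hwm ε])
        (fun ε x => by
          simp only [hF]
          split_ifs
          · rw [norm_mul, hz, one_mul]; exact hfb x
          · exact hwb ε x)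
      have e1 : z * ∫ x, f x * D H x ∂μ = (C : ℂ) ^ n * cubeAvg μ R F H := by
        have e2 : ∀ h x, ∏ ε, F ε (cubePoint R (cubeExp ε h) x) =
            (z * f x) * ∏ ε ∈ E, w ε (cubePoint R (cubeExp ε h) x) := by
          intro h x
          rw [← Finset.mul_prod_erase Finset.univ _ (Finset.mem_univ (0 : Fin s → Fin 2))]
          have hE' : Finset.univ.erase (0 : Fin s → Fin 2) = E := by ext ε; simp [hE]
          rw [hE']
          congr 1
          · have : cubeExp (0 : Fin s → Fin 2) h = fun _ => 0 := by ext i; simp [cubeExp]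
            rw [this, cubePoint_zero]; simp [hF]
          · refine Finset.prod_congr rfl fun ε hε => ?_
            have : ε ≠ 0 := by simpa [hE] using hε
            simp [hF, this]
        have hfi : ∀ h, Integrable (fun x => f x * ∏ ε ∈ E, w ε (cubePoint R (cubeExp ε h) x)) μ :=
          fun h => (hprodi h).bdd_mul (c := 1) hf.aestronglyMeasurable (Eventually.of_forall hfb)
        unfold cubeAvg
        simp only [e2, mul_assoc]
        simp only [integral_const_mul]
        rw [← Finset.mul_sum, ← integral_finsetSum _ fun h _ => hfi h]
        simp only [hD]
        rw [← integral_const_mul, ← integral_const_mul, ← integral_const_mul, ← integral_const_mul]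
        refine integral_congr_ae (Eventually.of_forall fun x => ?_)
        simp only [← Finset.mul_sum, hI]
        ring
      have e3 : ((C : ℂ) ^ n * cubeAvg μ R F H).re = C ^ n * (cubeAvg μ R F H).re := by
        rw [← Complex.ofReal_pow, Complex.re_ofReal_mul]
      rw [e1, e3]
      exact mul_le_mul_of_nonneg_left h1 hCn
    refine le_of_forall_pos_le_add fun δ hδ => ?_
    refine (hbound (δ / (C ^ n + 1)) (by positivity)).trans ?_
    rw [zero_add, zero_add, mul_div_assoc', div_le_iff₀ (by positivity)]
    nlinarith
  have h1 := key 1 (by simp)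
  have h2 := key (-1) (by simp)
  have h3 := key Complex.I (by simp)
  have h4 := key (-Complex.I) (by simp)
  refine Complex.ext ?_ ?_
  · simp at h1 h2 ⊢; linarith
  · simp at h3 h4 ⊢; linarith

end DualFunctions

/-! ### A finite Wiener lemma for stationary arrays. -/

section Parseval

theorem sum_pow_mul_conj_pow {ζ : ℂ} {m : ℕ} (hm : 0 < m) (hζ : IsPrimitiveRoot ζ m) {a b : ℕ}
    (ha : a < m) (hb : b < m) :
    ∑ j ∈ Finset.range m, (ζ ^ j) ^ a * conj ((ζ ^ j) ^ b) = if a = b then (m : ℂ) else 0 := by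
  have hn : ‖ζ‖ = 1 := hζ.norm'_eq_one hm.ne'
  have hc : ζ * conj ζ = 1 := by rw [Complex.mul_conj, Complex.normSq_eq_norm_sq, hn]; simp
  set z := ζ ^ a * conj (ζ ^ b) with hz
  have e : ∀ j, (ζ ^ j) ^ a * conj ((ζ ^ j) ^ b) = z ^ j := fun j => by
    rw [hz, mul_pow, map_pow, map_pow, map_pow]; ring
  simp only [e]
  have hcm : conj ζ ^ m = 1 := by rw [← map_pow, hζ.pow_eq_one, map_one]
  have hzm : z ^ m = 1 := by
    rw [hz, mul_pow, map_pow, ← pow_mul, ← pow_mul, mul_comm a, mul_comm b, pow_mul, pow_mul,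
      hζ.pow_eq_one, hcm, one_pow, one_pow, one_mul]
  split_ifs with hab
  · have : z = 1 := by rw [hz, hab, map_pow, ← mul_pow, hc, one_pow]
    simp [this]
  · have hne : z ≠ 1 := by
      intro h1
      refine hab (hζ.pow_inj ha hb ?_)
      have : z * ζ ^ b = ζ ^ a := by
        rw [hz, map_pow, mul_assoc, ← mul_pow, mul_comm (conj ζ), hc, one_pow, mul_one]
      rw [← this, h1, one_mul]
    have := mul_neg_geom_sum z m
    rw [hzm, sub_self, mul_eq_zero] at this
    exact this.resolve_left (sub_ne_zero.2 hne.symm)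

/-- A finite Parseval inequality: a stationary array whose Fejér means at the `4H`-th roots of unity
are small is small in mean square. -/
theorem avg_norm_sq_le_of_fejer_le {c : ℕ → ℕ → ℂ} (hc : ∀ k k', c (k + 1) (k' + 1) = c k k')
    (h0 : ‖c 0 0‖ ≤ 1) {H : ℕ} (hH : 0 < H) {ζ : ℂ} (hζ : IsPrimitiveRoot ζ (4 * H)) {α : ℝ}
    {p : ℕ → ℝ} (hp0 : ∀ j, 0 ≤ p j) (hpα : ∀ j < 4 * H, p j ≤ α)
    (hp : ∀ j, (p j : ℂ) = (((2 * H : ℕ) : ℂ) ^ 2)⁻¹ * ∑ k ∈ Finset.range (2 * H),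
      ∑ k' ∈ Finset.range (2 * H), conj ((ζ ^ j) ^ k) * (ζ ^ j) ^ k' * c k k') :
    ((H : ℝ) ^ 2)⁻¹ * ∑ k ∈ Finset.range H, ∑ k' ∈ Finset.range H, ‖c k k'‖ ^ 2 ≤ 8 * α := by
  set N := 2 * H with hN
  have hm : 0 < 4 * H := by omega
  have hHr : (0 : ℝ) < H := by exact_mod_cast hH
  have hct : ∀ t k k', c (k + t) (k' + t) = c k k' := by
    intro t k k'
    induction t with
    | zero => rfl
    | succ t ih => rw [← add_assoc, ← add_assoc, hc, ih]
  have hcq : ∀ k k' l l', k' + l = k + l' → c l l' = c k k' := by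
    intro k k' l l' h
    rcases le_total k l with h1 | h1
    · obtain ⟨t, rfl⟩ := Nat.exists_eq_add_of_le h1
      have : l' = k' + t := by omega
      rw [this, hct]
    · obtain ⟨t, rfl⟩ := Nat.exists_eq_add_of_le h1
      have : k' = l' + t := by omega
      rw [this, hct]
  -- Summing over the 4H-th roots of unity keeps only k = k', because the exponents are below 2H.
  -- The sum is 4H · 2H / (2H)² = 2 times c 0 0.
  have hs1 : ∑ j ∈ Finset.range (4 * H), p j ≤ 2 := by
    have e : ((∑ j ∈ Finset.range (4 * H), p j : ℝ) : ℂ) = 2 * c 0 0 := by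
      push_cast
      simp only [hp]
      rw [← Finset.mul_sum, Finset.sum_comm]
      have : ∀ k ∈ Finset.range N, ∑ j ∈ Finset.range (4 * H), ∑ k' ∈ Finset.range N,
          conj ((ζ ^ j) ^ k) * (ζ ^ j) ^ k' * c k k' = ((4 * H : ℕ) : ℂ) * c 0 0 := by
        intro k hk
        rw [Finset.sum_comm]
        have h2 : ∀ k' ∈ Finset.range N, ∑ j ∈ Finset.range (4 * H),
            conj ((ζ ^ j) ^ k) * (ζ ^ j) ^ k' * c k k' =
              if k' = k then ((4 * H : ℕ) : ℂ) * c 0 0 else 0 := by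
          intro k' hk'
          rw [Finset.mem_range] at hk hk'
          have := sum_pow_mul_conj_pow hm hζ (a := k') (b := k) (by omega) (by omega)
          rw [← Finset.sum_mul]
          simp only [mul_comm (conj _)]
          rw [this]
          split_ifs with h3
          · rw [h3]; have := hct k 0 0; rw [zero_add] at this; rw [this]
          · simp
        rw [Finset.sum_congr rfl h2, Finset.sum_ite_eq', if_pos hk]
      rw [Finset.sum_congr rfl this, Finset.sum_const, Finset.card_range, nsmul_eq_mul, hN]
      have : (H : ℂ) ≠ 0 := by exact_mod_cast hH.ne'
      push_cast
      field_simp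
      ring
    have h3 : ‖((∑ j ∈ Finset.range (4 * H), p j : ℝ) : ℂ)‖ ≤ 2 := by
      rw [e, norm_mul]; simpa using h0
    rw [Complex.norm_real] at h3
    exact (le_abs_self _).trans h3
  -- In the square the exponents k' + l and k + l' stay below 4H, so only true equality survives and
  -- there is no wrap-around: this is why 4H-th roots go with averages of length 2H.
  have hs2 : ∑ j ∈ Finset.range (4 * H), p j ^ 2 = (4 * H : ℝ) * ((N : ℝ) ^ 4)⁻¹ *
      ∑ k ∈ Finset.range N, ∑ k' ∈ Finset.range N, ∑ l ∈ Finset.range N, ∑ l' ∈ Finset.range N,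
        if k' + l = k + l' then ‖c k k'‖ ^ 2 else 0 := by
    have e : ∀ j, ((p j ^ 2 : ℝ) : ℂ) = ((N : ℂ) ^ 4)⁻¹ * ∑ k ∈ Finset.range N,
        ∑ k' ∈ Finset.range N, ∑ l ∈ Finset.range N, ∑ l' ∈ Finset.range N,
          ((ζ ^ j) ^ (k' + l) * conj ((ζ ^ j) ^ (k + l'))) * (c k k' * conj (c l l')) := by
      intro j
      have h1 : ((p j ^ 2 : ℝ) : ℂ) = (p j : ℂ) * conj (p j : ℂ) := by
        rw [Complex.conj_ofReal]; push_cast; ring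
      rw [h1, hp j]
      simp only [map_mul, map_inv₀, map_pow, map_sum, Complex.conj_natCast, Complex.conj_conj]
      rw [mul_mul_mul_comm, Finset.sum_mul]
      congr 1
      · rw [← mul_inv]; ring
      · refine Finset.sum_congr rfl fun k _ => ?_
        rw [Finset.sum_mul]
        refine Finset.sum_congr rfl fun k' _ => ?_
        rw [Finset.mul_sum]
        refine Finset.sum_congr rfl fun l _ => ?_
        rw [Finset.mul_sum]
        refine Finset.sum_congr rfl fun l' _ => ?_
        ring
    rw [← Complex.ofReal_inj]
    rw [Complex.ofReal_sum]
    simp only [e]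
    push_cast
    rw [← Finset.mul_sum, mul_comm (4 * (H : ℂ)), mul_assoc]
    congr 1
    rw [Finset.sum_comm, Finset.mul_sum]
    refine Finset.sum_congr rfl fun k hk => ?_
    rw [Finset.sum_comm, Finset.mul_sum]
    refine Finset.sum_congr rfl fun k' hk' => ?_
    rw [Finset.sum_comm, Finset.mul_sum]
    refine Finset.sum_congr rfl fun l hl => ?_
    rw [Finset.sum_comm, Finset.mul_sum]
    refine Finset.sum_congr rfl fun l' hl' => ?_
    rw [Finset.mem_range] at hk hk' hl hl'
    rw [← Finset.sum_mul, sum_pow_mul_conj_pow hm hζ (by omega) (by omega)]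
    split_ifs with h
    · rw [hcq _ _ _ _ h, Complex.mul_conj, Complex.normSq_eq_norm_sq]; push_cast; ring
    · simp
  -- Each pair (k, k') below H has at least H partners (k + t, k' + t), t < H, in the range of
  -- length 2H.
  have hs3 : (H : ℝ) * ∑ k ∈ Finset.range H, ∑ k' ∈ Finset.range H, ‖c k k'‖ ^ 2 ≤
      ∑ k ∈ Finset.range N, ∑ k' ∈ Finset.range N, ∑ l ∈ Finset.range N, ∑ l' ∈ Finset.range N,
        if k' + l = k + l' then ‖c k k'‖ ^ 2 else 0 := by
    have hsub : Finset.range H ⊆ Finset.range N := Finset.range_subset_range.2 (by omega)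
    have hnn : ∀ k k' l l', (0 : ℝ) ≤ if k' + l = k + l' then ‖c k k'‖ ^ 2 else 0 :=
      fun k k' l l' => by split_ifs <;> positivity
    rw [Finset.mul_sum]
    refine le_trans (Finset.sum_le_sum fun k hk => ?_)
      (Finset.sum_le_sum_of_subset_of_nonneg hsub fun k _ _ => Finset.sum_nonneg fun k' _ =>
        Finset.sum_nonneg fun l _ => Finset.sum_nonneg fun l' _ => hnn k k' l l')
    rw [Finset.mul_sum]
    refine le_trans (Finset.sum_le_sum fun k' hk' => ?_)
      (Finset.sum_le_sum_of_subset_of_nonneg hsub fun k' _ _ =>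
        Finset.sum_nonneg fun l _ => Finset.sum_nonneg fun l' _ => hnn k k' l l')
    rw [Finset.mem_range] at hk hk'
    have h1 : (H : ℝ) * ‖c k k'‖ ^ 2 = ∑ l ∈ (Finset.range H).map (addLeftEmbedding k),
        ‖c k k'‖ ^ 2 := by simp
    rw [h1]
    refine le_trans (Finset.sum_le_sum fun l hl => ?_)
      (Finset.sum_le_sum_of_subset_of_nonneg (t := Finset.range N) ?_ fun l _ _ =>
        Finset.sum_nonneg fun l' _ => hnn k k' l l')
    · simp only [Finset.mem_map, Finset.mem_range, addLeftEmbedding_apply] at hl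
      obtain ⟨t, ht, rfl⟩ := hl
      refine le_trans (le_of_eq ?_) (Finset.single_le_sum (f := fun l' =>
        if k' + (k + t) = k + l' then ‖c k k'‖ ^ 2 else 0) (fun l' _ => hnn k k' _ l')
        (Finset.mem_range.2 (show k' + t < N by omega)))
      rw [if_pos (by omega)]
    · intro l hl
      simp only [Finset.mem_map, Finset.mem_range, addLeftEmbedding_apply] at hl ⊢
      omega
  have hs4 : ∑ j ∈ Finset.range (4 * H), p j ^ 2 ≤ α * 2 := by
    have hα : 0 ≤ α := (hp0 0).trans (hpα 0 hm)
    calc ∑ j ∈ Finset.range (4 * H), p j ^ 2 ≤ ∑ j ∈ Finset.range (4 * H), α * p j := by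
          refine Finset.sum_le_sum fun j hj => ?_
          rw [sq]
          exact mul_le_mul_of_nonneg_right (hpα j (Finset.mem_range.1 hj)) (hp0 j)
      _ ≤ α * 2 := by rw [← Finset.mul_sum]; exact mul_le_mul_of_nonneg_left hs1 hα
  set Q := ∑ k ∈ Finset.range H, ∑ k' ∈ Finset.range H, ‖c k k'‖ ^ 2 with hQ
  have hs5 : (4 * H : ℝ) * ((N : ℝ) ^ 4)⁻¹ * (H * Q) ≤ α * 2 := by
    refine le_trans ?_ (hs2 ▸ hs4)
    exact mul_le_mul_of_nonneg_left hs3 (by positivity)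
  -- With N = 2H the factor is 4H · H / (16 H⁴) = 1 / (4H²), so 2α becomes 8α.
  have e : (4 * H : ℝ) * ((N : ℝ) ^ 4)⁻¹ * (H * Q) = ((H : ℝ) ^ 2)⁻¹ * Q / 4 := by
    rw [hN]; push_cast; field_simp; ring
  rw [e] at hs5
  linarith

end Parseval

/-! ### Twisted Cesàro averages and their mean squares. -/

section TwistedAverage

variable {Y : Type*} [MeasurableSpace Y] {κ : Measure Y} {S : Y ≃ᵐ Y} {F : Y → ℂ}

/-- The twisted Cesàro average `M⁻¹ ∑_{k < M} z̄ᵏ F ∘ Sᵏ`. -/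
def tavg (S : Y ≃ᵐ Y) (F : Y → ℂ) (M : ℕ) (z : ℂ) (y : Y) : ℂ :=
  (M : ℂ)⁻¹ * ∑ k ∈ Finset.range M, conj (z ^ k) * F (S^[k] y)

theorem measurable_tavg (hF : Measurable F) (M : ℕ) {θ : Y → ℂ} (hθ : Measurable θ) :
    Measurable fun y => tavg S F M (θ y) y := by
  unfold tavg
  refine Measurable.const_mul (Finset.measurable_fun_sum _ fun k _ => ?_) _
  exact (Complex.continuous_conj.measurable.comp (hθ.pow_const k)).mul
    (hF.comp (S.measurable.iterate k))

theorem continuous_tavg (M : ℕ) (y : Y) : Continuous fun z => tavg S F M z y := by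
  unfold tavg
  fun_prop

theorem norm_tavg_le (hFb : ∀ y, ‖F y‖ ≤ 1) (M : ℕ) {z : ℂ} (hz : ‖z‖ = 1) (y : Y) :
    ‖tavg S F M z y‖ ≤ 1 := by
  rw [tavg, norm_mul, norm_inv, Complex.norm_natCast]
  rcases Nat.eq_zero_or_pos M with h0 | h0
  · simp [h0]
  · rw [inv_mul_le_iff₀ (by positivity), mul_one]
    refine (norm_sum_le _ _).trans ((Finset.sum_le_card_nsmul _ _ 1 fun k _ => ?_).trans (by simp))
    rw [norm_mul, RCLike.norm_conj, norm_pow, hz, one_pow, one_mul]; exact hFb _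

theorem tavg_two_mul {M : ℕ} (hM : 0 < M) (z : ℂ) (y : Y) :
    tavg S F (2 * M) z y =
      2⁻¹ * (tavg S F M z y + conj (z ^ M) * tavg S F M z (S^[M] y)) := by
  have hMc : (M : ℂ) ≠ 0 := by exact_mod_cast hM.ne'
  have h1 : ∑ k ∈ Finset.range (2 * M), conj (z ^ k) * F (S^[k] y) =
      ∑ k ∈ Finset.range M, conj (z ^ k) * F (S^[k] y) +
        conj (z ^ M) * ∑ k ∈ Finset.range M, conj (z ^ k) * F (S^[k] (S^[M] y)) := by
    rw [two_mul, Finset.sum_range_add, Finset.mul_sum]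
    congr 1
    refine Finset.sum_congr rfl fun k _ => ?_
    rw [pow_add, map_mul, add_comm M k, Function.iterate_add_apply]; ring
  simp only [tavg]
  rw [h1]
  push_cast
  field_simp

variable (S F κ) in
/-- The mean square of a twisted average. -/
def tpow (M : ℕ) (z : ℂ) : ℝ := ∫ y, ‖tavg S F M z y‖ ^ 2 ∂κ

theorem tpow_nonneg (M : ℕ) (z : ℂ) : 0 ≤ tpow κ S F M z :=
  integral_nonneg fun _ => by positivity

theorem integrable_norm_tavg_sq [IsFiniteMeasure κ] (hF : Measurable F) (hFb : ∀ y, ‖F y‖ ≤ 1)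
    (M : ℕ) {θ : Y → ℂ} (hθ : Measurable θ) (hθ1 : ∀ y, ‖θ y‖ = 1) :
    Integrable (fun y => ‖tavg S F M (θ y) y‖ ^ 2) κ :=
  Integrable.of_bound ((measurable_tavg hF M hθ).norm.pow_const 2).aestronglyMeasurable 1
    (Eventually.of_forall fun y => by
      rw [norm_pow, norm_norm]
      exact pow_le_one₀ (norm_nonneg _) (norm_tavg_le hFb M (hθ1 y) y))

/-- The average of length 2M is the mean of two functions of the same L² norm, since S preserves κ
and z is unimodular. This monotonicity under doubling is why scales are powers of two from here on.
-/
theorem tpow_two_mul_le [IsFiniteMeasure κ] (hS : MeasurePreserving S κ κ) (hF : Measurable F)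
    (hFb : ∀ y, ‖F y‖ ≤ 1) {M : ℕ} (hM : 0 < M) {z : ℂ} (hz : ‖z‖ = 1) :
    tpow κ S F (2 * M) z ≤ tpow κ S F M z := by
  have i1 := integrable_norm_tavg_sq (κ := κ) (S := S) hF hFb M (θ := fun _ => z) measurable_const
    fun _ => hz
  have hSM := hS.iterate M
  have i2 : Integrable (fun y => ‖tavg S F M z (S^[M] y)‖ ^ 2) κ := hSM.integrable_comp_of_integrable i1
  have e2 : ∫ y, ‖tavg S F M z (S^[M] y)‖ ^ 2 ∂κ = ∫ y, ‖tavg S F M z y‖ ^ 2 ∂κ := by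
    have h := integral_map (μ := κ) hSM.measurable.aemeasurable
      (f := fun y => ‖tavg S F M z y‖ ^ 2) (by rw [hSM.map_eq]; exact i1.aestronglyMeasurable)
    rw [hSM.map_eq] at h
    exact h.symm
  calc tpow κ S F (2 * M) z
      ≤ ∫ y, 2⁻¹ * (‖tavg S F M z y‖ ^ 2 + ‖tavg S F M z (S^[M] y)‖ ^ 2) ∂κ := by
        refine integral_mono (integrable_norm_tavg_sq hF hFb _ measurable_const fun _ => hz)
          ((i1.add i2).const_mul _) fun y => ?_
        simp only
        rw [tavg_two_mul hM]
        have h1 : ‖(2 : ℂ)⁻¹ * (tavg S F M z y + conj (z ^ M) * tavg S F M z (S^[M] y))‖ ≤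
            2⁻¹ * (‖tavg S F M z y‖ + ‖tavg S F M z (S^[M] y)‖) := by
          rw [norm_mul, norm_inv]
          have : ‖conj (z ^ M) * tavg S F M z (S^[M] y)‖ = ‖tavg S F M z (S^[M] y)‖ := by
            rw [norm_mul, RCLike.norm_conj, norm_pow, hz, one_pow, one_mul]
          have h2 := norm_add_le (tavg S F M z y) (conj (z ^ M) * tavg S F M z (S^[M] y))
          rw [this] at h2
          simpa using h2
        refine (pow_le_pow_left₀ (norm_nonneg _) h1 2).trans ?_
        nlinarith [sq_nonneg (‖tavg S F M z y‖ - ‖tavg S F M z (S^[M] y)‖)]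
    _ = tpow κ S F M z := by
        rw [integral_const_mul, integral_add i1 i2, e2, tpow]; ring

theorem tpow_two_pow_antitone [IsFiniteMeasure κ] (hS : MeasurePreserving S κ κ)
    (hF : Measurable F) (hFb : ∀ y, ‖F y‖ ≤ 1) {z : ℂ} (hz : ‖z‖ = 1) :
    Antitone fun n : ℕ => tpow κ S F (2 ^ n) z :=
  antitone_nat_of_succ_le fun n => by
    rw [pow_succ, mul_comm]
    exact tpow_two_mul_le hS hF hFb (by positivity) hz

theorem continuousOn_tpow [IsFiniteMeasure κ] (hF : Measurable F) (hFb : ∀ y, ‖F y‖ ≤ 1) (M : ℕ) :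
    ContinuousOn (tpow κ S F M) {z | ‖z‖ = 1} := by
  refine continuousOn_of_dominated (bound := fun _ => 1) ?_ ?_ (integrable_const _) ?_
  · intro z hz
    exact ((measurable_tavg hF M measurable_const).norm.pow_const 2).aestronglyMeasurable
  · intro z hz
    refine Eventually.of_forall fun y => ?_
    rw [norm_pow, norm_norm]
    exact pow_le_one₀ (norm_nonneg _) (norm_tavg_le hFb M hz y)
  · exact Eventually.of_forall fun y => ((continuous_tavg M y).norm.pow 2).continuousOn

/-- Invariance of κ makes the array of correlations stationary, and its Fejér mean at a root of
unity is the mean square of the corresponding twisted average, so `avg_norm_sq_le_of_fejer_le`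
applies. -/
theorem avg_norm_corr_sq_le_of_tpow_le [IsProbabilityMeasure κ] (hS : MeasurePreserving S κ κ)
    (hF : Measurable F) (hFb : ∀ y, ‖F y‖ ≤ 1) {H : ℕ} (hH : 0 < H) {ζ : ℂ}
    (hζ : IsPrimitiveRoot ζ (4 * H)) {α : ℝ}
    (h : ∀ j < 4 * H, tpow κ S F (2 * H) (ζ ^ j) ≤ α) :
    ((H : ℝ) ^ 2)⁻¹ * ∑ k ∈ Finset.range H, ∑ k' ∈ Finset.range H,
      ‖∫ y, corr S F k k' y ∂κ‖ ^ 2 ≤ 8 * α := by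
  have hint : ∀ k k', Integrable (corr S F k k') κ := fun k k' =>
    Integrable.of_bound (measurable_corr hF k k').aestronglyMeasurable (1 * 1)
      (Eventually.of_forall (norm_corr_le hFb k k'))
  refine avg_norm_sq_le_of_fejer_le (c := fun k k' => ∫ y, corr S F k k' y ∂κ) (fun k k' => ?_) ?_
    hH hζ (fun j => tpow_nonneg (2 * H) (ζ ^ j)) h fun j => ?_
  · have h1 := integral_map (μ := κ) hS.measurable.aemeasurable (f := corr S F k k')
      (by rw [hS.map_eq]; exact (hint k k').aestronglyMeasurable)
    rw [hS.map_eq] at h1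
    rw [h1]
    simp only [corr, Function.iterate_succ_apply]
  · refine (norm_integral_le_of_norm_le_const (C := 1 * 1)
      (Eventually.of_forall (norm_corr_le hFb 0 0))).trans ?_
    simp
  · have e : ∀ y, ((‖tavg S F (2 * H) (ζ ^ j) y‖ ^ 2 : ℝ) : ℂ) =
        (((2 * H : ℕ) : ℂ) ^ 2)⁻¹ * ∑ k ∈ Finset.range (2 * H), ∑ k' ∈ Finset.range (2 * H),
          conj ((ζ ^ j) ^ k) * (ζ ^ j) ^ k' * corr S F k k' y := by
      intro y
      rw [← Complex.normSq_eq_norm_sq, ← Complex.mul_conj, tavg]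
      simp only [map_mul, map_inv₀, map_sum, Complex.conj_natCast, Complex.conj_conj]
      rw [mul_mul_mul_comm, Finset.sum_mul_sum, ← mul_inv, ← sq]
      congr 1
      refine Finset.sum_congr rfl fun k _ => Finset.sum_congr rfl fun k' _ => ?_
      rw [corr]; ring
    rw [tpow, ← integral_complex_ofReal]
    simp only [e]
    rw [integral_const_mul]
    congr 1
    rw [integral_finsetSum]
    · refine Finset.sum_congr rfl fun k _ => ?_
      rw [integral_finsetSum]
      · exact Finset.sum_congr rfl fun k' _ => integral_const_mul _ _
      · exact fun k' _ => (hint k k').const_mul _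
    · exact fun k _ => integrable_finsetSum _ fun k' _ => (hint k k').const_mul _

end TwistedAverage

/-! ### Measurable selection of frequencies on the ergodic fibres. -/

section EigenStep

variable {Y : Type*} [mY : MeasurableSpace Y] [StandardBorelSpace Y] {ν : Measure Y}
  [IsProbabilityMeasure ν] {S : Y ≃ᵐ Y} {F : Y → ℂ}

/-- The point `exp(2πit)` of the unit circle. -/
def circ (t : ℝ) : ℂ := Complex.exp (2 * Real.pi * Complex.I * t)

theorem norm_circ (t : ℝ) : ‖circ t‖ = 1 := by
  have : (2 * Real.pi * Complex.I * t : ℂ) = ((2 * Real.pi * t : ℝ) : ℂ) * Complex.I := by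
    push_cast; ring
  rw [circ, this, Complex.norm_exp_ofReal_mul_I]

theorem continuous_circ : Continuous circ := by
  unfold circ; fun_prop

theorem circ_div (j m : ℕ) : circ ((j : ℝ) / m) = circ (1 / m) ^ j := by
  rw [circ, circ, ← Complex.exp_nat_mul]
  congr 1
  push_cast
  ring

theorem isPrimitiveRoot_circ {m : ℕ} (hm : m ≠ 0) : IsPrimitiveRoot (circ (1 / m)) m := by
  have := Complex.isPrimitiveRoot_exp m hm
  rw [circ]
  convert this using 2
  push_cast
  ring

variable (ν S F) in
/-- The least grid angle at scale `n` at which the fibrewise twisted mean square is at least `α`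
(and `2` if there is none). -/
def leastAngle (α : ℝ) (n : ℕ) (y : Y) : ℝ :=
  ⨅ j : Fin (4 * 2 ^ n),
    if α ≤ tpow (condExpKernel ν (singleInv S) y) S F (2 * 2 ^ n) (circ ((j : ℝ) / (4 * 2 ^ n : ℕ)))
    then (j : ℝ) / (4 * 2 ^ n : ℕ) else 2

theorem leastAngle_cases (α : ℝ) (n : ℕ) (y : Y) :
    leastAngle ν S F α n y = 2 ∨ (0 ≤ leastAngle ν S F α n y ∧ leastAngle ν S F α n y < 1 ∧
      α ≤ tpow (condExpKernel ν (singleInv S) y) S F (2 * 2 ^ n)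
        (circ (leastAngle ν S F α n y))) := by
  have : NeZero (4 * 2 ^ n) := ⟨by positivity⟩
  obtain ⟨j, hj⟩ := exists_eq_ciInf_of_finite (ι := Fin (4 * 2 ^ n)) (f := fun j =>
    if α ≤ tpow (condExpKernel ν (singleInv S) y) S F (2 * 2 ^ n) (circ ((j : ℝ) / (4 * 2 ^ n : ℕ)))
    then (j : ℝ) / (4 * 2 ^ n : ℕ) else 2)
  rw [leastAngle, ← hj]
  split_ifs with h
  · right
    refine ⟨by positivity, ?_, h⟩
    rw [div_lt_one (by positivity)]
    exact_mod_cast j.2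
  · exact Or.inl rfl

theorem tpow_lt_of_leastAngle_eq_two {α : ℝ} {n : ℕ} {y : Y} (h : leastAngle ν S F α n y = 2)
    {j : ℕ} (hj : j < 4 * 2 ^ n) :
    tpow (condExpKernel ν (singleInv S) y) S F (2 * 2 ^ n) (circ ((j : ℝ) / (4 * 2 ^ n : ℕ))) < α := by
  by_contra! hc
  have h1 : leastAngle ν S F α n y ≤ (j : ℝ) / (4 * 2 ^ n : ℕ) := by
    refine (ciInf_le (Set.finite_range _).bddBelow (⟨j, hj⟩ : Fin (4 * 2 ^ n))).trans ?_
    simp only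
    rw [if_pos hc]
  have h2 : (j : ℝ) / (4 * 2 ^ n : ℕ) < 1 := by
    rw [div_lt_one (by positivity)]; exact_mod_cast hj
  linarith

theorem measurable_tpow_condExpKernel (hF : Measurable F) (M : ℕ) (z : ℂ) :
    Measurable[singleInv S] fun y => tpow (condExpKernel ν (singleInv S) y) S F M z :=
  (StronglyMeasurable.integral_condExpKernel
    ((measurable_tavg hF M measurable_const).norm.pow_const 2).stronglyMeasurable).measurable

theorem measurable_leastAngle (hF : Measurable F) (α : ℝ) (n : ℕ) :
    Measurable[singleInv S] (leastAngle ν S F α n) := by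
  unfold leastAngle
  refine Measurable.iInf fun j => Measurable.ite ?_ measurable_const measurable_const
  exact measurable_tpow_condExpKernel hF _ _ measurableSet_Ici

theorem abs_leastAngle_le (α : ℝ) (n : ℕ) (y : Y) :
    0 ≤ leastAngle ν S F α n y ∧ leastAngle ν S F α n y ≤ 2 := by
  rcases leastAngle_cases (ν := ν) (S := S) (F := F) α n y with h | ⟨h0, h1, -⟩
  · rw [h]; norm_num
  · exact ⟨h0, by linarith⟩

/-- At a limit inferior of good angles all dyadic twisted mean squares are large. -/
theorem le_tpow_liminf_leastAngle (hF : Measurable F) (hFb : ∀ y, ‖F y‖ ≤ 1) {α : ℝ} {y : Y}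
    (hS : MeasurePreserving S (condExpKernel ν (singleInv S) y) (condExpKernel ν (singleInv S) y))
    (h : ∃ᶠ n in atTop, leastAngle ν S F α n y ≠ 2) (m : ℕ) :
    α ≤ tpow (condExpKernel ν (singleInv S) y) S F (2 ^ m)
      (circ (liminf (fun n => leastAngle ν S F α n y) atTop)) := by
  set τ := liminf (fun n => leastAngle ν S F α n y) atTop with hτ
  set κ := condExpKernel ν (singleInv S) y with hκ
  -- If the mean square at the limiting angle were below α at scale 2^m, it would be so at nearby
  -- angles. Infinitely many selected angles are nearby, and at their larger scale the mean square
  -- is at least α, against monotonicity in the scale.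
  by_contra! hc
  have hcont : Continuous fun t => tpow κ S F (2 ^ m) (circ t) :=
    (continuousOn_tpow hF hFb _).comp_continuous continuous_circ norm_circ
  have hnear : ∀ᶠ t in 𝓝 τ, tpow κ S F (2 ^ m) (circ t) < α :=
    hcont.continuousAt.eventually_lt continuousAt_const hc
  obtain ⟨δ, hδ, hball⟩ := Metric.eventually_nhds_iff.1 hnear
  have hb : IsBoundedUnder (· ≥ ·) atTop fun n => leastAngle ν S F α n y :=
    isBoundedUnder_of ⟨0, fun n => (abs_leastAngle_le α n y).1⟩
  have hb' : IsCoboundedUnder (· ≥ ·) atTop fun n => leastAngle ν S F α n y :=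
    IsBoundedUnder.isCoboundedUnder_ge
      (isBoundedUnder_of ⟨2, fun n => (abs_leastAngle_le α n y).2⟩)
  have hτ1 : τ ≤ 1 := by
    refine liminf_le_of_frequently_le (h.mono fun n hn => ?_) hb
    rcases leastAngle_cases (ν := ν) (S := S) (F := F) α n y with h2 | ⟨-, h1, -⟩
    · exact absurd h2 hn
    · exact h1.le
  have hev : ∀ᶠ n in atTop, τ - δ < leastAngle ν S F α n y :=
    eventually_lt_of_lt_liminf (by linarith) hb
  -- As τ ≤ 1, the cap at 1 keeps the angle below 2, which excludes the default value of
  -- `leastAngle`.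
  have hfr : ∃ᶠ n in atTop, leastAngle ν S F α n y < τ + min δ 1 :=
    frequently_lt_of_liminf_lt hb' (by have := lt_min hδ one_pos; linarith)
  obtain ⟨n, h1, h2, h3⟩ := (hfr.and_eventually (hev.and (eventually_ge_atTop m))).exists
  have h4 : leastAngle ν S F α n y < τ + δ := h1.trans_le (by gcongr; exact min_le_left _ _)
  have h5 : leastAngle ν S F α n y < τ + 1 := h1.trans_le (by gcongr; exact min_le_right _ _)
  rcases leastAngle_cases (ν := ν) (S := S) (F := F) α n y with h6 | ⟨-, -, h6⟩
  · linarith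
  · have h7 : tpow κ S F (2 ^ m) (circ (leastAngle ν S F α n y)) < α :=
      hball (by rw [Real.dist_eq, abs_lt]; constructor <;> linarith)
    have h8 := tpow_two_pow_antitone hS hF hFb (norm_circ (leastAngle ν S F α n y))
      (show m ≤ n + 1 by omega)
    simp only [pow_succ, mul_comm _ 2] at h8
    linarith

end EigenStep

/-! ### Generalised eigenfunctions control the seminorm of order two. -/

section EigenStep

variable {Y : Type*} [mY : MeasurableSpace Y] [StandardBorelSpace Y] {ν : Measure Y}
  [IsProbabilityMeasure ν] {S : Y ≃ᵐ Y} {F : Y → ℂ}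

/-- As θ is constant along orbits, the twists accumulate to a power. Cesàro averages of this
operator are therefore twisted averages whose frequency varies with the fibre. -/
theorem wavg_unit_iterate_of_invariant {θ : Y → ℂ} (hθ : ∀ y, θ (S y) = θ y) (f : Y → ℂ) (k : ℕ)
    (y : Y) :
    ((wavg (fun (_ : Unit) y => conj (θ y)) fun _ => S)^[k] f) y =
      conj (θ y ^ k) * f (S^[k] y) := by
  induction k generalizing y with
  | zero => simp
  | succ k ih =>
    rw [Function.iterate_succ_apply', Function.iterate_succ_apply]
    simp only [wavg, Finset.univ_unique, Finset.sum_singleton, ih, hθ, map_pow]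
    ring

/-- If `F` is orthogonal to all square integrable functions `g` with `g ∘ S = θ g` for some
invariant unimodular `θ`, then almost surely no twisted mean square stays large. -/
theorem ae_eventually_leastAngle_eq_two (hS : MeasurePreserving S ν ν) (hF : Measurable F)
    (hFb : ∀ y, ‖F y‖ ≤ 1)
    (horth : ∀ θ g : Y → ℂ, Measurable[singleInv S] θ → (∀ y, ‖θ y‖ = 1) → Measurable g →
      MemLp g 2 ν → (∀ᵐ y ∂ν, g (S y) = θ y * g y) → ∫ y, F y * conj (g y) ∂ν = 0)
    {α : ℝ} (hα : 0 < α) : ∀ᵐ y ∂ν, ∀ᶠ n in atTop, leastAngle ν S F α n y = 2 := by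
  have hle := jointInv_le fun _ : Unit => S
  -- The limit inferior selects one frequency on each fibre measurably and invariantly; θ is the
  -- candidate eigenvalue, and G is the set of fibres on which large twisted averages occur at
  -- infinitely many scales.
  set τ : Y → ℝ := fun y => liminf (fun n => leastAngle ν S F α n y) atTop with hτ
  have hτm : Measurable[singleInv S] τ := Measurable.liminf fun n => measurable_leastAngle hF α n
  set θ : Y → ℂ := fun y => circ (τ y) with hθ
  have hθm : Measurable[singleInv S] θ := continuous_circ.measurable.comp hτm
  have hθm' : Measurable θ := hθm.mono hle le_rfl
  have hθ1 : ∀ y, ‖θ y‖ = 1 := fun y => norm_circ _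
  have hθi : ∀ y, θ (S y) = θ y := jointInv_apply_eq (S := fun _ : Unit => S) hθm ()
  set G : Set Y := {y | ∃ᶠ n in atTop, leastAngle ν S F α n y ≠ 2} with hG
  have hGm : MeasurableSet G := by
    have : G = ⋂ a : ℕ, ⋃ b : ℕ, ⋃ _ : a ≤ b, {y | leastAngle ν S F α b y ≠ 2} := by
      ext y; simp [hG, frequently_atTop]
    rw [this]
    refine MeasurableSet.iInter fun a => MeasurableSet.iUnion fun b => MeasurableSet.iUnion fun _ =>
      ?_
    exact (((measurable_leastAngle hF α b).mono hle le_rfl) (measurableSet_singleton 2)).compl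
  have hFmem : MemLp F 2 ν := MemLp.of_bound hF.aestronglyMeasurable 1 (Eventually.of_forall hFb)
  obtain ⟨g, hgm, hg2, hgfix, hglim, hgorth⟩ := mean_ergodic_wavg (ι := Unit) (S := fun _ => S)
    (w := fun _ y => conj (θ y)) (fun _ => hS)
    (fun _ => Complex.continuous_conj.measurable.comp hθm') (fun _ y => by simp [hθ1]) hFmem
  have hgS : ∀ᵐ y ∂ν, g (S y) = θ y * g y := by
    filter_upwards [hgfix] with y hy
    simp only [wavg, Finset.univ_unique, Finset.sum_singleton] at hy
    rw [← hy, ← mul_assoc, Complex.mul_conj, Complex.normSq_eq_norm_sq, hθ1]; simp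
  -- g is the projection of F to the θ-eigenfunctions. It is itself such an eigenfunction, hence
  -- orthogonal to F, and so it vanishes.
  have hg0 : ∫ y, ‖g y‖ ^ 2 ∂ν = 0 := by
    have h1 := hgorth g hg2 hgfix
    rw [horth θ g hθm hθ1 hgm hg2 hgS] at h1
    have h2 : ∀ y, g y * conj (g y) = ((‖g y‖ ^ 2 : ℝ) : ℂ) := fun y => by
      rw [Complex.mul_conj, Complex.normSq_eq_norm_sq]
    simp only [h2] at h1
    rw [integral_complex_ofReal] at h1
    exact_mod_cast h1.symm
  have hbav : ∀ n y, bavg (fun (_ : Unit) y => conj (θ y)) (fun _ => S) n F y =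
      tavg S F n (θ y) y := fun n y => by
    simp only [bavg, tavg, wavg_unit_iterate_of_invariant hθi]
  have hlim := tendsto_integral_norm_sq (ν := ν) (u := fun n y => tavg S F n (θ y) y) (fun n => by
    exact MemLp.of_bound (measurable_tavg hF n hθm').aestronglyMeasurable 1
        (Eventually.of_forall fun y => norm_tavg_le hFb n (hθ1 y) y)) hg2
    (by simpa only [hbav] using hglim)
  rw [hg0] at hlim
  -- On the fibre of a point of G the function θ is constant, and each dyadic twisted mean square
  -- there is at least α. Since the global mean squares tend to 0, G is null.
  have hlow : ∀ m : ℕ, α * ν.real G ≤ ∫ y, ‖tavg S F (2 ^ m) (θ y) y‖ ^ 2 ∂ν := by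
    intro m
    have hi := integrable_norm_tavg_sq (κ := ν) (S := S) hF hFb (2 ^ m) hθm' hθ1
    have h1 : ∫ y, ‖tavg S F (2 ^ m) (θ y) y‖ ^ 2 ∂ν =
        ∫ y, ∫ z, ‖tavg S F (2 ^ m) (θ z) z‖ ^ 2 ∂(condExpKernel ν (singleInv S) y) ∂ν := by
      rw [← integral_congr_ae (condExp_ae_eq_integral_condExpKernel hle hi), integral_condExp hle]
    have h2 : ∀ᵐ y ∂ν, G.indicator (fun _ => α) y ≤
        ∫ z, ‖tavg S F (2 ^ m) (θ z) z‖ ^ 2 ∂(condExpKernel ν (singleInv S) y) := by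
      filter_upwards [ae_condExpKernel_const (ν := ν) (fun _ : Unit => S) hτm,
        ae_measurePreserving_condExpKernel (ν := ν) (S := fun _ : Unit => S) fun _ => hS]
        with y h3 h4
      by_cases hy : y ∈ G
      · rw [Set.indicator_of_mem hy]
        refine (le_tpow_liminf_leastAngle hF hFb (h4 ()) hy m).trans (le_of_eq ?_)
        refine integral_congr_ae ?_
        filter_upwards [h3] with z hz
        simp only [hθ, hz]
        rfl
      · rw [Set.indicator_of_notMem hy]
        exact integral_nonneg fun _ => by positivity
    rw [h1]
    have h3 := integral_mono_ae ((integrable_const α).indicator hGm) (by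
      have := hi.integral_condExpKernel (m := singleInv S)
      exact this) h2
    rw [integral_indicator_const _ hGm, smul_eq_mul, mul_comm] at h3
    exact h3
  have hle0 : α * ν.real G ≤ 0 :=
    ge_of_tendsto (hlim.comp (tendsto_pow_atTop_atTop_of_one_lt one_lt_two))
      (Eventually.of_forall hlow)
  have hG0 : ν.real G = 0 := by
    have := measureReal_nonneg (μ := ν) (s := G)
    nlinarith
  have hG0' : ν G = 0 := (measureReal_eq_zero_iff).1 hG0
  have : ∀ᵐ y ∂ν, y ∉ G := measure_eq_zero_iff_ae_notMem.1 hG0'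
  filter_upwards [this] with y hy
  have := not_frequently.1 hy
  simpa using this

/-- A bounded function orthogonal to all generalised eigenfunctions has vanishing second box
seminorm. -/
theorem boxLE_pair_of_orthogonal (hS : MeasurePreserving S ν ν) (hF : Measurable F)
    (hFb : ∀ y, ‖F y‖ ≤ 1)
    (horth : ∀ θ g : Y → ℂ, Measurable[singleInv S] θ → (∀ y, ‖θ y‖ = 1) → Measurable g →
      MemLp g 2 ν → (∀ᵐ y ∂ν, g (S y) = θ y * g y) → ∫ y, F y * conj (g y) ∂ν = 0) :
    BoxLE ν [S, S] F 0 := by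
  have hle := jointInv_le fun _ : Unit => S
  set κ := condExpKernel ν (singleInv S) with hκ
  -- q n y is the average of the squared correlations on the fibre of y; its integral is the
  -- quantity that `BoxLE` asks to be small.
  set q : ℕ → Y → ℝ := fun n y => (((2 ^ n : ℕ) : ℝ) ^ 2)⁻¹ * ∑ k ∈ Finset.range (2 ^ n),
    ∑ k' ∈ Finset.range (2 ^ n), ‖∫ z, corr S F k k' z ∂(κ y)‖ ^ 2 with hq
  have hint : ∀ k k', Integrable (corr S F k k') ν := fun k k' =>
    Integrable.of_bound (measurable_corr hF k k').aestronglyMeasurable (1 * 1)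
      (Eventually.of_forall (norm_corr_le hFb k k'))
  have hcm : ∀ k k', Measurable fun y => ∫ z, corr S F k k' z ∂(κ y) := fun k k' =>
    (StronglyMeasurable.integral_condExpKernel (m := singleInv S)
      (measurable_corr hF k k').stronglyMeasurable).measurable.mono hle le_rfl
  have hcb : ∀ k k' y, ‖∫ z, corr S F k k' z ∂(κ y)‖ ≤ 1 := fun k k' y =>
    (norm_integral_le_of_norm_le_const (C := 1 * 1)
      (Eventually.of_forall (norm_corr_le hFb k k'))).trans (by simp)
  have hcb2 : ∀ k k' y, ‖∫ z, corr S F k k' z ∂(κ y)‖ ^ 2 ≤ 1 := fun k k' y =>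
    pow_le_one₀ (norm_nonneg _) (hcb k k' y)
  have hcint : ∀ k k', Integrable (fun y => ‖∫ z, corr S F k k' z ∂(κ y)‖ ^ 2) ν := fun k k' =>
    Integrable.of_bound ((hcm k k').norm.pow_const 2).aestronglyMeasurable 1
      (Eventually.of_forall fun y => by rw [norm_pow, norm_norm]; exact hcb2 k k' y)
  have hqm : ∀ n, Measurable (q n) := fun n =>
    (Finset.measurable_fun_sum _ fun k _ => Finset.measurable_fun_sum _ fun k' _ =>
      (hcm k k').norm.pow_const 2).const_mul _
  have hq0 : ∀ n y, 0 ≤ q n y := fun n y => by positivity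
  have hq1 : ∀ n y, q n y ≤ 1 := fun n y => by
    simp only [hq]
    rw [inv_mul_le_iff₀ (by positivity), mul_one]
    refine (Finset.sum_le_sum fun k _ => Finset.sum_le_card_nsmul _ _ 1 fun k' _ =>
      hcb2 k k' y).trans ?_
    simp [sq]
  have hqlim : ∀ᵐ y ∂ν, Tendsto (fun n => q n y) atTop (𝓝 0) := by
    have h1 : ∀ᵐ y ∂ν, ∀ i : ℕ, ∀ᶠ n in atTop,
        leastAngle ν S F (1 / ((i : ℝ) + 1)) n y = 2 :=
      ae_all_iff.2 fun i => ae_eventually_leastAngle_eq_two hS hF hFb horth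
        Nat.one_div_pos_of_nat
    filter_upwards [h1, ae_measurePreserving_condExpKernel (ν := ν) (S := fun _ : Unit => S)
      fun _ => hS] with y h2 h3
    rw [Metric.tendsto_atTop']
    intro ε hε
    obtain ⟨i, hi⟩ := exists_nat_one_div_lt (show 0 < ε / 8 by positivity)
    obtain ⟨n₀, hn₀⟩ := eventually_atTop.1 (h2 i)
    refine ⟨n₀, fun n hn => ?_⟩
    -- With H = 2^n the 4H-th roots of unity and the length 2H are exactly the grid and the scale of
    -- `leastAngle`.
    have h4 := avg_norm_corr_sq_le_of_tpow_le (κ := κ y) (h3 ()) hF hFb (H := 2 ^ n)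
      (by positivity) (isPrimitiveRoot_circ (m := 4 * 2 ^ n) (by positivity))
      (α := 1 / ((i : ℝ) + 1)) fun j hj => by
        rw [← circ_div]; exact (tpow_lt_of_leastAngle_eq_two (hn₀ n hn.le) hj).le
    rw [Real.dist_eq, sub_zero, abs_of_nonneg (hq0 n y)]
    have : q n y ≤ 8 * (1 / ((i : ℝ) + 1)) := h4
    linarith
  have hIlim : Tendsto (fun n => ∫ y, q n y ∂ν) atTop (𝓝 0) := by
    have := tendsto_integral_of_dominated_convergence (μ := ν) (f := fun _ => (0 : ℝ))
      (F := q) (fun _ => 1) (fun n => (hqm n).aestronglyMeasurable) (integrable_const _)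
      (fun n => Eventually.of_forall fun y => by
        rw [Real.norm_of_nonneg (hq0 n y)]; exact hq1 n y) hqlim
    simpa using this
  refine ⟨le_rfl, fun η hη => ?_⟩
  obtain ⟨n, hn⟩ := (hIlim.eventually_lt_const hη).exists
  -- The inner bound is the squared norm of E[corr | S-invariant sets], by `BoxLE.of_relProd` with
  -- no other transformation left.
  refine ⟨2 ^ n, by positivity, fun k k' => ∫ y, ‖∫ z, corr S F k k' z ∂(κ y)‖ ^ 2 ∂ν,
    fun k _ k' _ => ?_, ?_⟩
  · refine BoxLE.of_relProd hS [] (measurable_corr hF k k') (norm_corr_le hFb k k') ?_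
    change (∫ p, corr S F k k' p.1 * conj (corr S F k k' p.2) ∂(relProd ν S)).re ≤ _
    rw [integral_tensor_conj S (measurable_corr hF k k') (norm_corr_le hFb k k')]
    refine le_of_eq (integral_congr_ae ?_)
    filter_upwards [condExp_ae_eq_integral_condExpKernel hle (hint k k')] with y hy
    rw [hy]
  · have : ∫ y, q n y ∂ν = (((2 ^ n : ℕ) : ℝ) ^ 2)⁻¹ * ∑ k ∈ Finset.range (2 ^ n),
        ∑ k' ∈ Finset.range (2 ^ n), ∫ y, ‖∫ z, corr S F k k' z ∂(κ y)‖ ^ 2 ∂ν := by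
      simp only [hq]
      rw [integral_const_mul, integral_finsetSum]
      · congr 1
        exact Finset.sum_congr rfl fun k _ => integral_finsetSum _ fun k' _ => hcint k k'
      · exact fun k _ => integrable_finsetSum _ fun k' _ => hcint k k'
    rw [← this, zero_add]
    exact hn.le

end EigenStep

universe u v

/-! ### Extensions that remove transformations from box seminorms. -/

section BoxExtension

/-- `(Y, ν, S)` is an extension of `(X, μ, T)` on which the transformations in `L` can be removed
from box seminorms at the cost of a factor that is measurable with respect to the join of the
`S i`-invariant σ-algebras, `i ∈ L`; moreover `X` is the factor of `𝒰`-invariant functions, for a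
set `𝒰` of transformations commuting with the `S i`. -/
structure IsBoxExtension {ι : Type*} {X Y : Type*} [MeasurableSpace X] [MeasurableSpace Y]
    (μ : Measure X) (T : ι → X ≃ᵐ X) (L : List ι) (ν : Measure Y) (S : ι → Y ≃ᵐ Y) (π : Y → X)
    (𝒰 : Set (Y ≃ᵐ Y)) : Prop where
  measurePreserving_fst : MeasurePreserving π ν μ
  equivariant : ∀ i y, π (S i y) = T i (π y)
  commute : ∀ i j y, S i (S j y) = S j (S i y)
  measurePreserving : ∀ i, MeasurePreserving (S i) ν ν
  fibre : ∀ U ∈ 𝒰, ∀ y, π (U y) = π y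
  fibre_commute : ∀ U ∈ 𝒰, ∀ i y, U (S i y) = S i (U y)
  fibre_measurePreserving : ∀ U ∈ 𝒰, MeasurePreserving U ν ν
  exists_of_invariant : ∀ w : Y → ℂ, Measurable w → (∀ U ∈ 𝒰, ∀ᵐ y ∂ν, w (U y) = w y) →
    ∃ v : X → ℂ, Measurable v ∧ ∀ᵐ y ∂ν, w y = v (π y)
  boxLE : ∀ f : X → ℂ, Measurable f → (∀ x, ‖f x‖ ≤ 1) → ∃ F : Y → ℂ,
    Measurable[⨆ i ∈ L, MeasurableSpace.invariants (S i)] F ∧ (∀ y, ‖F y‖ ≤ 1) ∧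
    ∀ M : List ι, List.Disjoint M L → ∀ c, BoxLE ν (M.map S) (fun y => f (π y) * F y) c →
      BoxLE μ (M.map T ++ (L.map T).reverse) f c

open Classical in
/-- The lifts of the transformations to the relative product over `T i`; the additional one is
`id × T i`. -/
def relLift {ι : Type*} {X : Type*} [MeasurableSpace X] (T : ι → X ≃ᵐ X) (i : ι) :
    Option ι → (X × X) ≃ᵐ (X × X)
  | none => (MeasurableEquiv.refl X).prodCongr (T i)
  | some j => if j = i then (T i).prodCongr (MeasurableEquiv.refl X) else (T j).prodCongr (T j)

theorem relLift_none {ι : Type*} {X : Type*} [MeasurableSpace X] (T : ι → X ≃ᵐ X) (i : ι)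
    (p : X × X) : relLift T i none p = (p.1, T i p.2) := rfl

theorem relLift_self {ι : Type*} {X : Type*} [MeasurableSpace X] (T : ι → X ≃ᵐ X) (i : ι)
    (p : X × X) : relLift T i (some i) p = (T i p.1, p.2) := by
  simp only [relLift, if_true]; rfl

theorem relLift_of_ne {ι : Type*} {X : Type*} [MeasurableSpace X] (T : ι → X ≃ᵐ X) {i j : ι}
    (h : j ≠ i) : relLift T i (some j) = (T j).prodCongr (T j) := by
  simp only [relLift, if_neg h]

theorem relLift_of_ne_apply {ι : Type*} {X : Type*} [MeasurableSpace X] (T : ι → X ≃ᵐ X) {i j : ι}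
    (h : j ≠ i) (p : X × X) : relLift T i (some j) p = (T j p.1, T j p.2) := by
  rw [relLift_of_ne T h]; rfl

theorem relLift_commute {ι : Type*} {X : Type*} [MeasurableSpace X] {T : ι → X ≃ᵐ X}
    (hc : ∀ i j x, T i (T j x) = T j (T i x)) (i : ι) (a b : Option ι) (p : X × X) :
    relLift T i a (relLift T i b p) = relLift T i b (relLift T i a p) := by
  rcases a with _ | a <;> rcases b with _ | b
  · rfl
  · by_cases hb : b = i
    · subst hb; simp only [relLift_none, relLift_self]
    · simp only [relLift_none, relLift_of_ne_apply T hb, hc i b]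
  · by_cases ha : a = i
    · subst ha; simp only [relLift_none, relLift_self]
    · simp only [relLift_none, relLift_of_ne_apply T ha, hc i a]
  · by_cases ha : a = i <;> by_cases hb : b = i
    · rw [ha, hb]
    · subst ha; simp only [relLift_self, relLift_of_ne_apply T hb, hc a b]
    · subst hb; simp only [relLift_self, relLift_of_ne_apply T ha, hc a b]
    · simp only [relLift_of_ne_apply T ha, relLift_of_ne_apply T hb, hc a b]

/-- Each step passes to the relative product over the first `T i` of L and applies the induction
hypothesis to the rest. The index set grows to `Option ι`, since id × T i has to be lifted through
the later steps as well: it is the symmetry of the fibre over X created here. -/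
theorem exists_isBoxExtension (n : ℕ) : ∀ {ι : Type v} {X : Type u} [MeasurableSpace X]
    [StandardBorelSpace X] {μ : Measure X} [IsProbabilityMeasure μ] {T : ι → X ≃ᵐ X}
    (_ : ∀ i j x, T i (T j x) = T j (T i x)) (_ : ∀ i, MeasurePreserving (T i) μ μ)
    {L : List ι} (_ : L.Nodup) (_ : L.length = n),
    ∃ (Y : Type u) (_ : MeasurableSpace Y) (_ : StandardBorelSpace Y) (ν : Measure Y)
      (_ : IsProbabilityMeasure ν) (S : ι → Y ≃ᵐ Y) (π : Y → X) (𝒰 : Set (Y ≃ᵐ Y)),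
      IsBoxExtension μ T L ν S π 𝒰 := by
  induction n with
  | zero =>
    intro ι X _ _ μ _ T hc hmp L _ hL
    obtain rfl := List.eq_nil_of_length_eq_zero hL
    refine ⟨X, inferInstance, inferInstance, μ, inferInstance, T, id, ∅, MeasurePreserving.id μ,
      fun _ _ => rfl, hc, hmp, by simp, by simp, by simp, fun w hw _ => ⟨w, hw, by simp⟩,
      fun f _ _ => ⟨fun _ => 1, measurable_const, by simp, fun M _ c h => ?_⟩⟩
    simpa using h
  | succ n ih =>
    intro ι X _ _ μ _ T hc hmp L hL hlen
    obtain ⟨i, L, rfl⟩ := List.exists_cons_of_length_eq_add_one hlen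
    have hiL : i ∉ L := (List.nodup_cons.1 hL).1
    have hmp' : ∀ a, MeasurePreserving (relLift T i a) (relProd μ (T i)) (relProd μ (T i)) := by
      rintro (_ | a)
      · exact measurePreserving_prodCongr_right (hmp i)
      · by_cases ha : a = i
        · subst ha
          have : relLift T a (some a) = (T a).prodCongr (MeasurableEquiv.refl X) := by
            simp [relLift]
          rw [this]
          exact measurePreserving_prodCongr_left (hmp a)
        · rw [relLift_of_ne T ha]
          exact measurePreserving_prodCongr_diag (hmp a) (hc a i)
    obtain ⟨Y, _, _, ν, _, S, π, 𝒰, h⟩ := ih (ι := Option ι) (μ := relProd μ (T i))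
      (T := relLift T i) (relLift_commute hc i) hmp' (L := L.map some)
      ((List.nodup_cons.1 hL).2.map (Option.some_injective ι)) (by simpa using hlen)
    -- Functions invariant under the old fibre maps descend to X × X; those also invariant under the
    -- lift of id × T i then depend on the first coordinate only.
    refine ⟨Y, inferInstance, inferInstance, ν, inferInstance, fun j => S (some j),
      fun y => (π y).1, insert (S none) 𝒰, ?_⟩
    have hπm := h.measurePreserving_fst
    refine ⟨(measurePreserving_fst_relProd (T i)).comp hπm, fun j y => ?_,
      fun j k y => h.commute _ _ y, fun j => h.measurePreserving _, ?_, ?_, ?_, ?_, ?_⟩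
    · rw [h.equivariant]
      by_cases hj : j = i
      · subst hj; rw [relLift_self]
      · rw [relLift_of_ne_apply T hj]
    · rintro U (rfl | hU) y
      · rw [h.equivariant, relLift_none]
      · rw [h.fibre U hU]
    · rintro U (rfl | hU) j y
      · exact h.commute _ _ y
      · exact h.fibre_commute U hU _ y
    · rintro U (rfl | hU)
      · exact h.measurePreserving _
      · exact h.fibre_measurePreserving U hU
    · intro w hw hinv
      obtain ⟨v, hv, hwv⟩ := h.exists_of_invariant w hw fun U hU => hinv U (Or.inr hU)
      have h1 : ∀ᵐ y ∂ν, v (relLift T i none (π y)) = v (π y) := by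
        filter_upwards [hwv, (h.measurePreserving none).quasiMeasurePreserving.ae hwv,
          hinv _ (Or.inl rfl)] with y h1 h2 h3
        rw [← h.equivariant, ← h2, h3, h1]
      have hset : MeasurableSet {p : X × X | v (relLift T i none p) = v p} :=
        measurableSet_eq_fun (hv.comp (MeasurableEquiv.measurable _)) hv
      have h2 : ∀ᵐ p ∂(relProd μ (T i)), v (relLift T i none p) = v p := by
        rw [← hπm.map_eq]
        exact (ae_map_iff hπm.measurable.aemeasurable hset).2 h1
      obtain ⟨v', hv', h3⟩ := exists_fst_of_invariant (hmp i) hv h2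
      refine ⟨v', hv', ?_⟩
      filter_upwards [hwv, hπm.quasiMeasurePreserving.ae h3] with y h4 h5
      rw [h4, h5]
    · intro f hf hfb
      have hcm : Measurable fun x => conj (f x) := Complex.continuous_conj.measurable.comp hf
      obtain ⟨F, hF, hFb, hbox⟩ := h.boxLE (tensorConj f)
        ((hf.comp measurable_fst).mul (hcm.comp measurable_snd)) fun p => by
          rw [tensorConj, norm_mul, RCLike.norm_conj]
          exact mul_le_one₀ (hfb _) (norm_nonneg _) (hfb _)
      -- The lift of T i is T i × id, which fixes the second coordinate, so the new factor is
      -- invariant under `S (some i)`; F is measurable for the remaining indices.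
      refine ⟨fun y => conj (f (π y).2) * F y, ?_, fun y => ?_, fun M hM c hb => ?_⟩
      · refine Measurable.mul ?_ (hF.mono ?_ le_rfl)
        · have h1 : Measurable[singleInv (S (some i))] fun y => conj (f (π y).2) := by
            refine measurable_jointInv (hcm.comp (measurable_snd.comp hπm.measurable))
              fun _ y => ?_
            rw [h.equivariant, relLift_self]
          rw [singleInv, jointInv_unit] at h1
          exact h1.mono (le_iSup₂_of_le i (by simp) le_rfl) le_rfl
        · refine iSup₂_le fun a ha => ?_
          obtain ⟨j, hj, rfl⟩ := List.mem_map.1 ha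
          exact le_iSup₂_of_le (f := fun j (_ : j ∈ i :: L) => MeasurableSpace.invariants (S (some j)))
            j (List.mem_cons_of_mem _ hj) le_rfl
      · rw [norm_mul, RCLike.norm_conj]
        exact mul_le_one₀ (hfb _) (norm_nonneg _) (hFb _)
      · have hMi : ∀ j ∈ M, j ≠ i := fun j hj hji => hM hj (by simp [hji])
        have hLi : ∀ j ∈ L, j ≠ i := fun j hj hji => hiL (hji ▸ hj)
        have h1 := hbox (M.map some) (by
          intro a ha hb
          obtain ⟨j, hj, rfl⟩ := List.mem_map.1 ha
          obtain ⟨k, hk, hjk⟩ := List.mem_map.1 hb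
          obtain rfl := Option.some_injective _ hjk
          exact hM hj (List.mem_cons_of_mem _ hk)) c (by
            simpa only [List.map_map, Function.comp_def, tensorConj, mul_assoc] using hb)
        have h2 : ∀ (N : List ι), (∀ j ∈ N, j ≠ i) → (N.map some).map (relLift T i) =
            (N.map T).map fun Q => Q.prodCongr Q := fun N hN => by
          rw [List.map_map, List.map_map]
          exact List.map_congr_left fun j hj => relLift_of_ne T (hN j hj)
        rw [h2 M hMi, h2 L hLi, ← List.map_reverse, ← List.map_append] at h1
        -- Indices in M and L differ from i, so all remaining lifts are diagonal; T i returns in the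
        -- innermost place, which is why L appears reversed.
        have h3 := BoxLE.of_relProd (hmp i) _ hf hfb h1
        simpa using h3

end BoxExtension

theorem comap_eq_of_comap_le {Y : Type*} {U V : Y → Y} (hVU : ∀ y, V (U y) = y) {m : MeasurableSpace Y}
    (h : m.comap U ≤ m) (h' : m.comap V ≤ m) : m.comap U = m := by
  refine le_antisymm h ?_
  have h1 := MeasurableSpace.comap_mono (g := U) h'
  rw [MeasurableSpace.comap_comp] at h1
  have : V ∘ U = id := funext hVU
  rwa [this, MeasurableSpace.comap_id] at h1

/-! ### The σ-algebra of generalised eigenfunctions, in a form without explicit eigenvalue. -/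

section Eigen

variable {Y : Type*} [mY : MeasurableSpace Y] {ν : Measure Y} {S : Y ≃ᵐ Y}

/-- Generalised eigenfunctions of `S` whose modulus is an indicator function, the eigenvalue
`(g ∘ S) · conj g` being an `S`-invariant function. -/
structure IsEig (ν : Measure Y) (S : Y ≃ᵐ Y) (g : Y → ℂ) : Prop where
  measurable : Measurable g
  ae_norm : ∀ᵐ y ∂ν, ‖g y‖ = 0 ∨ ‖g y‖ = 1
  ae_norm_comp : ∀ᵐ y ∂ν, ‖g (S y)‖ = ‖g y‖
  ae_eigenvalue : ∀ᵐ y ∂ν, g (S (S y)) * conj (g (S y)) = g (S y) * conj (g y)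

/-- The σ-algebra generated by the generalised eigenfunctions of `S`. -/
@[reducible]
def eigAlg (ν : Measure Y) (S : Y ≃ᵐ Y) : MeasurableSpace Y :=
  ⨆ g : {g : Y → ℂ // IsEig ν S g}, MeasurableSpace.comap g.1 inferInstance

theorem eigAlg_le (ν : Measure Y) (S : Y ≃ᵐ Y) : eigAlg ν S ≤ mY :=
  iSup_le fun g => g.2.measurable.comap_le

theorem IsEig.measurable_eigAlg {g : Y → ℂ} (hg : IsEig ν S g) : Measurable[eigAlg ν S] g :=
  (comap_measurable g).mono (le_iSup (fun g : {g : Y → ℂ // IsEig ν S g} =>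
    MeasurableSpace.comap g.1 inferInstance) ⟨g, hg⟩) le_rfl

theorem IsEig.comp {g : Y → ℂ} (hg : IsEig ν S g) {U : Y ≃ᵐ Y} (hU : MeasurePreserving U ν ν)
    (hc : ∀ y, U (S y) = S (U y)) : IsEig ν S (g ∘ U) where
  measurable := hg.measurable.comp U.measurable
  ae_norm := hU.quasiMeasurePreserving.ae hg.ae_norm
  ae_norm_comp := by
    simpa only [Function.comp, hc] using hU.quasiMeasurePreserving.ae hg.ae_norm_comp
  ae_eigenvalue := by
    simpa only [Function.comp, hc] using hU.quasiMeasurePreserving.ae hg.ae_eigenvalue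

theorem comap_eigAlg_le {U : Y ≃ᵐ Y} (hU : MeasurePreserving U ν ν)
    (hc : ∀ y, U (S y) = S (U y)) : (eigAlg ν S).comap U ≤ eigAlg ν S := by
  unfold eigAlg
  rw [MeasurableSpace.comap_iSup]
  refine iSup_le fun g => ?_
  rw [MeasurableSpace.comap_comp]
  exact (g.2.comp hU hc).measurable_eigAlg.comap_le

theorem symm_commute {U Q : Y ≃ᵐ Y} (hc : ∀ y, U (Q y) = Q (U y)) (y : Y) :
    U.symm (Q y) = Q (U.symm y) := by
  apply U.injective
  rw [hc, U.apply_symm_apply, U.apply_symm_apply]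

theorem eigAlg_comap {U : Y ≃ᵐ Y} (hU : MeasurePreserving U ν ν)
    (hc : ∀ y, U (S y) = S (U y)) : (eigAlg ν S).comap U = eigAlg ν S :=
  comap_eq_of_comap_le U.symm_apply_apply (comap_eigAlg_le hU hc)
    (comap_eigAlg_le (hU.symm U) (symm_commute hc))

theorem isEig_indicator {E : Set Y} (hE : MeasurableSet[singleInv S] E) :
    IsEig ν S (E.indicator fun _ => (1 : ℂ)) := by
  have hm : Measurable[singleInv S] (E.indicator fun _ => (1 : ℂ)) :=
    Measurable.indicator (@measurable_const _ _ _ (singleInv S) _) hE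
  have hinv : ∀ y, E.indicator (fun _ => (1 : ℂ)) (S y) = E.indicator (fun _ => (1 : ℂ)) y :=
    jointInv_apply_eq (S := fun _ : Unit => S) hm ()
  refine ⟨hm.mono (jointInv_le _) le_rfl, Eventually.of_forall fun y => ?_,
    Eventually.of_forall fun y => by rw [hinv], Eventually.of_forall fun y => by rw [hinv, hinv]⟩
  by_cases h : y ∈ E <;> simp [h]

theorem singleInv_le_eigAlg : singleInv S ≤ eigAlg ν S := fun E hE => by
  have h := (isEig_indicator (ν := ν) hE).measurable_eigAlg (measurableSet_singleton (1 : ℂ))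
  have e : (E.indicator fun _ => (1 : ℂ)) ⁻¹' {1} = E := by
    ext y; by_cases h : y ∈ E <;> simp [h]
  rwa [e] at h

/-- Polar decomposition: g is its phase times |g|. The phase satisfies `IsEig` (it is 0 where g is,
by the convention for 0⁻¹), and |g| is invariant because θ is unimodular. -/
theorem aestronglyMeasurable_eigAlg (hS : MeasurePreserving S ν ν) {θ g : Y → ℂ}
    (hθ : ∀ y, θ (S y) = θ y) (hθ1 : ∀ y, ‖θ y‖ = 1) (hg : Measurable g)
    (h : ∀ᵐ y ∂ν, g (S y) = θ y * g y) : AEStronglyMeasurable[eigAlg ν S] g ν := by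
  have hnm : Measurable fun y => (‖g y‖ : ℂ) := Complex.measurable_ofReal.comp hg.norm
  have hn : ∀ᵐ y ∂ν, ‖g (S y)‖ = ‖g y‖ := by
    filter_upwards [h] with y hy
    rw [hy, norm_mul, hθ1, one_mul]
  obtain ⟨r, hr, hgr⟩ := exists_jointInv_ae_eq (S := fun _ : Unit => S) (fun _ => hS) hnm
    fun _ => by filter_upwards [hn] with y hy; rw [hy]
  have hr' : Measurable[eigAlg ν S] r := hr.mono singleInv_le_eigAlg le_rfl
  have hsgn : IsEig ν S fun y => g y * (‖g y‖ : ℂ)⁻¹ := by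
    refine ⟨hg.mul hnm.inv, Eventually.of_forall fun y => ?_, ?_, ?_⟩
    · by_cases hy : g y = 0
      · left; simp [hy]
      · right
        have : ‖g y‖ ≠ 0 := norm_ne_zero_iff.2 hy
        simp [this]
    · filter_upwards [h, hn] with y h1 h2
      rw [h2, h1, norm_mul, norm_mul, norm_mul, hθ1, one_mul]
    · filter_upwards [h, hn, hS.quasiMeasurePreserving.ae h, hS.quasiMeasurePreserving.ae hn]
        with y h1 h2 h3 h4
      rw [h4, h2, h3, hθ, h1]
      simp only [map_mul]
      have h5 : θ y * conj (θ y) = 1 := by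
        rw [Complex.mul_conj, Complex.normSq_eq_norm_sq, hθ1]; simp
      linear_combination (θ y * g y * (‖g y‖ : ℂ)⁻¹ * (conj (g y) * conj (‖g y‖ : ℂ)⁻¹)) * h5
  refine ⟨fun y => g y * (‖g y‖ : ℂ)⁻¹ * r y,
    (hsgn.measurable_eigAlg.mul hr').stronglyMeasurable, ?_⟩
  filter_upwards [hgr] with y hy
  rw [← hy]
  by_cases h0 : g y = 0
  · simp [h0]
  · have : (‖g y‖ : ℂ) ≠ 0 := by exact_mod_cast norm_ne_zero_iff.2 h0
    field_simp

end Eigen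

/-! ### Conditional expectation as a self-adjoint projection. -/

section CondExp

variable {Y : Type*} {mY : MeasurableSpace Y} {ν : Measure Y}

theorem integral_mul_condExp_of_aestronglyMeasurable [IsFiniteMeasure ν] {H b : Y → ℂ} (hb : Integrable b ν)
    (hHb : Integrable (fun y => H y * b y) ν) {m : MeasurableSpace Y} (hm : m ≤ mY)
    (hH : AEStronglyMeasurable[m] H ν) :
    ∫ y, H y * b y ∂ν = ∫ y, H y * (ν[b|m]) y ∂ν := by
  rw [← integral_condExp hm]
  exact integral_congr_ae (condExp_bilin_of_aestronglyMeasurable_left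
    (ContinuousLinearMap.mul ℝ ℂ) hH hHb hb)

theorem integral_mul_condExp_comm [IsFiniteMeasure ν] {a b : Y → ℂ} {C : ℝ} (ha : Integrable a ν)
    (hC : ∀ᵐ y ∂ν, ‖a y‖ ≤ C) (hb : Integrable b ν) {m : MeasurableSpace Y} (hm : m ≤ mY) :
    ∫ y, a y * (ν[b|m]) y ∂ν = ∫ y, (ν[a|m]) y * b y ∂ν := by
  have h1 := integral_mul_condExp_of_aestronglyMeasurable (H := ν[a|m]) hb
    (hb.bdd_mul integrable_condExp.aestronglyMeasurable
      (ae_bdd_norm_condExp_of_ae_bdd_norm hC)) hm stronglyMeasurable_condExp.aestronglyMeasurable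
  have h2 := integral_mul_condExp_of_aestronglyMeasurable (H := ν[b|m]) ha
    (integrable_condExp.mul_bdd ha.aestronglyMeasurable hC) hm
    stronglyMeasurable_condExp.aestronglyMeasurable
  rw [h1]
  simp only [mul_comm (a _)]
  rw [h2]
  simp only [mul_comm ((ν[b|m]) _)]

theorem integral_comp_of_measurePreserving {X : Type*} [MeasurableSpace X] {μ : Measure X}
    {π : Y → X} (hπ : MeasurePreserving π ν μ) {u : X → ℂ} (hu : Measurable u) :
    ∫ y, u (π y) ∂ν = ∫ x, u x ∂μ := by
  rw [← hπ.map_eq, integral_map hπ.measurable.aemeasurable hu.aestronglyMeasurable]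

end CondExp

/-! ### Dual functions of the base are structured on the extension. -/

section StructuredFactor

/-- The join of the `S i`-invariant σ-algebras, `i ∈ L`, and the σ-algebra generated by the
generalised eigenfunctions of `S a`. -/
@[reducible]
def structAlg {ι Y : Type*} [MeasurableSpace Y] (ν : Measure Y) (S : ι → Y ≃ᵐ Y) (L : List ι)
    (a : ι) : MeasurableSpace Y :=
  (⨆ i ∈ L, MeasurableSpace.invariants (S i)) ⊔ eigAlg ν (S a)

theorem structAlg_le {ι Y : Type*} [mY : MeasurableSpace Y] (ν : Measure Y) (S : ι → Y ≃ᵐ Y)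
    (L : List ι) (a : ι) : structAlg ν S L a ≤ mY :=
  sup_le (iSup₂_le fun i _ => MeasurableSpace.invariants_le _) (eigAlg_le _ _)

theorem structAlg_comap {ι Y : Type*} [mY : MeasurableSpace Y] {ν : Measure Y} {S : ι → Y ≃ᵐ Y}
    {U : Y ≃ᵐ Y} (hU : MeasurePreserving U ν ν) (hc : ∀ i y, U (S i y) = S i (U y)) (L : List ι)
    (a : ι) : (structAlg ν S L a).comap U = structAlg ν S L a := by
  unfold structAlg
  simp only [MeasurableSpace.comap_sup, MeasurableSpace.comap_iSup, eigAlg_comap hU (hc a)]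
  congr 1
  refine iSup_congr fun i => iSup_congr fun _ => ?_
  rw [← jointInv_unit]
  exact jointInv_comap _ fun _ => hc i

variable {ι X Y : Type*} [MeasurableSpace X] [mY : MeasurableSpace Y] [StandardBorelSpace Y]
  {μ : Measure X} [IsProbabilityMeasure μ] {ν : Measure Y} [IsProbabilityMeasure ν]
  {T : ι → X ≃ᵐ X} {S : ι → Y ≃ᵐ Y} {L : List ι} {π : Y → X} {𝒰 : Set (Y ≃ᵐ Y)}

/-- The fibre maps fix u ∘ π and preserve the structured σ-algebra, as they commute with every `S
i`. They hence fix the conditional expectation, which therefore descends to X. -/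
theorem IsBoxExtension.exists_condExp_eq (h : IsBoxExtension μ T L ν S π 𝒰) (a : ι) {u : X → ℂ}
    (hu : Integrable (fun y => u (π y)) ν) :
    ∃ v : X → ℂ, Measurable v ∧
      ∀ᵐ y ∂ν, (ν[fun y => u (π y)|structAlg ν S L a]) y = v (π y) := by
  have hle := structAlg_le ν S L a
  refine h.exists_of_invariant _ (stronglyMeasurable_condExp.mono hle).measurable fun U hU => ?_
  have h1 := condExp_comp_equiv (h.fibre_measurePreserving U hU) hle
    (structAlg_comap (h.fibre_measurePreserving U hU) (h.fibre_commute U hU) L a) hu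
  have e : (fun y => u (π y)) ∘ U = fun y => u (π y) := by
    ext y; simp [h.fibre U hU]
  rw [e] at h1
  filter_upwards [h1] with y hy
  exact hy.symm

/-- Both F and the conjugate of an eigenfunction g are structured, while (f - v) ∘ π has zero
conditional expectation; so (f - v) ∘ π · F is orthogonal to g. The bounds 1 / 2 keep f - v below 1.
-/
theorem IsBoxExtension.boxLE_sub_condExp (h : IsBoxExtension μ T L ν S π 𝒰) {a : ι} (ha : a ∉ L)
    {f v : X → ℂ} (hf : Measurable f) (hfb : ∀ x, ‖f x‖ ≤ 1 / 2) (hv : Measurable v)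
    (hvb : ∀ x, ‖v x‖ ≤ 1 / 2)
    (hfv : ∀ᵐ y ∂ν, (ν[fun y => f (π y)|structAlg ν S L a]) y = v (π y)) :
    BoxLE μ ([T a, T a] ++ (L.map T).reverse) (fun x => f x - v x) 0 := by
  have hle := structAlg_le ν S L a
  have hπ := h.measurePreserving_fst.measurable
  obtain ⟨F, hF, hFb, hbox⟩ := h.boxLE (fun x => f x - v x) (hf.sub hv) fun x =>
    (norm_sub_le _ _).trans (by linarith [hfb x, hvb x])
  have hF' : Measurable[structAlg ν S L a] F := hF.mono le_sup_left le_rfl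
  have hFm : Measurable F := hF'.mono hle le_rfl
  refine hbox [a, a] (by simpa using ha) 0 ?_
  refine boxLE_pair_of_orthogonal (h.measurePreserving a)
    (((hf.sub hv).comp hπ).mul hFm) (fun y => ?_) fun θ g hθ hθ1 hg hg2 hgS => ?_
  · rw [norm_mul]
    refine mul_le_one₀ ((norm_sub_le _ _).trans ?_) (norm_nonneg _) (hFb y)
    linarith [hfb (π y), hvb (π y)]
  · have hgB : AEStronglyMeasurable[structAlg ν S L a] g ν :=
      (aestronglyMeasurable_eigAlg (h.measurePreserving a)
        (jointInv_apply_eq (S := fun _ : Unit => S a) hθ ()) hθ1 hg hgS).mono le_sup_right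
    have hH : AEStronglyMeasurable[structAlg ν S L a] (fun y => F y * conj (g y)) ν :=
      hF'.aestronglyMeasurable.mul (Complex.continuous_conj.comp_aestronglyMeasurable hgB)
    have hHi : Integrable (fun y => F y * conj (g y)) ν := by
      have hci : Integrable (fun y => conj (g y)) ν :=
        (hg2.integrable (by norm_num)).norm.mono'
          (Complex.continuous_conj.measurable.comp hg).aestronglyMeasurable
          (Eventually.of_forall fun y => by rw [RCLike.norm_conj])
      exact hci.bdd_mul hFm.aestronglyMeasurable (Eventually.of_forall hFb)
    have hfi : Integrable (fun y => f (π y)) ν :=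
      Integrable.of_bound (hf.comp hπ).aestronglyMeasurable (1 / 2)
        (Eventually.of_forall fun y => hfb _)
    have i1 : Integrable (fun y => F y * conj (g y) * f (π y)) ν :=
      hHi.mul_bdd (hf.comp hπ).aestronglyMeasurable (Eventually.of_forall fun y => hfb (π y))
    have i2 : Integrable (fun y => F y * conj (g y) * v (π y)) ν :=
      hHi.mul_bdd (hv.comp hπ).aestronglyMeasurable (Eventually.of_forall fun y => hvb (π y))
    have h1 := integral_mul_condExp_of_aestronglyMeasurable hfi i1 hle hH
    have h2 : ∫ y, F y * conj (g y) * (ν[fun y => f (π y)|structAlg ν S L a]) y ∂ν =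
        ∫ y, F y * conj (g y) * v (π y) ∂ν := by
      refine integral_congr_ae ?_
      filter_upwards [hfv] with y hy
      rw [hy]
    have e : ∀ y, (f (π y) - v (π y)) * F y * conj (g y) =
        F y * conj (g y) * f (π y) - F y * conj (g y) * v (π y) := fun y => by ring
    simp only [e]
    rw [integral_sub i1 i2, h1, h2, sub_self]

/-- With E[D ∘ π] = w ∘ π and E[f ∘ π] = v ∘ π, orthogonality of f - v to D gives ∫ f D = ∫ v D, and
self-adjointness gives ∫ v D = ∫ f w. Letting f run over half indicators yields D = w. -/
theorem IsBoxExtension.aestronglyMeasurable_dual (h : IsBoxExtension μ T L ν S π 𝒰) {a : ι}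
    (ha : a ∉ L) {s : ℕ} (hs : 0 < s) {R : Fin s → X ≃ᵐ X}
    (hcomm : ∀ i j x, R i (R j x) = R j (R i x)) (hR : ∀ i, MeasurePreserving (R i) μ μ)
    (hRL : (List.ofFn R).reverse = [T a, T a] ++ (L.map T).reverse) {D : Lp ℂ 2 μ}
    (hD : IsDualFunction μ R D) :
    AEStronglyMeasurable[structAlg ν S L a] (fun y => D (π y)) ν := by
  have hle := structAlg_le ν S L a
  have hπ := h.measurePreserving_fst
  have hDm : Measurable D := (Lp.stronglyMeasurable D).measurable
  have hDi : Integrable D μ := (Lp.memLp D).integrable (by norm_num)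
  have hDπ : Integrable (fun y => D (π y)) ν := hπ.integrable_comp_of_integrable hDi
  obtain ⟨w, hw, hDw⟩ := h.exists_condExp_eq a hDπ
  have hwi : Integrable w μ := by
    rw [← hπ.integrable_comp hw.aestronglyMeasurable]
    exact (integrable_condExp (m := structAlg ν S L a) (f := fun y => D (π y))).congr hDw
  have key : ∀ s : Set X, MeasurableSet s → ∫ x in s, w x ∂μ = ∫ x in s, D x ∂μ := by
    intro s hs'
    set f : X → ℂ := s.indicator fun _ => 1 / 2 with hf
    have hfm : Measurable f := measurable_const.indicator hs'
    have hfb : ∀ x, ‖f x‖ ≤ 1 / 2 := fun x => by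
      by_cases hx : x ∈ s <;> simp [hf, hx]
    have hfi : Integrable (fun y => f (π y)) ν :=
      Integrable.of_bound (hfm.comp hπ.measurable).aestronglyMeasurable (1 / 2)
        (Eventually.of_forall fun y => hfb _)
    obtain ⟨v, hv, hfv⟩ := h.exists_condExp_eq a hfi
    -- v obeys the bound 1 / 2 only almost everywhere; the truncation makes it hold everywhere.
    set v' : X → ℂ := {x | ‖v x‖ ≤ 1 / 2}.indicator v with hv'
    have hvset : MeasurableSet {x | ‖v x‖ ≤ 1 / 2} := measurableSet_le hv.norm measurable_const
    have hvm : Measurable v' := hv.indicator hvset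
    have hvb : ∀ x, ‖v' x‖ ≤ 1 / 2 := fun x => by
      by_cases hx : ‖v x‖ ≤ 1 / 2
      · rw [hv', Set.indicator_of_mem (show x ∈ {x | ‖v x‖ ≤ 1 / 2} from hx)]; exact hx
      · rw [hv', Set.indicator_of_notMem (show x ∉ {x | ‖v x‖ ≤ 1 / 2} from hx)]; norm_num
    have hfv' : ∀ᵐ y ∂ν, (ν[fun y => f (π y)|structAlg ν S L a]) y = v' (π y) := by
      have hb := ae_bdd_norm_condExp_of_ae_bdd_norm (m := structAlg ν S L a) (μ := ν)
        (f := fun y => f (π y)) (R := 1 / 2) (Eventually.of_forall fun y => hfb _)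
      filter_upwards [hfv, hb] with y h1 h2
      rw [h1] at h2 ⊢
      rw [hv', Set.indicator_of_mem (show π y ∈ {x | ‖v x‖ ≤ 1 / 2} from h2)]
    have hbox := h.boxLE_sub_condExp ha hfm hfb hvm hvb hfv'
    rw [← hRL] at hbox
    have h0 : ∫ x, (f x - v' x) * D x ∂μ = 0 := integral_mul_dual_eq_zero hs hcomm hR (hfm.sub hvm) (fun x =>
      (norm_sub_le _ _).trans (by linarith [hfb x, hvb x])) hbox hD
    have hfD : Integrable (fun x => f x * D x) μ :=
      hDi.bdd_mul hfm.aestronglyMeasurable (Eventually.of_forall hfb)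
    have hvD : Integrable (fun x => v' x * D x) μ :=
      hDi.bdd_mul hvm.aestronglyMeasurable (Eventually.of_forall hvb)
    have h1 : ∫ x, f x * D x ∂μ = ∫ x, v' x * D x ∂μ := by
      rw [← sub_eq_zero, ← integral_sub hfD hvD, ← h0]
      simp only [sub_mul]
    have h2 : ∫ x, f x * w x ∂μ = ∫ x, v' x * D x ∂μ := by
      rw [← integral_comp_of_measurePreserving (u := fun x => f x * w x) hπ (hfm.mul hw),
        ← integral_comp_of_measurePreserving (u := fun x => v' x * D x) hπ (hvm.mul hDm)]
      calc ∫ y, f (π y) * w (π y) ∂ν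
          = ∫ y, f (π y) * (ν[fun y => D (π y)|structAlg ν S L a]) y ∂ν := by
            refine integral_congr_ae ?_
            filter_upwards [hDw] with y hy
            rw [hy]
        _ = ∫ y, (ν[fun y => f (π y)|structAlg ν S L a]) y * D (π y) ∂ν :=
            integral_mul_condExp_comm hfi (Eventually.of_forall fun y => hfb (π y)) hDπ hle
        _ = ∫ y, v' (π y) * D (π y) ∂ν := by
            refine integral_congr_ae ?_
            filter_upwards [hfv'] with y hy
            rw [hy]
    have e : ∀ u : X → ℂ, ∫ x, f x * u x ∂μ = 1 / 2 * ∫ x in s, u x ∂μ := fun u => by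
      rw [← integral_const_mul, ← integral_indicator hs']
      congr 1
      ext x
      by_cases hx : x ∈ s <;> simp [hf, hx]
    rw [← h1, e, e] at h2
    exact mul_left_cancel₀ (by norm_num) h2
  have hwD : w =ᵐ[μ] D := hwi.ae_eq_of_forall_setIntegral_eq _ _ hDi fun s hs' _ => key s hs'
  refine (stronglyMeasurable_condExp (f := fun y => D (π y)) (μ := ν)
    (m := structAlg ν S L a)).aestronglyMeasurable.congr ?_
  filter_upwards [hDw, hπ.quasiMeasurePreserving.ae hwD] with y h1 h2
  rw [h1, h2]

/-- The box factor of the base is contained in the structured factor of a box extension. -/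
theorem IsBoxExtension.aestronglyMeasurable_boxSpace (h : IsBoxExtension μ T L ν S π 𝒰) {a : ι}
    (ha : a ∉ L) {s : ℕ} (hs : 0 < s) {R : Fin s → X ≃ᵐ X}
    (hcomm : ∀ i j x, R i (R j x) = R j (R i x)) (hR : ∀ i, MeasurePreserving (R i) μ μ)
    (hRL : (List.ofFn R).reverse = [T a, T a] ++ (L.map T).reverse) {g : Lp ℂ 2 μ}
    (hg : g ∈ boxSpace μ R) :
    AEStronglyMeasurable[structAlg ν S L a] (fun y => g (π y)) ν := by
  have hle := structAlg_le ν S L a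
  have hπ := h.measurePreserving_fst
  set K : Submodule ℂ (Lp ℂ 2 μ) := (lpMeas ℂ ℂ (structAlg ν S L a) 2 ν).comap
    (Lp.compMeasurePreservingₗᵢ ℂ π hπ).toLinearMap with hK
  have hmem : ∀ u : Lp ℂ 2 μ, u ∈ K ↔
      AEStronglyMeasurable[structAlg ν S L a] (fun y => u (π y)) ν := fun u => by
    rw [hK, Submodule.mem_comap, mem_lpMeas_iff_aestronglyMeasurable]
    have := Lp.coeFn_compMeasurePreserving u hπ
    exact aestronglyMeasurable_congr this
  have hclosed : IsClosed (K : Set (Lp ℂ 2 μ)) :=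
    (isClosed_aestronglyMeasurable hle).preimage
      (Lp.compMeasurePreservingₗᵢ ℂ π hπ).continuous
  rw [← hmem]
  refine Submodule.topologicalClosure_minimal _ (Submodule.span_le.2 fun D hD => ?_) hclosed hg
  exact (hmem D).2 (h.aestronglyMeasurable_dual ha hs hcomm hR hRL hD)

end StructuredFactor

/-! ### The action of ℤ^ℓ generated by commuting transformations. -/

section Action

/-- The acting group `ℤ^ℓ`, written multiplicatively. -/
abbrev ZIdx (ℓ : ℕ) : Type := Fin ℓ → Multiplicative ℤ

/-- The standard generators of `ℤ^ℓ`. -/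
def zgen {ℓ : ℕ} (i : Fin ℓ) : ZIdx ℓ := Pi.mulSingle i (Multiplicative.ofAdd 1)

theorem closure_range_zgen (ℓ : ℕ) : Subgroup.closure (Set.range (zgen (ℓ := ℓ))) = ⊤ := by
  refine eq_top_iff.2 fun n _ => ?_
  rw [← Finset.univ_prod_mulSingle n]
  refine Subgroup.prod_mem _ fun i _ => ?_
  have : Pi.mulSingle i (n i) = (zgen i : ZIdx ℓ) ^ (Multiplicative.toAdd (n i)) := by
    rw [zgen, ← Pi.mulSingle_zpow, ← ofAdd_zsmul]
    simp
  rw [this]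
  exact Subgroup.zpow_mem _ (Subgroup.subset_closure (Set.mem_range_self i)) _

theorem ZIdx.induction {ℓ : ℕ} {P : ZIdx ℓ → Prop} (one : P 1)
    (mul : ∀ n i, P n → P (n * zgen i)) (mul_inv : ∀ n i, P n → P (n * (zgen i)⁻¹)) (n : ZIdx ℓ) :
    P n := by
  have hn : n ∈ Subgroup.closure (Set.range (zgen (ℓ := ℓ))) := by
    rw [closure_range_zgen]; trivial
  induction hn using Subgroup.closure_induction_right with
  | one => exact one
  | mul_right x _ y hy h => obtain ⟨i, rfl⟩ := hy; exact mul x i h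
  | mul_inv_cancel x _ y hy h => obtain ⟨i, rfl⟩ := hy; exact mul_inv x i h

variable {ℓ : ℕ} {Y : Type*} [MeasurableSpace Y] {S : Fin ℓ → Y ≃ᵐ Y}

theorem pairwise_commute_zpowersHom (hc : ∀ i j y, S i (S j y) = S j (S i y)) :
    Pairwise fun i j => ∀ x y : Multiplicative ℤ,
      Commute (zpowersHom (Equiv.Perm Y) (S i).toEquiv x)
        (zpowersHom (Equiv.Perm Y) (S j).toEquiv y) := by
  intro i j _ x y
  rw [zpowersHom_apply, zpowersHom_apply]
  refine Commute.zpow_zpow ?_ _ _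
  ext z
  exact hc i j z

/-- The action of `ℤ^ℓ` by permutations given by commuting transformations. -/
def permAct (hc : ∀ i j y, S i (S j y) = S j (S i y)) : ZIdx ℓ →* Equiv.Perm Y :=
  MonoidHom.noncommPiCoprod (fun i => zpowersHom (Equiv.Perm Y) (S i).toEquiv)
    (pairwise_commute_zpowersHom hc)

variable (hc : ∀ i j y, S i (S j y) = S j (S i y))

theorem permAct_zgen (i : Fin ℓ) : permAct hc (zgen i) = (S i).toEquiv := by
  rw [permAct, zgen, MonoidHom.noncommPiCoprod_mulSingle]
  simp

theorem permAct_mul_zgen (n : ZIdx ℓ) (i : Fin ℓ) (y : Y) :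
    permAct hc (n * zgen i) y = permAct hc n (S i y) := by
  rw [map_mul, permAct_zgen]; rfl

theorem permAct_mul_zgen_inv (n : ZIdx ℓ) (i : Fin ℓ) (y : Y) :
    permAct hc (n * (zgen i)⁻¹) y = permAct hc n ((S i).symm y) := by
  rw [map_mul, map_inv, permAct_zgen]; rfl

theorem measurable_permAct (n : ZIdx ℓ) : Measurable (permAct hc n) := by
  induction n using ZIdx.induction with
  | one => rw [map_one]; exact measurable_id
  | mul n i h =>
    have : ⇑(permAct hc (n * zgen i)) = permAct hc n ∘ S i := funext (permAct_mul_zgen hc n i)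
    rw [this]; exact h.comp (S i).measurable
  | mul_inv n i h =>
    have : ⇑(permAct hc (n * (zgen i)⁻¹)) = permAct hc n ∘ (S i).symm :=
      funext (permAct_mul_zgen_inv hc n i)
    rw [this]; exact h.comp (S i).symm.measurable

/-- The action of `ℤ^ℓ` given by commuting transformations. -/
def zact (n : ZIdx ℓ) : Y ≃ᵐ Y where
  toEquiv := permAct hc n
  measurable_toFun := measurable_permAct hc n
  measurable_invFun := by
    have : ⇑(permAct hc n).symm = permAct hc n⁻¹ := by rw [map_inv]; rfl
    rw [this]
    exact measurable_permAct hc _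

theorem zact_one (y : Y) : zact hc 1 y = y := by
  change permAct hc 1 y = y
  rw [map_one]; rfl

theorem zact_mul (m n : ZIdx ℓ) (y : Y) : zact hc (m * n) y = zact hc m (zact hc n y) := by
  change permAct hc (m * n) y = _
  rw [map_mul]; rfl

theorem zact_zgen (i : Fin ℓ) (y : Y) : zact hc (zgen i) y = S i y := by
  change permAct hc (zgen i) y = _
  rw [permAct_zgen]; rfl

theorem zact_commute (n : ZIdx ℓ) (i : Fin ℓ) (y : Y) :
    zact hc n (S i y) = S i (zact hc n y) := by
  rw [← zact_zgen hc i, ← zact_zgen hc i, ← zact_mul, ← zact_mul, mul_comm]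

theorem zact_mul_zgen (n : ZIdx ℓ) (i : Fin ℓ) (y : Y) :
    zact hc (n * zgen i) y = zact hc n (S i y) := permAct_mul_zgen hc n i y

theorem zact_mul_zgen_inv (n : ZIdx ℓ) (i : Fin ℓ) (y : Y) :
    zact hc (n * (zgen i)⁻¹) y = zact hc n ((S i).symm y) := permAct_mul_zgen_inv hc n i y

theorem measurePreserving_zact {ν : Measure Y} (hS : ∀ i, MeasurePreserving (S i) ν ν)
    (n : ZIdx ℓ) : MeasurePreserving (zact hc n) ν ν := by
  induction n using ZIdx.induction with
  | one =>
    have : ⇑(zact hc 1) = id := funext (zact_one hc)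
    rw [this]; exact MeasurePreserving.id ν
  | mul n i h =>
    have : ⇑(zact hc (n * zgen i)) = zact hc n ∘ S i := funext (zact_mul_zgen hc n i)
    rw [this]; exact h.comp (hS i)
  | mul_inv n i h =>
    have : ⇑(zact hc (n * (zgen i)⁻¹)) = zact hc n ∘ (S i).symm :=
      funext (zact_mul_zgen_inv hc n i)
    rw [this]; exact h.comp ((hS i).symm _)

theorem map_zact {X : Type*} [MeasurableSpace X] {T : Fin ℓ → X ≃ᵐ X}
    (hcT : ∀ i j x, T i (T j x) = T j (T i x)) {π : Y → X} (hπ : ∀ i y, π (S i y) = T i (π y))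
    (n : ZIdx ℓ) (y : Y) : π (zact hc n y) = zact hcT n (π y) := by
  induction n using ZIdx.induction generalizing y with
  | one => rw [zact_one, zact_one]
  | mul n i h => rw [zact_mul_zgen, zact_mul_zgen, h, hπ]
  | mul_inv n i h =>
    rw [zact_mul_zgen_inv, zact_mul_zgen_inv, h]
    congr 1
    apply (T i).injective
    rw [← hπ, (S i).apply_symm_apply, (T i).apply_symm_apply]

end Action

/-! ### Coding of systems in a standard Borel shift space. -/

section Shift

/-- The shift space in which factors of `ℤ^ℓ`-systems are realised. -/
abbrev ShiftSpace (ℓ : ℕ) : Type := ZIdx ℓ → ℕ → ℂ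

/-- The shift by `m`. -/
def zshift {ℓ : ℕ} (m : ZIdx ℓ) : ShiftSpace ℓ ≃ᵐ ShiftSpace ℓ where
  toFun ω n := ω (n * m)
  invFun ω n := ω (n * m⁻¹)
  left_inv ω := by ext n; simp
  right_inv ω := by ext n; simp
  measurable_toFun := measurable_pi_lambda _ fun _ => measurable_pi_apply _
  measurable_invFun := measurable_pi_lambda _ fun _ => measurable_pi_apply _

theorem zshift_apply {ℓ : ℕ} (m n : ZIdx ℓ) (ω : ShiftSpace ℓ) : zshift m ω n = ω (n * m) := rfl

/-- The standard generators of the shift action. -/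
def shiftGen {ℓ : ℕ} (i : Fin ℓ) : ShiftSpace ℓ ≃ᵐ ShiftSpace ℓ := zshift (zgen i)

theorem zshift_commute {ℓ : ℕ} (m m' : ZIdx ℓ) (ω : ShiftSpace ℓ) :
    zshift m (zshift m' ω) = zshift m' (zshift m ω) := by
  ext n j
  simp only [zshift_apply]
  rw [mul_right_comm]

variable {ℓ : ℕ} {Y : Type*} [MeasurableSpace Y] {S : Fin ℓ → Y ≃ᵐ Y}
  (hc : ∀ i j y, S i (S j y) = S j (S i y))

/-- The coding of points by the values of the functions `g j` along their orbits. -/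
def coding (g : ℕ → Y → ℂ) (y : Y) : ShiftSpace ℓ := fun n j => g j (zact hc n y)

theorem measurable_coding {g : ℕ → Y → ℂ} (hg : ∀ j, Measurable (g j)) :
    Measurable (coding hc g) :=
  measurable_pi_lambda _ fun n => measurable_pi_lambda _ fun j =>
    (hg j).comp (zact hc n).measurable

theorem coding_zact (g : ℕ → Y → ℂ) (m : ZIdx ℓ) (y : Y) :
    coding hc g (zact hc m y) = zshift m (coding hc g y) := by
  ext n j
  rw [zshift_apply, coding, coding, zact_mul]

theorem coding_apply (g : ℕ → Y → ℂ) (i : Fin ℓ) (y : Y) :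
    coding hc g (S i y) = shiftGen i (coding hc g y) := by
  rw [shiftGen, ← coding_zact, zact_zgen]

theorem measurePreserving_of_semiconj {Y Z : Type*} [MeasurableSpace Y] [MeasurableSpace Z]
    {ν : Measure Y} {A : Y → Y} {B : Z → Z} {Φ : Y → Z} (hΦ : Measurable Φ)
    (hA : MeasurePreserving A ν ν) (hB : Measurable B) (h : ∀ y, Φ (A y) = B (Φ y)) :
    MeasurePreserving B (ν.map Φ) (ν.map Φ) := by
  refine ⟨hB, ?_⟩
  rw [Measure.map_map hB hΦ]
  have : B ∘ Φ = Φ ∘ A := funext fun y => (h y).symm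
  rw [this, ← Measure.map_map hΦ hA.measurable, hA.map_eq]

end Shift

/-! ### σ-algebras up to null sets. -/

section NullAugmentation

variable {Y : Type*} {mY : MeasurableSpace Y} {ν : Measure Y}

/-- The σ-algebra of sets that agree almost everywhere with a set in `m`. -/
@[reducible]
def nullAug (ν : Measure Y) (m : MeasurableSpace Y) : MeasurableSpace Y :=
  eventuallyMeasurableSpace m (ae ν)

theorem le_nullAug {m : MeasurableSpace Y} : m ≤ nullAug ν m :=
  fun s hs => ⟨s, hs, EventuallyEq.rfl⟩

theorem nullAug_mono {m₁ m₂ : MeasurableSpace Y} (h : m₁ ≤ m₂) : nullAug ν m₁ ≤ nullAug ν m₂ :=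
  fun _ ⟨t, ht, hst⟩ => ⟨t, h _ ht, hst⟩

theorem eqModNull_iff {m₁ m₂ : MeasurableSpace Y} :
    @EqModNull _ mY ν m₁ m₂ ↔ m₁ ≤ nullAug ν m₂ ∧ m₂ ≤ nullAug ν m₁ := Iff.rfl

theorem measurableSet_nullAug_of_aestronglyMeasurable {m : MeasurableSpace Y} {E : Set Y}
    (h : AEStronglyMeasurable[m] (E.indicator fun _ => (1 : ℂ)) ν) :
    MeasurableSet[nullAug ν m] E := by
  refine ⟨h.mk _ ⁻¹' {1}, h.stronglyMeasurable_mk.measurable (measurableSet_singleton 1), ?_⟩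
  refine eventuallyEq_set.2 ?_
  filter_upwards [h.ae_eq_mk] with y hy
  rw [Set.mem_preimage, ← hy]
  by_cases hE : y ∈ E <;> simp [hE]

end NullAugmentation

/-! ### Invariance and countable generation of the box factor. -/

section BoxFactor

variable {X : Type*} [mX : MeasurableSpace X] {μ : Measure X} {s : ℕ} {R : Fin s → X ≃ᵐ X}

theorem dualAverage_comp {Q : X ≃ᵐ X} (hc : ∀ i x, R i (Q x) = Q (R i x))
    (f : (Fin s → Fin 2) → X → ℂ) (H : ℕ) (x : X) :
    dualAverage R (fun ε => f ε ∘ Q) H x = dualAverage R f H (Q x) := by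
  have : ∀ k : Fin s → ℕ, cubePoint R k (Q x) = Q (cubePoint R k x) := fun k =>
    cubePoint_comm hc k 1 x
  simp only [dualAverage, Function.comp, this]

theorem IsDualFunction.comp {Q : X ≃ᵐ X} (hQ : MeasurePreserving Q μ μ)
    (hc : ∀ i x, R i (Q x) = Q (R i x)) (hR : ∀ i, MeasurePreserving (R i) μ μ) {g : Lp ℂ 2 μ}
    (hg : IsDualFunction μ R g) : IsDualFunction μ R (Lp.compMeasurePreserving Q hQ g) := by
  obtain ⟨f, hf, hlim⟩ := hg
  refine ⟨fun ε => f ε ∘ Q, fun ε => (hf ε).comp_measurePreserving hQ, hlim.congr fun H => ?_⟩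
  have hm : AEStronglyMeasurable (fun x => dualAverage R f H x - g x) μ := by
    refine AEStronglyMeasurable.sub ?_ (Lp.aestronglyMeasurable g)
    unfold dualAverage
    refine AEStronglyMeasurable.const_mul ?_ _
    refine Finset.aestronglyMeasurable_fun_sum _ fun h _ =>
      Finset.aestronglyMeasurable_fun_prod _ fun ε _ => ?_
    have h1 := (hf ε).1.comp_measurePreserving (measurePreserving_cubePoint hR
      fun i => (ε i : ℕ) * h i)
    exact ((Complex.continuous_conj.iterate _).comp_aestronglyMeasurable h1)
  rw [← eLpNorm_comp_measurePreserving hm hQ]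
  refine eLpNorm_congr_ae ?_
  filter_upwards [Lp.coeFn_compMeasurePreserving g hQ] with x hx
  simp only [Function.comp] at hx ⊢
  rw [hx]
  congr 1
  exact (dualAverage_comp hc f H x).symm

/-- A map commuting with all R i takes the dual function of (f_ε) to that of (f_ε ∘ Q), and closed
spans follow. The orbit coding thus stays inside the box factor. -/
theorem compMeasurePreserving_mem_boxSpace {Q : X ≃ᵐ X} (hQ : MeasurePreserving Q μ μ)
    (hc : ∀ i x, R i (Q x) = Q (R i x)) (hR : ∀ i, MeasurePreserving (R i) μ μ) {g : Lp ℂ 2 μ}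
    (hg : g ∈ boxSpace μ R) : Lp.compMeasurePreserving Q hQ g ∈ boxSpace μ R := by
  have hle : boxSpace μ R ≤ (boxSpace μ R).comap
      (Lp.compMeasurePreservingₗᵢ ℂ Q hQ).toLinearMap := by
    refine Submodule.topologicalClosure_minimal _ (Submodule.span_le.2 fun D hD => ?_) ?_
    · exact Submodule.le_topologicalClosure _ (Submodule.subset_span (hD.comp hQ hc hR))
    · exact (Submodule.isClosed_topologicalClosure _).preimage
        (Lp.compMeasurePreservingₗᵢ ℂ Q hQ).continuous
  exact hle hg

variable [IsFiniteMeasure μ]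

/-- The generating sets of the box factor. -/
def IsBoxSet (μ : Measure X) [IsFiniteMeasure μ] (R : Fin s → X ≃ᵐ X) (E : Set X) : Prop :=
  ∃ hE : MeasurableSet E, indicatorConstLp 2 hE (measure_ne_top μ E) (1 : ℂ) ∈ boxSpace μ R

theorem IsBoxSet.measurableSet_boxFactor {E : Set X} (hE : IsBoxSet μ R E) :
    MeasurableSet[boxFactor μ R] E := MeasurableSpace.measurableSet_generateFrom hE

theorem boxFactor_le (μ : Measure X) [IsFiniteMeasure μ] (R : Fin s → X ≃ᵐ X) :
    boxFactor μ R ≤ mX := MeasurableSpace.generateFrom_le fun _ hE => hE.1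

theorem IsBoxSet.preimage {E : Set X} (hE : IsBoxSet μ R E) {Q : X ≃ᵐ X}
    (hQ : MeasurePreserving Q μ μ) (hc : ∀ i x, R i (Q x) = Q (R i x))
    (hR : ∀ i, MeasurePreserving (R i) μ μ) : IsBoxSet μ R (Q ⁻¹' E) := by
  obtain ⟨hEm, hE⟩ := hE
  refine ⟨Q.measurable hEm, ?_⟩
  have h := compMeasurePreserving_mem_boxSpace hQ hc hR hE
  rwa [Lp.indicatorConstLp_compMeasurePreserving] at h

/-- Countably many sets generate the box factor up to null sets. -/
theorem exists_seq_isBoxSet [IsSeparable μ] (R : Fin s → X ≃ᵐ X) :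
    ∃ E : ℕ → Set X, (∀ j, IsBoxSet μ R (E j)) ∧
      boxFactor μ R ≤ nullAug μ (MeasurableSpace.generateFrom (Set.range E)) := by
  have : Fact ((2 : ℝ≥0∞) ≠ ∞) := ⟨by norm_num⟩
  -- L² is separable, so countably many of the admissible indicators are dense among them.
  -- Measurability modulo null sets is closed in L², so it passes to all admissible sets.
  set G : Set (Lp ℂ 2 μ) := {u | ∃ E, ∃ hE : MeasurableSet E,
    u = indicatorConstLp 2 hE (measure_ne_top μ E) (1 : ℂ) ∧ u ∈ boxSpace μ R} with hG
  have hne : Nonempty G := ⟨⟨0, ∅, MeasurableSet.empty, by rw [indicatorConstLp_empty],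
    Submodule.zero_mem _⟩⟩
  obtain ⟨u, hu⟩ := TopologicalSpace.exists_dense_seq G
  choose E hE hEu hmem using fun j => (u j).2
  have hgen : ∀ j, IsBoxSet μ R (E j) := fun j => ⟨hE j, by rw [← hEu]; exact hmem j⟩
  refine ⟨E, hgen, MeasurableSpace.generateFrom_le ?_⟩
  rintro F ⟨hF, hFbox⟩
  set m := MeasurableSpace.generateFrom (Set.range E) with hm
  have hmle : m ≤ mX := MeasurableSpace.generateFrom_le (by rintro _ ⟨j, rfl⟩; exact hE j)
  refine measurableSet_nullAug_of_aestronglyMeasurable ?_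
  have hind : ∀ {A : Set X} (hA : MeasurableSet[mX] A),
      AEStronglyMeasurable[m] (indicatorConstLp 2 hA (measure_ne_top μ A) (1 : ℂ)) μ ↔
        AEStronglyMeasurable[m] (A.indicator fun _ => (1 : ℂ)) μ := fun hA =>
    aestronglyMeasurable_congr indicatorConstLp_coeFn
  rw [← hind hF]
  exact hu.induction_on (p := fun f : G => AEStronglyMeasurable[m] (f : Lp ℂ 2 μ) μ)
    ⟨_, F, hF, rfl, hFbox⟩
    ((isClosed_aestronglyMeasurable hmle).preimage continuous_subtype_val) fun j => by
      rw [hEu j, hind]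
      exact ((@stronglyMeasurable_const X ℂ m _ 1).indicator
        (MeasurableSpace.measurableSet_generateFrom ⟨j, rfl⟩)).aestronglyMeasurable

end BoxFactor

/-! ### Realisation of the box factor on the shift space. -/

section Realisation

variable {ℓ : ℕ} {X : Type*} [mX : MeasurableSpace X] {μ : Measure X} {T : Fin ℓ → X ≃ᵐ X}

theorem isSystem_map_coding (hT : IsSystem μ T) {g : ℕ → X → ℂ} (hg : ∀ j, Measurable (g j)) :
    IsSystem (μ.map (coding hT.commute g)) (shiftGen (ℓ := ℓ)) where
  commute _ _ ω := zshift_commute _ _ ω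
  measurePreserving i := measurePreserving_of_semiconj (measurable_coding _ hg)
    (hT.measurePreserving i) (shiftGen i).measurable (coding_apply hT.commute g i)

theorem isFactorMap_coding (hT : IsSystem μ T) {g : ℕ → X → ℂ} (hg : ∀ j, Measurable (g j)) :
    IsFactorMap μ T (μ.map (coding hT.commute g)) shiftGen (coding hT.commute g) where
  measurePreserving := (measurable_coding _ hg).measurePreserving μ
  equivariant i := Eventually.of_forall (coding_apply hT.commute g i)

theorem IsJointlyErgodic.map_coding (hT : IsSystem μ T) (hErg : IsJointlyErgodic μ T)
    {g : ℕ → X → ℂ} (hg : ∀ j, Measurable (g j)) :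
    IsJointlyErgodic (μ.map (coding hT.commute g)) (shiftGen (ℓ := ℓ)) := by
  intro E hE hinv
  have hm := measurable_coding hT.commute hg
  rw [Measure.map_apply hm hE]
  refine hErg _ (hm hE) fun i => ?_
  conv_rhs => rw [← hinv i]
  ext x
  simp only [Set.mem_preimage, coding_apply]

/-- The factor generated by the orbits of countably many generating sets of the box factor. -/
theorem eqModNull_comap_coding [IsFiniteMeasure μ] (hT : IsSystem μ T) {s : ℕ}
    {R : Fin s → X ≃ᵐ X} (hR : ∀ i, MeasurePreserving (R i) μ μ)
    (hRT : ∀ i j x, R i (T j x) = T j (R i x)) {E : ℕ → Set X} (hE : ∀ j, IsBoxSet μ R (E j))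
    (hgen : boxFactor μ R ≤ nullAug μ (MeasurableSpace.generateFrom (Set.range E))) :
    EqModNull μ (MeasurableSpace.comap
      (coding hT.commute fun j => (E j).indicator fun _ => (1 : ℂ)) inferInstance)
      (boxFactor μ R) := by
  set p := coding hT.commute fun j => (E j).indicator fun _ => (1 : ℂ) with hp
  have hRz : ∀ n i x, R i (zact hT.commute n x) = zact hT.commute n (R i x) := fun n i x =>
    map_zact hT.commute hT.commute (fun j y => hRT i j y) n x
  refine eqModNull_iff.2 ⟨le_trans (Measurable.comap_le ?_) le_nullAug,
    hgen.trans (nullAug_mono (MeasurableSpace.generateFrom_le ?_))⟩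
  -- Each coordinate of the coding is the indicator of a translate of some E j, and translates of
  -- box sets are box sets.
  · refine @measurable_pi_lambda _ _ _ (_) _ _ fun n => @measurable_pi_lambda _ _ _ (_) _ _ fun j =>
      ?_
    have h1 := ((hE j).preimage (measurePreserving_zact hT.commute hT.measurePreserving n) (hRz n)
      hR).measurableSet_boxFactor
    have h2 : Measurable[boxFactor μ R] ((zact hT.commute n ⁻¹' E j).indicator fun _ => (1 : ℂ)) :=
      Measurable.indicator (@measurable_const _ _ _ (boxFactor μ R) _) h1
    exact h2
  · rintro _ ⟨j, rfl⟩
    refine ⟨{ω | ω 1 j = 1}, measurableSet_eq_fun (by fun_prop) measurable_const, ?_⟩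
    ext x
    by_cases hx : x ∈ E j <;> simp [hp, coding, zact_one, hx]

end Realisation

theorem measurable_real_of_Iic {Y : Type*} {m : MeasurableSpace Y} {f : Y → ℝ}
    (h : ∀ t, MeasurableSet[m] {y | f y ≤ t}) : Measurable[m] f := measurable_of_Iic h

/-! ### Generalised eigenfunctions are measurable for the degree one Host–Kra factor. -/

section EigenfunctionsAreDual

variable {Y : Type*} [mY : MeasurableSpace Y] {ν : Measure Y} {S : Y ≃ᵐ Y} {f g : Y → ℂ}

theorem IsEig.mul (hf : IsEig ν S f) (hg : IsEig ν S g) : IsEig ν S (f * g) where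
  measurable := hf.measurable.mul hg.measurable
  ae_norm := by
    filter_upwards [hf.ae_norm, hg.ae_norm] with y h1 h2
    rw [Pi.mul_apply, norm_mul]
    rcases h1 with h1 | h1 <;> rcases h2 with h2 | h2 <;> simp [h1, h2]
  ae_norm_comp := by
    filter_upwards [hf.ae_norm_comp, hg.ae_norm_comp] with y h1 h2
    rw [Pi.mul_apply, Pi.mul_apply, norm_mul, norm_mul, h1, h2]
  ae_eigenvalue := by
    filter_upwards [hf.ae_eigenvalue, hg.ae_eigenvalue] with y h1 h2
    simp only [Pi.mul_apply, map_mul]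
    linear_combination (g (S (S y)) * conj (g (S y))) * h1 + (f (S y) * conj (f y)) * h2

theorem IsEig.conj (hg : IsEig ν S g) : IsEig ν S fun y => conj (g y) where
  measurable := Complex.continuous_conj.measurable.comp hg.measurable
  ae_norm := by simpa only [RCLike.norm_conj] using hg.ae_norm
  ae_norm_comp := by simpa only [RCLike.norm_conj] using hg.ae_norm_comp
  ae_eigenvalue := by
    filter_upwards [hg.ae_eigenvalue] with y h
    simp only [← map_mul, h]

theorem isEig_const {c : ℂ} (hc : ‖c‖ = 1) : IsEig ν S fun _ => c where
  measurable := measurable_const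
  ae_norm := Eventually.of_forall fun _ => Or.inr hc
  ae_norm_comp := Eventually.of_forall fun _ => rfl
  ae_eigenvalue := Eventually.of_forall fun _ => rfl

/-- The eigenvalue g(Sy) · conj g(y) is constant along the orbit. If g vanishes at a point it
vanishes along the forward orbit, because |g| is invariant. -/
theorem IsEig.ae_iterate (hS : MeasurePreserving S ν ν) (hg : IsEig ν S g) :
    ∀ᵐ y ∂ν, ∀ n, g (S^[n] y) = (g (S y) * conj (g y)) ^ n * g y := by
  have h : ∀ n : ℕ, ∀ᵐ y ∂ν, (‖g (S^[n] y)‖ = 0 ∨ ‖g (S^[n] y)‖ = 1) ∧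
      ‖g (S (S^[n] y))‖ = ‖g (S^[n] y)‖ ∧
      g (S (S (S^[n] y))) * conj (g (S (S^[n] y))) = g (S (S^[n] y)) * conj (g (S^[n] y)) :=
    fun n => (hS.iterate n).quasiMeasurePreserving.ae
      (hg.ae_norm.and (hg.ae_norm_comp.and hg.ae_eigenvalue))
  filter_upwards [ae_all_iff.2 h] with y hy
  have hu : ∀ n, g (S (S^[n] y)) * conj (g (S^[n] y)) = g (S y) * conj (g y) := by
    intro n
    induction n with
    | zero => rfl
    | succ n ih => rw [Function.iterate_succ_apply', (hy n).2.2, ih]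
  intro n
  induction n with
  | zero => simp
  | succ n ih =>
    have h1 : g (S (S^[n] y)) = g (S (S^[n] y)) * conj (g (S^[n] y)) * g (S^[n] y) := by
      rcases (hy n).1 with h0 | h0
      · have h2 : g (S (S^[n] y)) = 0 := by rw [← norm_eq_zero, (hy n).2.1, h0]
        rw [h2]; simp
      · rw [mul_assoc, mul_comm (conj _), Complex.mul_conj, Complex.normSq_eq_norm_sq, h0]; simp
    rw [Function.iterate_succ_apply', h1, hu, ih, pow_succ]
    ring

theorem cubePoint_pair (S : Y ≃ᵐ Y) (k : Fin 2 → ℕ) (y : Y) :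
    cubePoint (fun _ : Fin 2 => S) k y = S^[k 0 + k 1] y := by
  rw [cubePoint_succ, cubePoint_succ, cubePoint_nil]
  rw [Function.iterate_add_apply]
  rfl

theorem filter_ne_zero_pair : (Finset.univ.filter fun ε : Fin 2 → Fin 2 => ε ≠ 0) =
    {![1, 0], ![0, 1], ![1, 1]} := by decide

/-- With u the eigenvalue, the three vertices contribute conj(u^{h₀} g), conj(u^{h₁} g) and
u^{h₀+h₁} g. The powers of u cancel, so every term of the average already equals conj g. -/
theorem IsEig.ae_dualAverage (hS : MeasurePreserving S ν ν) (hg : IsEig ν S g) :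
    ∀ᵐ y ∂ν, ∀ H > 0, dualAverage (fun _ : Fin 2 => S) (fun _ => g) H y = conj (g y) := by
  filter_upwards [hg.ae_iterate hS, hg.ae_norm, hg.ae_norm_comp] with y hy h0 h1 H hH
  have hterm : ∀ h : Fin 2 → ℕ, ∏ ε ∈ Finset.univ.filter (fun ε : Fin 2 → Fin 2 => ε ≠ 0),
      (starRingEnd ℂ)^[∑ i, (ε i : ℕ)] (g (cubePoint (fun _ : Fin 2 => S)
        (fun i => (ε i : ℕ) * h i) y)) = conj (g y) := by
    intro h
    rw [filter_ne_zero_pair, Finset.prod_insert (by decide), Finset.prod_insert (by decide),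
      Finset.prod_singleton]
    simp only [cubePoint_pair, Fin.sum_univ_two, hy]
    have hc2 : ∀ z : ℂ, (starRingEnd ℂ)^[1 + 1] z = z := Complex.conj_conj
    simp only [Matrix.cons_val_zero, Matrix.cons_val_one, Fin.val_zero, Fin.val_one, zero_mul,
      one_mul, add_zero, zero_add, Function.iterate_one, hc2]
    rcases h0 with h0 | h0
    · rw [norm_eq_zero] at h0; simp [h0]
    · have e1 : g y * conj (g y) = 1 := by
        rw [Complex.mul_conj, Complex.normSq_eq_norm_sq, h0]; simp
      have e2 : g (S y) * conj (g (S y)) = 1 := by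
        rw [Complex.mul_conj, Complex.normSq_eq_norm_sq, h1, h0]; simp
      set u := g (S y) * conj (g y) with hu
      have e3 : conj u * u = 1 := by
        rw [hu, map_mul, Complex.conj_conj]
        linear_combination (g y * conj (g y)) * e2 + e1
      have e4 : ∀ k : ℕ, conj u ^ k * u ^ k = 1 := fun k => by rw [← mul_pow, e3, one_pow]
      simp only [map_mul, map_pow]
      rw [pow_add]
      linear_combination (conj (g y) * (g y * conj (g y)) * (conj u ^ (h 1) * u ^ (h 1))) * e4 (h 0) +
        (conj (g y) * (g y * conj (g y))) * e4 (h 1) + conj (g y) * e1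
  rw [dualAverage]
  simp only [hterm]
  rw [Finset.sum_const, Fintype.card_piFinset]
  simp only [Nat.card_Icc, add_tsub_cancel_right, Finset.prod_const, Finset.card_univ,
    Fintype.card_fin, nsmul_eq_mul, Nat.cast_pow]
  have : (H : ℂ) ≠ 0 := by exact_mod_cast hH.ne'
  field_simp

theorem IsEig.ae_norm_le (hg : IsEig ν S g) : ∀ᵐ y ∂ν, ‖g y‖ ≤ 1 := by
  filter_upwards [hg.ae_norm] with y h
  rcases h with h | h <;> simp [h]

variable (ν S) in
/-- Functions whose class belongs to the box space `Z(S, S)`. -/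
def boxFun : Submodule ℂ (Y → ℂ) where
  carrier := {u | ∃ hu : MemLp u 2 ν, hu.toLp u ∈ boxSpace ν fun _ : Fin 2 => S}
  add_mem' := fun ⟨hu, hu'⟩ ⟨hv, hv'⟩ => ⟨hu.add hv, by
    rw [MemLp.toLp_add hu hv]; exact Submodule.add_mem _ hu' hv'⟩
  zero_mem' := ⟨MemLp.zero, by rw [MemLp.toLp_zero]; exact Submodule.zero_mem _⟩
  smul_mem' := fun c u ⟨hu, hu'⟩ => ⟨hu.const_smul c, by
    rw [MemLp.toLp_const_smul c hu]; exact Submodule.smul_mem _ c hu'⟩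

theorem IsEig.mem_boxFun [IsFiniteMeasure ν] (hS : MeasurePreserving S ν ν) (hg : IsEig ν S g) :
    g ∈ boxFun ν S := by
  have hmem : MemLp g 2 ν := MemLp.of_bound hg.measurable.aestronglyMeasurable 1 hg.ae_norm_le
  refine ⟨hmem, Submodule.le_topologicalClosure _ (Submodule.subset_span
    ⟨fun _ y => conj (g y), fun _ => memLp_top_of_bound
      hg.conj.measurable.aestronglyMeasurable 1 hg.conj.ae_norm_le, ?_⟩)⟩
  refine tendsto_const_nhds.congr' ?_
  filter_upwards [eventually_gt_atTop 0] with H hH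
  rw [← eLpNorm_zero (μ := ν) (p := 2) (ε := ℂ)]
  refine eLpNorm_congr_ae ?_
  filter_upwards [hg.conj.ae_dualAverage hS, hmem.coeFn_toLp] with y h1 h2
  rw [h1 H hH, h2, Complex.conj_conj, sub_self]; rfl

/-- Bounded pointwise limits of functions in the box space are in the box space. -/
theorem boxFun_of_tendsto [IsFiniteMeasure ν] {u : ℕ → Y → ℂ} {v : Y → ℂ}
    (hu : ∀ k, u k ∈ boxFun ν S) (hv : AEStronglyMeasurable v ν) {C : ℝ}
    (hC : ∀ k, ∀ᵐ y ∂ν, ‖u k y‖ ≤ C) (hlim : ∀ᵐ y ∂ν, Tendsto (fun k => u k y) atTop (𝓝 (v y))) :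
    v ∈ boxFun ν S := by
  have hvb : ∀ᵐ y ∂ν, ‖v y‖ ≤ C := by
    filter_upwards [ae_all_iff.2 hC, hlim] with y h1 h2
    exact le_of_tendsto h2.norm (Eventually.of_forall h1)
  have hvm : MemLp v 2 ν := MemLp.of_bound hv C hvb
  choose hum hub using hu
  refine ⟨hvm, (Submodule.isClosed_topologicalClosure _).mem_of_tendsto (b := atTop)
    (f := fun k => (hum k).toLp (u k)) ?_ (Eventually.of_forall hub)⟩
  rw [Lp.tendsto_Lp_iff_tendsto_eLpNorm']
  have e : ∀ k, eLpNorm (⇑((hum k).toLp (u k)) - ⇑(hvm.toLp v)) 2 ν =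
      (∫⁻ y, ‖u k y - v y‖ₑ ^ (2 : ℝ) ∂ν) ^ (1 / 2 : ℝ) := by
    intro k
    rw [eLpNorm_eq_lintegral_rpow_enorm_toReal (by norm_num) (by norm_num)]
    simp only [ENNReal.toReal_ofNat]
    congr 1
    refine lintegral_congr_ae ?_
    filter_upwards [(hum k).coeFn_toLp, hvm.coeFn_toLp] with y h1 h2
    rw [Pi.sub_apply, h1, h2]
  simp only [e]
  have h0 : Tendsto (fun k => ∫⁻ y, ‖u k y - v y‖ₑ ^ (2 : ℝ) ∂ν) atTop (𝓝 0) := by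
    have h1 := tendsto_lintegral_of_dominated_convergence' (μ := ν)
      (F := fun k y => ‖u k y - v y‖ₑ ^ (2 : ℝ)) (f := fun _ => 0)
      (fun _ => ENNReal.ofReal (2 * C) ^ (2 : ℝ))
      (fun k => ((hum k).1.sub hv).enorm.pow_const _) (fun k => ?_) ?_ ?_
    · simpa using h1
    · filter_upwards [hC k, hvb] with y h1 h2
      refine ENNReal.rpow_le_rpow ?_ (by norm_num)
      rw [← ofReal_norm]
      exact ENNReal.ofReal_le_ofReal ((norm_sub_le _ _).trans (by linarith))
    · rw [lintegral_const]
      exact ENNReal.mul_ne_top (ENNReal.rpow_ne_top_of_nonneg (by norm_num) ENNReal.ofReal_ne_top)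
        (measure_ne_top _ _)
    · filter_upwards [hlim] with y hy
      have h2 : Tendsto (fun k => ‖u k y - v y‖ₑ) atTop (𝓝 0) := by
        have := (hy.sub_const (v y)).enorm
        simpa using this
      have := h2.ennrpow_const (2 : ℝ)
      simpa using this
  have := h0.ennrpow_const (1 / 2 : ℝ)
  simpa using this

variable (ν S) in
/-- The multiplicative monoid of generalised eigenfunctions. -/
def eigMonoid : Submonoid (Y → ℂ) where
  carrier := {g | IsEig ν S g}
  mul_mem' := IsEig.mul
  one_mem' := isEig_const (c := 1) norm_one

/-- Eigenfunctions are closed under multiplication, so the algebra they generate is just their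
linear span. -/
theorem adjoin_le_boxFun [IsFiniteMeasure ν] (hS : MeasurePreserving S ν ν) {u : Y → ℂ}
    (hu : u ∈ Algebra.adjoin ℂ (eigMonoid ν S : Set (Y → ℂ))) : u ∈ boxFun ν S := by
  have h1 : u ∈ Subalgebra.toSubmodule (Algebra.adjoin ℂ (eigMonoid ν S : Set (Y → ℂ))) := hu
  rw [Algebra.adjoin_eq_span, Submonoid.closure_eq] at h1
  exact Submodule.span_le.2 (fun g (hg : IsEig ν S g) => hg.mem_boxFun hS) h1

theorem IsEig.polynomial_mem_boxFun [IsFiniteMeasure ν] (hS : MeasurePreserving S ν ν)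
    (hg : IsEig ν S g) (p : Polynomial ℝ) :
    (fun y => ((p.eval (g y).re : ℝ) : ℂ)) ∈ boxFun ν S := by
  set A := Algebra.adjoin ℂ (eigMonoid ν S : Set (Y → ℂ)) with hA
  refine adjoin_le_boxFun hS ?_
  have hre : (fun y => ((g y).re : ℂ)) ∈ A := by
    have h1 : g ∈ A := Algebra.subset_adjoin hg
    have h2 : (fun y => conj (g y)) ∈ A := Algebra.subset_adjoin hg.conj
    have h3 := A.smul_mem (A.add_mem h1 h2) (1 / 2 : ℂ)
    convert h3 using 1
    ext y
    simp only [Pi.smul_apply, Pi.add_apply, smul_eq_mul, Complex.re_eq_add_conj]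
    ring
  induction p using Polynomial.induction_on' with
  | add p q hp hq =>
    convert A.add_mem hp hq using 1
    ext y; simp
  | monomial n c =>
    convert A.smul_mem (A.pow_mem hre n) (c : ℂ) using 1
    ext y; simp [Polynomial.eval_monomial]

/-- The box factor is generated by sets whose indicators lie in the box space, so having g in that
space is not enough. Polynomials in Re g lie in it, and they approximate the indicator of a sublevel
set boundedly and pointwise. -/
theorem IsEig.isBoxSet [IsFiniteMeasure ν] (hS : MeasurePreserving S ν ν) (hg : IsEig ν S g)
    (t : ℝ) : IsBoxSet ν (fun _ : Fin 2 => S) {y | (g y).re ≤ t} := by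
  have hE : MeasurableSet {y | (g y).re ≤ t} :=
    measurableSet_le (Complex.measurable_re.comp hg.measurable) measurable_const
  -- For k > 0, φ k is 1 up to t and falls linearly to 0 at t + 1/k. Weierstrass replaces it on [-1,
  -- 1], which contains the values of Re g, by a polynomial with error 1/(k + 1).
  set φ : ℕ → ℝ → ℝ := fun k x => max 0 (min 1 (1 - k * (x - t))) with hφ
  have hφc : ∀ k, ContinuousOn (φ k) (Set.Icc (-1) 1) := fun k => by
    simp only [hφ]; fun_prop
  choose p hp using fun k : ℕ => exists_polynomial_near_of_continuousOn (-1) 1 (φ k) (hφc k)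
    (1 / ((k : ℝ) + 1)) Nat.one_div_pos_of_nat
  have hgre : ∀ᵐ y ∂ν, (g y).re ∈ Set.Icc (-1 : ℝ) 1 := by
    filter_upwards [hg.ae_norm_le] with y hy
    exact abs_le.1 ((Complex.abs_re_le_norm _).trans hy)
  have hφb : ∀ k x, 0 ≤ φ k x ∧ φ k x ≤ 1 := fun k x =>
    ⟨le_max_left _ _, max_le zero_le_one (min_le_left _ _)⟩
  have hmem : ({y | (g y).re ≤ t}.indicator fun _ => (1 : ℂ)) ∈ boxFun ν S := by
    refine boxFun_of_tendsto (C := 2) (u := fun k y => (((p k).eval (g y).re : ℝ) : ℂ))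
      (fun k => hg.polynomial_mem_boxFun hS (p k))
      (measurable_const.indicator hE).aestronglyMeasurable (fun k => ?_) ?_
    · filter_upwards [hgre] with y hy
      rw [Complex.norm_real, Real.norm_eq_abs]
      have h1 := hp k _ hy
      have h2 : (1 : ℝ) / ((k : ℝ) + 1) ≤ 1 := by
        rw [div_le_one (by positivity)]; linarith [(Nat.cast_nonneg k : (0 : ℝ) ≤ k)]
      have h3 := hφb k (g y).re
      rw [abs_lt] at h1
      rw [abs_le]
      constructor <;> linarith [h1.1, h1.2]
    · filter_upwards [hgre] with y hy
      have h1 : Tendsto (fun k => (p k).eval (g y).re - φ k (g y).re) atTop (𝓝 0) := by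
        refine squeeze_zero_norm (fun k => ?_) tendsto_one_div_add_atTop_nhds_zero_nat
        exact (hp k _ hy).le
      have h2 : Tendsto (fun k => φ k (g y).re) atTop
          (𝓝 (if (g y).re ≤ t then 1 else 0)) := by
        split_ifs with h
        · refine tendsto_const_nhds.congr fun k => ?_
          have : (k : ℝ) * ((g y).re - t) ≤ 0 :=
            mul_nonpos_of_nonneg_of_nonpos (Nat.cast_nonneg k) (by linarith)
          simp only [hφ]
          rw [min_eq_left (by linarith), max_eq_right zero_le_one]
        · push Not at h
          obtain ⟨n, hn⟩ := exists_nat_gt (1 / ((g y).re - t))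
          refine tendsto_const_nhds.congr' ?_
          filter_upwards [eventually_ge_atTop n] with k hk
          have h3 : (1 : ℝ) < n * ((g y).re - t) := by
            rwa [div_lt_iff₀ (by linarith)] at hn
          have h4 : (n : ℝ) * ((g y).re - t) ≤ k * ((g y).re - t) := by
            have : (n : ℝ) ≤ k := by exact_mod_cast hk
            exact mul_le_mul_of_nonneg_right this (by linarith)
          simp only [hφ]
          rw [max_eq_left]
          exact (min_le_right _ _).trans (by linarith)
      have h3 := h1.add h2
      simp only [sub_add_cancel, zero_add] at h3
      have h4 := (Complex.continuous_ofReal.tendsto _).comp h3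
      by_cases h : (g y).re ≤ t
      · rw [if_pos h] at h4
        rw [Set.indicator_of_mem (show y ∈ {y | (g y).re ≤ t} from h)]; simpa [Function.comp_def] using h4
      · rw [if_neg h] at h4
        rw [Set.indicator_of_notMem (show y ∉ {y | (g y).re ≤ t} from h)]; simpa [Function.comp_def] using h4
  obtain ⟨h1, h2⟩ := hmem
  refine ⟨hE, ?_⟩
  exact h2

/-- The imaginary part of g is the real part of -i g, again an eigenfunction. -/
theorem IsEig.measurable_hostKra [IsFiniteMeasure ν] (hS : MeasurePreserving S ν ν)
    (hg : IsEig ν S g) : Measurable[hostKraFactorOne ν S] g := by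
  have hre : ∀ {f : Y → ℂ}, IsEig ν S f → Measurable[hostKraFactorOne ν S] fun y => (f y).re :=
    fun hf => measurable_real_of_Iic fun t =>
      (hf.isBoxSet hS t).measurableSet_boxFactor
  have h1 := hre hg
  have h2 := hre ((isEig_const (c := -Complex.I) (by simp)).mul hg)
  have e : g = fun y => (((g y).re : ℂ)) +
      ((((fun _ => -Complex.I) * g : Y → ℂ) y).re : ℂ) * Complex.I := by
    ext y
    simp [Complex.re_add_im]
  rw [e]
  exact (Complex.measurable_ofReal.comp h1).add ((Complex.measurable_ofReal.comp h2).mul_const _)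

end EigenfunctionsAreDual

/-! ### Reduction to countably many generating functions. -/

section CountableGeneration

/-- A set in a generated σ-algebra depends only on countably many generating functions. -/
theorem exists_countable_measurableSet_iSup_comap {Y : Type*} {𝒢 : Set (Y → ℂ)} {E : Set Y}
    (hE : MeasurableSet[⨆ g ∈ 𝒢, MeasurableSpace.comap g inferInstance] E) :
    ∃ G ⊆ 𝒢, G.Countable ∧ MeasurableSet[⨆ g ∈ G, MeasurableSpace.comap g inferInstance] E := by
  set m : MeasurableSpace Y :=
    { MeasurableSet' := fun E => ∃ G ⊆ 𝒢, G.Countable ∧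
        MeasurableSet[⨆ g ∈ G, MeasurableSpace.comap g inferInstance] E
      measurableSet_empty := ⟨∅, Set.empty_subset _, Set.countable_empty,
        @MeasurableSet.empty _ (_)⟩
      measurableSet_compl := fun E ⟨G, h1, h2, h3⟩ => ⟨G, h1, h2, @MeasurableSet.compl _ _ (_) h3⟩
      measurableSet_iUnion := fun f hf => by
        choose G h1 h2 h3 using hf
        refine ⟨⋃ i, G i, Set.iUnion_subset h1, Set.countable_iUnion h2,
          @MeasurableSet.iUnion _ _ (_) _ _ fun i => ?_⟩
        have hle : ⨆ g ∈ G i, MeasurableSpace.comap g inferInstance ≤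
            ⨆ g ∈ ⋃ i, G i, MeasurableSpace.comap g inferInstance :=
          biSup_mono fun g hg => Set.mem_iUnion_of_mem i hg
        exact hle _ (h3 i) } with hm
  have hle : ⨆ g ∈ 𝒢, MeasurableSpace.comap g inferInstance ≤ m := by
    refine iSup₂_le fun g hg F hF => ⟨{g}, Set.singleton_subset_iff.2 hg,
      Set.countable_singleton g, ?_⟩
    rw [iSup_singleton]
    exact hF
  exact hle _ hE

theorem exists_seq_measurableSet_iSup_comap {Y : Type*} {𝒢 : Set (Y → ℂ)} (hne : 𝒢.Nonempty)
    {B : ℕ → Set Y}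
    (hB : ∀ j, MeasurableSet[⨆ g ∈ 𝒢, MeasurableSpace.comap g inferInstance] (B j)) :
    ∃ g : ℕ → Y → ℂ, (∀ k, g k ∈ 𝒢) ∧
      ∀ j, MeasurableSet[⨆ k, MeasurableSpace.comap (g k) inferInstance] (B j) := by
  choose G h1 h2 h3 using fun j => exists_countable_measurableSet_iSup_comap (hB j)
  obtain ⟨g₀, hg₀⟩ := hne
  obtain ⟨g, hg⟩ := ((Set.countable_iUnion h2).insert g₀).exists_eq_range (Set.insert_nonempty _ _)
  have hmem : ∀ k, g k ∈ 𝒢 := fun k => by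
    have : g k ∈ insert g₀ (⋃ j, G j) := hg ▸ Set.mem_range_self k
    rcases this with h | h
    · rw [h]; exact hg₀
    · obtain ⟨j, hj⟩ := Set.mem_iUnion.1 h
      exact h1 j hj
  refine ⟨g, hmem, fun j => ?_⟩
  have hle : ⨆ f ∈ G j, MeasurableSpace.comap f inferInstance ≤
      ⨆ k, MeasurableSpace.comap (g k) inferInstance := by
    refine iSup₂_le fun f hf => ?_
    have : f ∈ Set.range g := hg ▸ Or.inr (Set.mem_iUnion_of_mem j hf)
    obtain ⟨k, rfl⟩ := this
    exact le_iSup (fun k => MeasurableSpace.comap (g k) inferInstance) k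
  exact hle _ (h3 j)

variable {ι Y : Type*} [mY : MeasurableSpace Y]

/-- The functions generating the structured σ-algebra: invariant functions and generalised
eigenfunctions. -/
def structGen (ν : Measure Y) (S : ι → Y ≃ᵐ Y) (L : List ι) (a : ι) : Set (Y → ℂ) :=
  {g | Measurable g ∧ ((∃ i ∈ L, ∀ y, g (S i y) = g y) ∨ IsEig ν (S a) g)}

theorem structAlg_le_iSup_comap (ν : Measure Y) (S : ι → Y ≃ᵐ Y) (L : List ι) (a : ι) :
    structAlg ν S L a ≤ ⨆ g ∈ structGen ν S L a, MeasurableSpace.comap g inferInstance := by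
  refine sup_le (iSup₂_le fun i hi E hE => ?_) (iSup_le fun g => ?_)
  · have hEm : MeasurableSet E := hE.1
    have hinv : S i ⁻¹' E = E := hE.2
    have hg : E.indicator (fun _ => (1 : ℂ)) ∈ structGen ν S L a := by
      refine ⟨measurable_const.indicator hEm, Or.inl ⟨i, hi, fun y => ?_⟩⟩
      have : S i y ∈ E ↔ y ∈ E := by rw [← Set.mem_preimage, hinv]
      by_cases h : y ∈ E <;> simp [h, this]
    have hle := le_iSup₂ (f := fun (g : Y → ℂ) (_ : g ∈ structGen ν S L a) =>
      MeasurableSpace.comap g inferInstance) _ hg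
    refine hle _ ⟨{1}, measurableSet_singleton _, ?_⟩
    ext y
    by_cases h : y ∈ E <;> simp [h]
  · exact le_iSup₂ (f := fun (g : Y → ℂ) (_ : g ∈ structGen ν S L a) =>
      MeasurableSpace.comap g inferInstance) g.1 ⟨g.2.measurable, Or.inr g.2⟩

end CountableGeneration

/-! ### Structured functions under image measures and conditional measures. -/

section Transport

variable {Y Z : Type*} [MeasurableSpace Y] [MeasurableSpace Z]

/-- A function that is invariant or a generalised eigenfunction up to null sets. -/
def IsAEStruct {ι : Type*} (ν : Measure Y) (S : ι → Y ≃ᵐ Y) (L : List ι) (a : ι) (g : Y → ℂ) :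
    Prop := (∃ i ∈ L, ∀ᵐ y ∂ν, g (S i y) = g y) ∨ IsEig ν (S a) g

theorem IsEig.map {ν : Measure Y} {S : Y ≃ᵐ Y} {Q : Z ≃ᵐ Z} {Φ : Y → Z} (hΦ : Measurable Φ)
    (h : ∀ y, Φ (S y) = Q (Φ y)) {g : Z → ℂ} (hg : Measurable g)
    (hE : IsEig ν S fun y => g (Φ y)) : IsEig (ν.map Φ) Q g := by
  have hgQ : Measurable fun z => g (Q z) := hg.comp Q.measurable
  have hgQQ : Measurable fun z => g (Q (Q z)) := hgQ.comp Q.measurable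
  have hcm : Measurable (starRingEnd ℂ) := Complex.continuous_conj.measurable
  refine ⟨hg, ?_, ?_, ?_⟩
  · refine (ae_map_iff hΦ.aemeasurable ?_).2 hE.ae_norm
    exact (measurableSet_eq_fun hg.norm measurable_const).union
      (measurableSet_eq_fun hg.norm measurable_const)
  · refine (ae_map_iff hΦ.aemeasurable (measurableSet_eq_fun hgQ.norm hg.norm)).2 ?_
    simpa only [h] using hE.ae_norm_comp
  · have hset : MeasurableSet {z | g (Q (Q z)) * (starRingEnd ℂ) (g (Q z)) =
        g (Q z) * (starRingEnd ℂ) (g z)} :=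
      measurableSet_eq_fun (hgQQ.mul (hcm.comp hgQ)) (hgQ.mul (hcm.comp hg))
    refine (ae_map_iff hΦ.aemeasurable hset).2 ?_
    simpa only [h] using hE.ae_eigenvalue

/-- For a fixed function the conditions are finitely many almost everywhere statements, which pass
to almost every conditional measure. -/
theorem IsAEStruct.ae_condExpKernel {ι κ : Type*} [StandardBorelSpace Y] {ν : Measure Y}
    [IsProbabilityMeasure ν] {S : ι → Y ≃ᵐ Y} {L : List ι} {a : ι} {g : Y → ℂ}
    (hg : IsAEStruct ν S L a g) (Q : κ → Y ≃ᵐ Y) :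
    ∀ᵐ y ∂ν, IsAEStruct (condExpKernel ν (jointInv Q) y) S L a g := by
  rcases hg with ⟨i, hi, h⟩ | h
  · filter_upwards [ae_ae_condExpKernel Q h] with y hy
    exact Or.inl ⟨i, hi, hy⟩
  · filter_upwards [ae_ae_condExpKernel Q h.ae_norm, ae_ae_condExpKernel Q h.ae_norm_comp,
      ae_ae_condExpKernel Q h.ae_eigenvalue] with y h1 h2 h3
    exact Or.inr ⟨h.measurable, h1, h2, h3⟩

theorem IsAEStruct.measurable_nullAug {ι : Type*} {ν : Measure Y} [IsFiniteMeasure ν]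
    {S : ι → Y ≃ᵐ Y} (hS : ∀ i, MeasurePreserving (S i) ν ν) {L : List ι} {a : ι} {g : Y → ℂ}
    (hgm : Measurable g) (hg : IsAEStruct ν S L a g) :
    Measurable[nullAug ν ((⨆ i ∈ L, MeasurableSpace.invariants (S i)) ⊔
      hostKraFactorOne ν (S a))] g := by
  rcases hg with ⟨i, hi, h⟩ | h
  · obtain ⟨u, hu, hgu⟩ := exists_jointInv_ae_eq (S := fun _ : Unit => S i) (fun _ => hS i) hgm
      fun _ => h
    have hle : jointInv (fun _ : Unit => S i) ≤ (⨆ i ∈ L, MeasurableSpace.invariants (S i)) ⊔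
        hostKraFactorOne ν (S a) := by
      rw [jointInv_unit]
      exact le_sup_of_le_left (le_iSup₂ (f := fun i (_ : i ∈ L) =>
        MeasurableSpace.invariants (S i)) i hi)
    exact (hu.mono hle le_rfl).eventuallyMeasurable_of_eventuallyEq hgu
  · exact ((h.measurable_hostKra (hS a)).mono le_sup_right le_rfl).mono le_nullAug le_rfl

theorem zshift_zshift {ℓ : ℕ} (m n : ZIdx ℓ) (ω : ShiftSpace ℓ) :
    zshift n (zshift m ω) = zshift (n * m) ω := by
  ext k j
  simp only [zshift_apply]
  rw [mul_assoc]

/-- The equivariant self-map of the shift space determined by a sequence of sets. -/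
def recoding {ℓ : ℕ} (D : ℕ → Set (ShiftSpace ℓ)) (ω : ShiftSpace ℓ) : ShiftSpace ℓ :=
  fun n j => (D j).indicator (fun _ => (1 : ℂ)) (zshift n ω)

theorem measurable_recoding {ℓ : ℕ} {D : ℕ → Set (ShiftSpace ℓ)}
    (hD : ∀ j, MeasurableSet (D j)) : Measurable (recoding D) :=
  measurable_pi_lambda _ fun n => measurable_pi_lambda _ fun j =>
    (measurable_const.indicator (hD j)).comp (zshift n).measurable

theorem recoding_zshift {ℓ : ℕ} (D : ℕ → Set (ShiftSpace ℓ)) (m : ZIdx ℓ) (ω : ShiftSpace ℓ) :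
    recoding D (zshift m ω) = zshift m (recoding D ω) := by
  ext n j
  rw [zshift_apply, recoding, recoding, zshift_zshift]

end Transport

/-! ### A structured, not yet ergodic, extension. -/

section Assembly

/-- The box factor of a system is realised as a factor of a (not necessarily ergodic) shift system
all of whose coordinates are invariant functions or generalised eigenfunctions. -/
theorem exists_structured_extension (d : ℕ) {X : Type*} [MeasurableSpace X] [StandardBorelSpace X]
    (μ : Measure X) [IsProbabilityMeasure μ] (T : Fin (d + 1) → X ≃ᵐ X) (hT : IsSystem μ T)
    {E : ℕ → Set X}
    (hE : ∀ j, IsBoxSet μ (Fin.snoc (α := fun _ => X ≃ᵐ X) T (T (Fin.last d))) (E j)) :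
    ∃ (ν : Measure (ShiftSpace (d + 1))) (_ : IsProbabilityMeasure ν)
      (q : ShiftSpace (d + 1) → ShiftSpace (d + 1)),
      (∀ i, MeasurePreserving (shiftGen i) ν ν) ∧
      MeasurePreserving q ν (μ.map (coding hT.commute fun j => (E j).indicator fun _ => (1 : ℂ))) ∧
      (∀ i ω, q (shiftGen i ω) = shiftGen i (q ω)) ∧
      ∀ n j, IsAEStruct ν shiftGen ((List.finRange d).map Fin.castSucc) (Fin.last d)
        fun ω : ShiftSpace (d + 1) => ω n j := by
  set L : List (Fin (d + 1)) := (List.finRange d).map Fin.castSucc with hL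
  set a := Fin.last d with ha
  have haL : a ∉ L := by
    rw [hL, List.mem_map]
    rintro ⟨i, -, hi⟩
    exact (Fin.castSucc_lt_last i).ne hi
  have hnd : L.Nodup := (List.nodup_finRange d).map (Fin.castSucc_injective d)
  set R : Fin (d + 2) → X ≃ᵐ X := Fin.snoc (α := fun _ => X ≃ᵐ X) T (T a) with hR
  have hRT : ∀ k, ∃ i, R k = T i := fun k => by
    refine Fin.lastCases ⟨a, by simp [hR]⟩ (fun i => ⟨i, by simp [hR]⟩) k
  have hRcomm : ∀ i j x, R i (R j x) = R j (R i x) := fun i j x => by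
    obtain ⟨i', hi⟩ := hRT i
    obtain ⟨j', hj⟩ := hRT j
    rw [hi, hj, hT.commute]
  have hRmp : ∀ i, MeasurePreserving (R i) μ μ := fun i => by
    obtain ⟨i', hi⟩ := hRT i
    rw [hi]; exact hT.measurePreserving i'
  -- In the reversed list the two copies of `T a` come first, hence outermost: they are the ones
  -- that survive on the box extension.
  have hRL : (List.ofFn R).reverse = [T a, T a] ++ (L.map T).reverse := by
    rw [List.ofFn_succ', List.ofFn_succ']
    simp [hR, hL, ha, Function.comp_def, List.ofFn_eq_map]
  obtain ⟨Y, _, _, ν₀, _, S, π, 𝒰, h⟩ := exists_isBoxExtension L.length (μ := μ) (T := T)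
    hT.commute hT.measurePreserving hnd rfl
  have hc := h.commute
  have hB : ∀ j, MeasurableSet[nullAug ν₀ (structAlg ν₀ S L a)] (π ⁻¹' E j) := fun j => by
    refine measurableSet_nullAug_of_aestronglyMeasurable ?_
    obtain ⟨hEm, hEb⟩ := hE j
    refine (h.aestronglyMeasurable_boxSpace haL (by omega) hRcomm hRmp hRL hEb).congr ?_
    filter_upwards [h.measurePreserving_fst.quasiMeasurePreserving.ae
      (indicatorConstLp_coeFn (p := 2) (hs := hEm) (hμs := measure_ne_top μ (E j)) (c := (1 : ℂ)))]
      with y hy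
    rw [hy]; rfl
  choose B hBm hBE using hB
  obtain ⟨g, hg, hgB⟩ := exists_seq_measurableSet_iSup_comap (𝒢 := structGen ν₀ S L a)
    ⟨fun _ => 1, measurable_const, Or.inr (isEig_const norm_one)⟩
    fun j => structAlg_le_iSup_comap ν₀ S L a _ (hBm j)
  set Φ := coding hc g with hΦ
  have hΦm : Measurable Φ := measurable_coding hc fun j => (hg j).1
  have hΦS : ∀ i y, Φ (S i y) = shiftGen i (Φ y) := coding_apply hc g
  have hD : ∀ j, ∃ D : Set (ShiftSpace (d + 1)), MeasurableSet D ∧ Φ ⁻¹' D = B j := fun j => by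
    have hle : ⨆ k, MeasurableSpace.comap (g k) inferInstance ≤
        MeasurableSpace.comap Φ inferInstance := by
      refine iSup_le fun k => ?_
      have e : g k = (fun ω : ShiftSpace (d + 1) => ω 1 k) ∘ Φ := by
        ext y; simp [hΦ, coding, zact_one]
      rw [e, ← MeasurableSpace.comap_comp]
      exact MeasurableSpace.comap_mono (Measurable.comap_le (by fun_prop))
    exact hle _ (hgB j)
  choose D hDm hDB using hD
  -- B j agrees with π⁻¹(E j) up to a null set and is read off from the coding Φ. Along whole
  -- orbits, `recoding D` thus recovers the coding of π y; there are countably many n and j.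
  have hqΦ : ∀ᵐ y ∂ν₀, recoding D (Φ y) =
      coding hT.commute (fun j => (E j).indicator fun _ => (1 : ℂ)) (π y) := by
    have h1 : ∀ᵐ y ∂ν₀, ∀ (n : ZIdx (d + 1)) (j : ℕ),
        zact hc n y ∈ π ⁻¹' E j ↔ zact hc n y ∈ B j := by
      refine ae_all_iff.2 fun n => ae_all_iff.2 fun j => ?_
      exact (measurePreserving_zact hc h.measurePreserving n).quasiMeasurePreserving.ae
        (eventuallyEq_set.1 (hBE j))
    filter_upwards [h1] with y hy
    ext n j
    have h2 := hy n j
    rw [← hDB, Set.mem_preimage, Set.mem_preimage, map_zact hc hT.commute h.equivariant, hΦ,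
      coding_zact, ← hΦ] at h2
    simp only [recoding, coding]
    by_cases hx : zact hT.commute n (π y) ∈ E j
    · rw [Set.indicator_of_mem hx, Set.indicator_of_mem (h2.1 hx)]
    · rw [Set.indicator_of_notMem hx, Set.indicator_of_notMem fun h3 => hx (h2.2 h3)]
  have hqm : Measurable (recoding D) := measurable_recoding hDm
  have hpm : Measurable (coding hT.commute fun j => (E j).indicator fun _ => (1 : ℂ)) :=
    measurable_coding _ fun j => measurable_const.indicator (hE j).1
  refine ⟨ν₀.map Φ, Measure.isProbabilityMeasure_map hΦm.aemeasurable, recoding D,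
    fun i => measurePreserving_of_semiconj hΦm (h.measurePreserving i) (shiftGen i).measurable
      (hΦS i), ⟨hqm, ?_⟩, fun i ω => recoding_zshift D _ ω, fun n j => ?_⟩
  · rw [Measure.map_map hqm hΦm, Measure.map_congr (f := recoding D ∘ Φ)
        (g := (coding hT.commute fun j => (E j).indicator fun _ => (1 : ℂ)) ∘ π) hqΦ]
    exact (hpm.measurePreserving μ |>.comp h.measurePreserving_fst).map_eq
  -- Pulled back by Φ, the coordinate (n, j) is g j composed with the action of n. The action
  -- commutes with the S i, so this is again invariant or an eigenfunction.
  · have hcoord : Measurable fun ω : ShiftSpace (d + 1) => ω n j := by fun_prop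
    rcases (hg j).2 with ⟨i, hi, hinv⟩ | hEig
    · refine Or.inl ⟨i, hi, (ae_map_iff hΦm.aemeasurable (measurableSet_eq_fun
        (hcoord.comp (shiftGen i).measurable) hcoord)).2 (Eventually.of_forall fun y => ?_)⟩
      simp only [Function.comp]
      rw [← hΦS, hΦ, coding, coding, zact_commute, hinv]
    · exact Or.inr (IsEig.map hΦm (hΦS a) hcoord
        (hEig.comp (measurePreserving_zact hc h.measurePreserving n) (zact_commute hc n a)))

end Assembly

end

/-! ### Passage to an ergodic component. -/

theorem theorem4p1 (d : ℕ) {X : Type*} [MeasurableSpace X] [StandardBorelSpace X]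
    (μ : Measure X) [IsProbabilityMeasure μ] (T : Fin (d + 1) → X ≃ᵐ X)
    (hT : IsSystem μ T) (hErg : IsJointlyErgodic μ T) :
    ∃ (Y : Type) (mY : MeasurableSpace Y) (_ : StandardBorelSpace Y)
      (ν : Measure Y) (_ : IsProbabilityMeasure ν) (S : Fin (d + 1) → Y ≃ᵐ Y),
      IsSystem ν S ∧ IsJointlyErgodic ν S ∧
      IsExtensionOfFactor (boxFactor μ (Fin.snoc (α := fun _ => X ≃ᵐ X) T (T (Fin.last d))))
        ν S μ T ∧
      EqModNull ν mY
        ((⨆ i : Fin d, MeasurableSpace.invariants (S i.castSucc)) ⊔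
          hostKraFactorOne ν (S (Fin.last d))) := by
  obtain ⟨E, hE, hgen⟩ := exists_seq_isBoxSet (μ := μ)
    (Fin.snoc (α := fun _ => X ≃ᵐ X) T (T (Fin.last d)))
  obtain ⟨ν₁, _, q, hS, hq, hqe, hcoord⟩ := exists_structured_extension d μ T hT hE
  set g : ℕ → X → ℂ := fun j => (E j).indicator fun _ => (1 : ℂ) with hg
  have hgm : ∀ j, Measurable (g j) := fun j => measurable_const.indicator (hE j).1
  set p := coding hT.commute g with hp
  have hpm : Measurable p := measurable_coding _ hgm
  have hW : IsProbabilityMeasure (μ.map p) := Measure.isProbabilityMeasure_map hpm.aemeasurable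
  have hWsys := isSystem_map_coding hT hgm
  have hWerg := hErg.map_coding hT hgm
  have hκq := condExpKernel_map_eq_of_ergodic hS hWsys.measurePreserving
    (fun F hF => hWerg F hF.1 hF.2) hq fun i => Eventually.of_forall (hqe i)
  have hκc : ∀ᵐ ω ∂ν₁, ∀ (n : ZIdx (d + 1)) (j : ℕ),
      IsAEStruct (ProbabilityTheory.condExpKernel ν₁ (jointInv shiftGen) ω) shiftGen
        ((List.finRange d).map Fin.castSucc) (Fin.last d) fun ω : ShiftSpace (d + 1) => ω n j :=
    ae_all_iff.2 fun n => ae_all_iff.2 fun j => (hcoord n j).ae_condExpKernel _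
  -- Invariance, ergodicity, the projection to the factor and structuredness of all coordinates each
  -- hold for almost every component; one component with all four is the extension.
  obtain ⟨ω, h1, h2, h3, h4⟩ := (((ae_measurePreserving_condExpKernel hS).and
    ((ae_ergodic_condExpKernel hS).and (hκq.and hκc)))).exists
  have hRT : ∀ k, ∃ i, (Fin.snoc (α := fun _ => X ≃ᵐ X) T (T (Fin.last d)) :
      Fin (d + 2) → X ≃ᵐ X) k = T i := fun k =>
    Fin.lastCases ⟨Fin.last d, by simp⟩ (fun i => ⟨i, by simp⟩) k
  refine ⟨ShiftSpace (d + 1), inferInstance, inferInstance,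
    ProbabilityTheory.condExpKernel ν₁ (jointInv shiftGen) ω, inferInstance, shiftGen,
    ⟨fun i j ω => zshift_commute _ _ ω, h1⟩, fun F hF hinv => h2 F ⟨hF, hinv⟩,
    ⟨ShiftSpace (d + 1), inferInstance, inferInstance, μ.map p, hW, shiftGen, p, q, hWsys,
      isFactorMap_coding hT hgm, eqModNull_comap_coding hT (fun k => ?_) (fun k j x => ?_) hE hgen,
      ⟨h3, fun i => Eventually.of_forall (hqe i)⟩⟩, eqModNull_iff.2 ⟨?_, ?_⟩⟩
  · obtain ⟨i, hi⟩ := hRT k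
    rw [hi]; exact hT.measurePreserving i
  · obtain ⟨i, hi⟩ := hRT k
    rw [hi]; exact hT.commute i j x
  · have e : ⨆ i : Fin d, MeasurableSpace.invariants (shiftGen (ℓ := d + 1) i.castSucc) =
        ⨆ i ∈ (List.finRange d).map Fin.castSucc,
          MeasurableSpace.invariants (shiftGen (ℓ := d + 1) i) := by
      simp [iSup_exists, iSup_comm (ι := Fin (d + 1))]
    rw [e]
    -- The Borel sets are generated by the countably many coordinates, each measurable modulo null
    -- sets for the structured σ-algebra; so the identity map is measurable too, which is the
    -- nontrivial inclusion.
    have hid : Measurable[nullAug (ProbabilityTheory.condExpKernel ν₁ (jointInv shiftGen) ω)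
        ((⨆ i ∈ (List.finRange d).map Fin.castSucc, MeasurableSpace.invariants (shiftGen i)) ⊔
          hostKraFactorOne (ProbabilityTheory.condExpKernel ν₁ (jointInv shiftGen) ω) (shiftGen (Fin.last d)))]
        (fun z : ShiftSpace (d + 1) => z) :=
      @measurable_pi_lambda _ _ _ (_) _ _ fun n => @measurable_pi_lambda _ _ _ (_) _ _ fun j =>
        (h4 n j).measurable_nullAug h1 (by fun_prop)
    exact fun F hF => hid hF
  · exact (sup_le (iSup_le fun i => MeasurableSpace.invariants_le _) (boxFactor_le _ _)).trans
      le_nullAug
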